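/- **Setting.** Let $\mathcal C$ be a unitary fusion category, i.e. a rigid $\mathbb C$-linear abelian monoidal category with finite-dimensional morphism spaces, in which every object is a finite direct sum of simple objects, there are finitely many isomorphism classes of simple objects and the unit $\mathbb 1$ is simple, together with a C*-category structure (a conjugate-linear involution $f\mapsto f^*$ on morphisms and C*-norms, with $f^*f$ positive) for which $(f\otimes g)^*=f^*\otimes g^*$ and the associators and unitors are unitary. Let $X\in\mathcal C$ be strongly tensor generating: there is $n\ge 1$ such that every simple object is a direct summand of $X^{\otimes n}$. The *fusion spin chain* $A=A(\mathcal C,X)$ assigns to each finite nonempty interval $I\subset\mathbb Z$ the finite-dimensional C*-algebra $A_I=\mathrm{End}_{\mathcal C}(X^{\otimes |I|})$, with inclusions $A_{[a,b]}\hookrightarrow A_{[c,d]}$, $w\mapsto 1_X^{\otimes (a-c)}\otimes w\otimes 1_X^{\otimes (d-b)}$ for $[a,b]\subseteq[c,d]$ (up to the canonical associativity isomorphisms); $A$ also denotes the C*-algebra colimit, in which the $A_I$ are regarded as subalgebras. $\mathrm{QCA}(A)$ is the group of $*$-automorphisms $\alpha$ of $A$ for which there is $l\ge 0$ with $\alpha^{\pm1}(A_{[a,b]})\subseteq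 A_{[a-l,b+l]}$ for all $[a,b]$. A depth one circuit is a QCA of the form $\alpha(w)=(\prod_i u_i)\,w\,(\prod_i u_i)^*$ for local $w$, where $\{I_i\}_{i\in\mathbb N}$ is a partition of $\mathbb Z$ into intervals of bounded length and $u_i\in A_{I_i}$ is unitary; $\mathrm{FDQC}(A)$ is the subgroup of $\mathrm{QCA}(A)$ of compositions of depth one circuits. If $A$ has a unique tracial state $\mathrm{tr}$, put $\mathcal A_x=\bigl(\bigcup_{[a,b],\,b\le x}A_{[a,b]}\bigr)''\subseteq B(L^2(A,\mathrm{tr}))$ for $x\in\mathbb Z$, in the GNS representation of $\mathrm{tr}$. Every QCA $\alpha$ then preserves $\mathrm{tr}$ and extends to $A''$ by the unitary implementing it on $L^2(A,\mathrm{tr})$; write $\alpha(\mathcal A_x)$ for the image. $A$ has the *finite index property* if every $\mathcal A_x$ is an infinite-dimensional factor and the Jones index $[\mathcal A_z:\mathcal A_x]=\dim_{\mathcal A_x}L^2(\mathcal A_z)$ is finite for all $x<z$. **Theorem.** Suppose moreover that $X\not\cong\mathbb 1$. Then 1. $A=A(\mathcal C,X)$ has a unique tracial state and satisfies the finite index property;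 2. every $\mathcal A_x$ ($x\in\mathbb Z$) is a II$_1$ factor; 3. for every $\alpha\in\mathrm{QCA}(A)$ there are integers $y\le x$ with $\mathcal A_y\subseteq\alpha(\mathcal A_x)$; $\mathrm{FDQC}(A)$ is normal in $\mathrm{QCA}(A)$; and there is a unique group homomorphism $$\mathrm{ind}:\mathrm{QCA}(A)/\mathrm{FDQC}(A)\to\mathbb R^\times_{+}$$ such that $$\mathrm{ind}([\alpha])=\left(\frac{[\alpha(\mathcal A_x):\mathcal A_y]}{[\mathcal A_x:\mathcal A_y]}\right)^{1/2}$$ for all $\alpha\in\mathrm{QCA}(A)$ and all integers $y\le x$ with $\mathcal A_y\subseteq\alpha(\mathcal A_x)$. -/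

import Mathlib

/-! ### Inductive limits of C⋆-algebras -/

section CStarLimit

open UniformSpace

/-- The completion of a normed ⋆-algebra with C⋆-norm is a C⋆-algebra. -/
noncomputable abbrev completionCStarAlgebra (D : Type*) [NormedRing D] [NormedAlgebra ℂ D]
    [StarRing D] [CStarRing D] [StarModule ℂ D] : CStarAlgebra (Completion D) :=
  have hu : UniformContinuous (star : D → D) := star_isometry.uniformContinuous
  letI : Star (Completion D) := ⟨Completion.map star⟩
  have hc : Continuous (star : Completion D → Completion D) := Completion.continuous_map
  have hs : ∀ d : D, star (d : Completion D) = ((star d : D) : Completion D) :=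
    fun d => Completion.map_coe hu d
  letI : StarRing (Completion D) :=
    { star_involutive := fun x => by
        induction x using Completion.induction_on with
        | hp => exact isClosed_eq (hc.comp hc) continuous_id
        | ih a => rw [hs, hs, star_star]
      star_mul := fun x y => by
        induction x, y using Completion.induction_on₂ with
        | hp =>
          exact isClosed_eq (hc.comp (continuous_fst.mul continuous_snd))
            ((hc.comp continuous_snd).mul (hc.comp continuous_fst))
        | ih a b => rw [← Completion.coe_mul, hs, hs, hs, star_mul, Completion.coe_mul]
      star_add := fun x y => by
        induction x, y using Completion.induction_on₂ with
        | hp =>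
          exact isClosed_eq (hc.comp (continuous_fst.add continuous_snd))
            ((hc.comp continuous_fst).add (hc.comp continuous_snd))
        | ih a b => rw [← Completion.coe_add, hs, hs, hs, star_add, Completion.coe_add] }
  { (inferInstance : NormedRing (Completion D)), (inferInstance : StarRing (Completion D)),
    (inferInstance : Algebra ℂ (Completion D)) with
    norm_mul_self_le := fun x => by
      induction x using Completion.induction_on with
      | hp =>
        exact isClosed_le (continuous_norm.mul continuous_norm)
          (continuous_norm.comp (hc.mul continuous_id))
      | ih a =>
        rw [hs, ← Completion.coe_mul, Completion.norm_coe, Completion.norm_coe]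
        exact CStarRing.norm_mul_self_le a
    complete := (inferInstance : CompleteSpace (Completion D)).complete
    norm_smul_le := norm_smul_le
    star_smul := fun c x => by
      induction x using Completion.induction_on with
      | hp =>
        exact isClosed_eq (hc.comp (continuous_const_smul c)) ((continuous_const_smul (star c)).comp hc)
      | ih a => rw [← Completion.coe_smul, hs, hs, star_smul, Completion.coe_smul] }

variable {ι : Type*} [Preorder ι] [IsDirectedOrder ι] [Nonempty ι]
  {G : ι → Type*} [∀ i, CStarAlgebra (G i)]
  (f : ∀ i j, i ≤ j → (G i →⋆ₐ[ℂ] G j)) [DirectedSystem G (f · · ·)]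
  (hf : ∀ i j h, Function.Injective (f i j h))

/-- The algebraic colimit of a directed system of C⋆-algebras with injective connecting maps. -/
def AlgColimit (_hf : ∀ i j h, Function.Injective (f i j h)) : Type _ := DirectLimit G f

namespace AlgColimit

noncomputable instance : Ring (AlgColimit f hf) := inferInstanceAs (Ring (DirectLimit G f))
noncomputable instance : StarRing (AlgColimit f hf) := inferInstanceAs (StarRing (DirectLimit G f))
noncomputable instance : Algebra ℂ (AlgColimit f hf) :=
  inferInstanceAs (Algebra ℂ (DirectLimit G f))

/-- The canonical ⋆-homomorphism into the algebraic colimit. -/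
noncomputable def of (i : ι) : G i →⋆ₐ[ℂ] AlgColimit f hf where
  __ := DirectLimit.Algebra.of (R := ℂ) G f i
  map_star' x := (DirectLimit.star_def (f := f) i x).symm

lemma ind {P : AlgColimit f hf → Prop} (h : ∀ i x, P (of f hf i x)) (x) : P x :=
  DirectLimit.induction f h x

lemma ind₂ {P : AlgColimit f hf → AlgColimit f hf → Prop}
    (h : ∀ i x y, P (of f hf i x) (of f hf i y)) (x y) : P x y :=
  DirectLimit.induction₂ f h x y

/-- The norm of an element of the algebraic colimit is the norm of any representative. -/
noncomputable instance : Norm (AlgColimit f hf) :=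
  ⟨DirectLimit.lift f (fun _ x => ‖x‖)
    (fun i j h x => (NonUnitalStarAlgHom.norm_map (f i j h) (hf i j h) x).symm)⟩

lemma norm_of (i : ι) (x : G i) : ‖of f hf i x‖ = ‖x‖ := rfl

lemma of_map {i j : ι} (h : i ≤ j) (x : G i) : of f hf j (f i j h x) = of f hf i x :=
  DirectLimit.Algebra.of_f (R := ℂ) (G := G) (f := f) h x

lemma core : NormedSpace.Core ℂ (AlgColimit f hf) where
  norm_nonneg := ind f hf fun i x => by rw [norm_of]; exact norm_nonneg x
  norm_smul c := ind f hf fun i x => by rw [← map_smul, norm_of, norm_of, norm_smul]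
  norm_triangle := ind₂ f hf fun i x y => by
    rw [← map_add, norm_of, norm_of, norm_of]; exact norm_add_le x y
  norm_eq_zero_iff := ind f hf fun i x => by
    rw [norm_of, norm_eq_zero]
    constructor
    · rintro rfl; exact map_zero _
    · intro h
      rw [← norm_eq_zero, ← norm_of f hf, h, ← map_zero (of f hf i), norm_of, norm_zero]

noncomputable instance : NormedRing (AlgColimit f hf) where
  __ := NormedAddCommGroup.ofCore (core f hf)
  __ := (inferInstance : Ring (AlgColimit f hf))
  norm_mul_le := ind₂ f hf fun i x y => by
    rw [← map_mul, norm_of, norm_of, norm_of]; exact norm_mul_le x y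

noncomputable instance : NormedAlgebra ℂ (AlgColimit f hf) where
  norm_smul_le c x := ((core f hf).norm_smul c x).le

instance : CStarRing (AlgColimit f hf) where
  norm_mul_self_le := ind f hf fun i x => by
    rw [← map_star, ← map_mul, norm_of, norm_of]; exact CStarRing.norm_mul_self_le x

instance : StarModule ℂ (AlgColimit f hf) where
  star_smul c := ind f hf fun i x => by
    rw [← map_smul, ← map_star, ← map_star, star_smul, map_smul]

end AlgColimit

/-- The colimit, in C⋆-algebras, of a directed system with injective connecting maps: the
completion of the algebraic colimit in its unique C⋆-norm. -/
def CStarColimit : Type _ := Completion (AlgColimit f hf)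

namespace CStarColimit

noncomputable instance : CStarAlgebra (CStarColimit f hf) :=
  completionCStarAlgebra (AlgColimit f hf)

/-- The canonical ⋆-homomorphism into the colimit. -/
noncomputable def of (i : ι) : G i →⋆ₐ[ℂ] CStarColimit f hf where
  toFun x := ((AlgColimit.of f hf i x : AlgColimit f hf) : Completion (AlgColimit f hf))
  map_one' := by rw [map_one]; rfl
  map_mul' x y := by rw [map_mul]; exact Completion.coe_mul _ _
  map_zero' := by rw [map_zero]; rfl
  map_add' x y := by rw [map_add]; exact Completion.coe_add _ _
  commutes' c := by rw [AlgHomClass.commutes]; rfl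
  map_star' x := by
    rw [map_star]
    exact (Completion.map_coe (star_isometry (E := AlgColimit f hf)).uniformContinuous _).symm

lemma of_map {i j : ι} (h : i ≤ j) (x : G i) : of f hf j (f i j h x) = of f hf i x :=
  congrArg (fun z : AlgColimit f hf => (z : Completion (AlgColimit f hf)))
    (AlgColimit.of_map f hf h x)

lemma dense_of : Dense (⋃ i, Set.range (of f hf i)) := by
  refine (Completion.denseRange_coe (α := AlgColimit f hf)).mono ?_
  rintro _ ⟨z, rfl⟩
  induction z using AlgColimit.ind with
  | h i x => exact Set.mem_iUnion.2 ⟨i, x, rfl⟩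

end CStarColimit

end CStarLimit

/-! ### Unitary fusion categories -/

section UnitaryFusion

open CategoryTheory MonoidalCategory Limits

universe v u

attribute [local instance] Abelian.hasFiniteBiproducts

/-- A complex linear dagger category with C⋆-norms on its morphism spaces. Note that `f ≫ dag f`
is `f⋆ ∘ f` in the usual order of composition. Completeness of the morphism spaces is not listed:
it is automatic below, where they are finite-dimensional. -/
class CStarCategory (C : Type u) [Category.{v} C] [Preadditive C] [Linear ℂ C] where
  /-- The dagger (adjoint) of a morphism. -/
  dag : ∀ {Y Z : C}, (Y ⟶ Z) → (Z ⟶ Y)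
  dag_dag : ∀ {Y Z : C} (f : Y ⟶ Z), dag (dag f) = f
  dag_comp : ∀ {W Y Z : C} (f : W ⟶ Y) (g : Y ⟶ Z), dag (f ≫ g) = dag g ≫ dag f
  dag_add : ∀ {Y Z : C} (f g : Y ⟶ Z), dag (f + g) = dag f + dag g
  dag_smul : ∀ {Y Z : C} (c : ℂ) (f : Y ⟶ Z), dag (c • f) = star c • dag f
  /-- The C⋆-norm of a morphism. -/
  nrm : ∀ {Y Z : C}, (Y ⟶ Z) → ℝ
  nrm_nonneg : ∀ {Y Z : C} (f : Y ⟶ Z), 0 ≤ nrm f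
  nrm_eq_zero : ∀ {Y Z : C} (f : Y ⟶ Z), nrm f = 0 ↔ f = 0
  nrm_add_le : ∀ {Y Z : C} (f g : Y ⟶ Z), nrm (f + g) ≤ nrm f + nrm g
  nrm_smul : ∀ {Y Z : C} (c : ℂ) (f : Y ⟶ Z), nrm (c • f) = ‖c‖ * nrm f
  nrm_comp_le : ∀ {W Y Z : C} (f : W ⟶ Y) (g : Y ⟶ Z), nrm (f ≫ g) ≤ nrm f * nrm g
  /-- The C⋆-identity. -/
  nrm_comp_dag : ∀ {Y Z : C} (f : Y ⟶ Z), nrm (f ≫ dag f) = nrm f ^ 2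
  /-- `f⋆ ∘ f` is a positive element of the endomorphism algebra of the source of `f`. -/
  comp_dag_pos : ∀ {Y Z : C} (f : Y ⟶ Z), ∃ g : Y ⟶ Y, f ≫ dag f = g ≫ dag g

/-- The tensor product is a ⋆-functor, and the associators and unitors are unitary. -/
class UnitaryMonoidal (C : Type u) [Category.{v} C] [Preadditive C] [Linear ℂ C]
    [MonoidalCategory C] [CStarCategory C] : Prop where
  dag_tensor : ∀ {Y Z Y' Z' : C} (f : Y ⟶ Z) (g : Y' ⟶ Z'),
    CStarCategory.dag (f ⊗ₘ g) = CStarCategory.dag f ⊗ₘ CStarCategory.dag g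
  dag_associator : ∀ W Y Z : C, CStarCategory.dag (α_ W Y Z).hom = (α_ W Y Z).inv
  dag_leftUnitor : ∀ Y : C, CStarCategory.dag (λ_ Y).hom = (λ_ Y).inv
  dag_rightUnitor : ∀ Y : C, CStarCategory.dag (ρ_ Y).hom = (ρ_ Y).inv

/-- A rigid complex linear monoidal abelian category is *fusion* if its morphism spaces are
finite-dimensional, every object is a finite direct sum of simple objects, there are finitely many
isomorphism classes of simple objects, and the monoidal unit is simple. -/
class IsFusion (C : Type u) [Category.{v} C] [Abelian C] [Linear ℂ C] [MonoidalCategory C]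
    [MonoidalPreadditive C] [MonoidalLinear ℂ C] [RigidCategory C] : Prop where
  finiteDimensional_hom : ∀ Y Z : C, FiniteDimensional ℂ (Y ⟶ Z)
  semisimple : ∀ Y : C, ∃ (n : ℕ) (S : Fin n → C), (∀ i, Simple (S i)) ∧ Nonempty (Y ≅ ⨁ S)
  finitely_many_simples : ∃ (n : ℕ) (S : Fin n → C),
    ∀ T : C, Simple T → ∃ i, Nonempty (T ≅ S i)
  simple_unit : Simple (𝟙_ C)

/-- A *unitary fusion category*: a fusion category with a compatible C⋆-structure. -/
class UnitaryFusionCategory (C : Type u) [Category.{v} C] [Abelian C] [Linear ℂ C]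
    [MonoidalCategory C] [MonoidalPreadditive C] [MonoidalLinear ℂ C] [RigidCategory C] extends
    CStarCategory C, UnitaryMonoidal C, IsFusion C

variable {C : Type u} [Category.{v} C]

/-- The tensor power `X ⊗ ⋯ ⊗ X` (`n` factors, bracketed to the left). -/
def tpow [MonoidalCategory C] (X : C) : ℕ → C
  | 0 => 𝟙_ C
  | n + 1 => tpow X n ⊗ X

/-- `X` is *strongly tensor generating*: for some `n > 0` every simple object is a direct summand
of the `n`-th tensor power of `X`. -/
def StronglyTensorGenerating [Abelian C] [MonoidalCategory C] (X : C) : Prop :=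
  ∃ n : ℕ, 0 < n ∧ ∀ S : C, Simple S →
    ∃ (i : S ⟶ tpow X n) (r : tpow X n ⟶ S), i ≫ r = 𝟙 S

section TensorPowers

variable [MonoidalCategory C] (X : C)

/-- The canonical isomorphism `X^p ⊗ X^n ≅ X^(p+n)` built from associators and unitors. -/
def tpowMulAux (p : ℕ) : ∀ n : ℕ, tpow X p ⊗ tpow X n ≅ tpow X (p + n)
  | 0 => ρ_ (tpow X p)
  | n + 1 => (α_ (tpow X p) (tpow X n) X).symm ≪≫ whiskerRightIso (tpowMulAux p n) X

/-- The canonical isomorphism `X^p ⊗ X^n ≅ X^m` for `p + n = m`. -/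
def tpowMul {p n m : ℕ} (h : p + n = m) : tpow X p ⊗ tpow X n ≅ tpow X m :=
  tpowMulAux X p n ≪≫ eqToIso (by rw [h])

lemma tpowMul_zero_right {n : ℕ} (h : n + 0 = n) : tpowMul X h = ρ_ (tpow X n) := by
  ext
  exact Category.comp_id _

lemma tpowMul_succ {p n m : ℕ} (h : p + n = m) (h' : p + (n + 1) = m + 1) :
    tpowMul X h' = (α_ (tpow X p) (tpow X n) X).symm ≪≫ whiskerRightIso (tpowMul X h) X := by
  subst h
  ext
  simp only [tpowMul, tpowMulAux, eqToIso_refl, Iso.trans_hom, Iso.refl_hom]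
  erw [Category.comp_id]
  simp
  rfl

lemma tpowMul_zero_left : ∀ {n : ℕ} (h : 0 + n = n), (tpowMul X h).hom = (λ_ (tpow X n)).hom
  | 0, h => by
    rw [tpowMul_zero_right]; exact unitors_equal.symm
  | n + 1, h => by
    rw [tpowMul_succ X (Nat.zero_add n)]
    simp only [Iso.trans_hom, Iso.symm_hom, whiskerRightIso_hom,
      tpowMul_zero_left (Nat.zero_add n)]
    simp [tpow]

lemma tpowMul_assoc {p n q a b c : ℕ} (h₁ : p + n = a) (h₂ : a + q = b) (h₃ : n + q = c)
    (h₄ : p + c = b) :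
    (tpowMul X h₁).hom ▷ tpow X q ≫ (tpowMul X h₂).hom =
      (α_ (tpow X p) (tpow X n) (tpow X q)).hom ≫
        tpow X p ◁ (tpowMul X h₃).hom ≫ (tpowMul X h₄).hom := by
  subst h₁ h₃ h₂
  induction q with
  | zero =>
    rw [tpowMul_zero_right, tpowMul_zero_right]
    simp [tpow]
  | succ q ih =>
    have h5 : p + (n + q) = p + n + q := by omega
    rw [tpowMul_succ X (rfl : p + n + q = p + n + q), tpowMul_succ X (rfl : n + q = n + q),
      tpowMul_succ X h5]
    have := congrArg (· ▷ X) (ih h5)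
    simp [tpow] at this ⊢
    rw [this]
    simp

end TensorPowers

set_option linter.unusedSectionVars false

section Coherence

variable [MonoidalCategory C] {P Q R PQ QR T : C} (e₁ : P ⊗ Q ≅ PQ) (e₂ : PQ ⊗ R ≅ T)
  (e₃ : Q ⊗ R ≅ QR) (e₄ : P ⊗ QR ≅ T)

lemma coherence_iso (H : e₁.hom ▷ R ≫ e₂.hom = (α_ P Q R).hom ≫ P ◁ e₃.hom ≫ e₄.hom) :
    e₂ = (whiskerRightIso e₁ R).symm ≪≫ α_ P Q R ≪≫ whiskerLeftIso P e₃ ≪≫ e₄ := by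
  ext
  simp [← H]

lemma coherence_RR (H : e₁.hom ▷ R ≫ e₂.hom = (α_ P Q R).hom ≫ P ◁ e₃.hom ≫ e₄.hom)
    (w : P ⟶ P) :
    e₂.inv ≫ (e₁.inv ≫ w ▷ Q ≫ e₁.hom) ▷ R ≫ e₂.hom = e₄.inv ≫ w ▷ QR ≫ e₄.hom := by
  obtain rfl := coherence_iso e₁ e₂ e₃ e₄ H
  have h : P ◁ e₃.inv ≫ w ▷ (Q ⊗ R) ≫ P ◁ e₃.hom ≫ e₄.hom = w ▷ QR ≫ e₄.hom := by
    rw [whisker_exchange_assoc]; simp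
  simpa using h

lemma coherence_LL (H : e₁.hom ▷ R ≫ e₂.hom = (α_ P Q R).hom ≫ P ◁ e₃.hom ≫ e₄.hom)
    (w : R ⟶ R) :
    e₄.inv ≫ P ◁ (e₃.inv ≫ Q ◁ w ≫ e₃.hom) ≫ e₄.hom = e₂.inv ≫ PQ ◁ w ≫ e₂.hom := by
  obtain rfl := coherence_iso e₁ e₂ e₃ e₄ H
  simp [whisker_exchange_assoc]

lemma coherence_LR (H : e₁.hom ▷ R ≫ e₂.hom = (α_ P Q R).hom ≫ P ◁ e₃.hom ≫ e₄.hom)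
    (w : Q ⟶ Q) :
    e₄.inv ≫ P ◁ (e₃.inv ≫ w ▷ R ≫ e₃.hom) ≫ e₄.hom =
      e₂.inv ≫ (e₁.inv ≫ P ◁ w ≫ e₁.hom) ▷ R ≫ e₂.hom := by
  obtain rfl := coherence_iso e₁ e₂ e₃ e₄ H
  simp

lemma coherence_comm {e : P ⊗ Q ≅ PQ} (w : P ⟶ P) (z : Q ⟶ Q) :
    (e.inv ≫ P ◁ z ≫ e.hom) ≫ (e.inv ≫ w ▷ Q ≫ e.hom) =
      (e.inv ≫ w ▷ Q ≫ e.hom) ≫ (e.inv ≫ P ◁ z ≫ e.hom) := by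
  simp [whisker_exchange_assoc]

lemma coherence_unit_right (w : P ⟶ P) : (ρ_ P).inv ≫ w ▷ 𝟙_ C ≫ (ρ_ P).hom = w := by simp

lemma coherence_unit_left (w : P ⟶ P) : (λ_ P).inv ≫ 𝟙_ C ◁ w ≫ (λ_ P).hom = w := by simp

end Coherence

section EndAlgebra

open CStarCategory

variable [Abelian C] [Linear ℂ C] [MonoidalCategory C] [MonoidalPreadditive C]
  [MonoidalLinear ℂ C] [RigidCategory C] [UnitaryFusionCategory C]

noncomputable instance endNorm (Y : C) : Norm (End Y) := ⟨fun f => nrm (C := C) f⟩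

lemma endCore (Y : C) : NormedSpace.Core ℂ (End Y) where
  norm_nonneg f := nrm_nonneg (C := C) f
  norm_smul c f := nrm_smul (C := C) c f
  norm_triangle f g := nrm_add_le (C := C) f g
  norm_eq_zero_iff f := nrm_eq_zero (C := C) f

/-- The endomorphism algebra of an object of a unitary fusion category, as a C⋆-algebra. -/
noncomputable instance endCStarAlgebra (Y : C) : CStarAlgebra (End Y) :=
  letI i₁ : NormedRing (End Y) :=
    { NormedAddCommGroup.ofCore (endCore Y), (inferInstance : Ring (End Y)) with
      norm_mul_le := fun f g => (nrm_comp_le (C := C) g f).trans_eq (mul_comm _ _) }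
  letI i₂ : NormedAlgebra ℂ (End Y) :=
    { (inferInstance : Algebra ℂ (End Y)) with
      norm_smul_le := fun c f => (nrm_smul (C := C) c f).le }
  letI i₃ : StarRing (End Y) :=
    { star := fun f => dag (C := C) f
      star_involutive := fun f => dag_dag (C := C) f
      star_mul := fun f g => dag_comp (C := C) g f
      star_add := fun f g => dag_add (C := C) f g }
  haveI : FiniteDimensional ℂ (End Y) := IsFusion.finiteDimensional_hom Y Y
  { i₁, i₂, i₃ with
    complete := (FiniteDimensional.complete ℂ (End Y)).complete
    norm_mul_self_le := fun f => by
      refine le_of_eq ?_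
      rw [← sq]
      exact (nrm_comp_dag (C := C) f).symm
    star_smul := fun c f => dag_smul (C := C) c f }

lemma end_star_def {Y : C} (f : End Y) : star f = dag (C := C) f := rfl

instance (Y : C) : FiniteDimensional ℂ (End Y) := IsFusion.finiteDimensional_hom Y Y

lemma dag_id (Y : C) : dag (𝟙 Y) = 𝟙 Y := star_one (End Y)

lemma dag_whiskerRight {Y Y' : C} (f : Y ⟶ Y') (Z : C) : dag (f ▷ Z) = dag f ▷ Z := by
  rw [← tensorHom_id, UnitaryMonoidal.dag_tensor, dag_id, tensorHom_id]

lemma dag_whiskerLeft {Y Y' : C} (f : Y ⟶ Y') (Z : C) : dag (Z ◁ f) = Z ◁ dag f := by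
  rw [← id_tensorHom, UnitaryMonoidal.dag_tensor, dag_id, id_tensorHom]

lemma dag_eqToHom {Y Z : C} (h : Y = Z) : dag (eqToHom h) = eqToHom h.symm := by
  subst h; exact dag_id Y

lemma dag_tpowMulAux_hom (X : C) (p : ℕ) :
    ∀ n : ℕ, dag (tpowMulAux X p n).hom = (tpowMulAux X p n).inv
  | 0 => UnitaryMonoidal.dag_rightUnitor _
  | n + 1 => by
    have h : dag (α_ (tpow X p) (tpow X n) X).inv = (α_ (tpow X p) (tpow X n) X).hom := by
      rw [← UnitaryMonoidal.dag_associator, dag_dag]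
    change dag ((α_ (tpow X p) (tpow X n) X).inv ≫ (tpowMulAux X p n).hom ▷ X) =
      (tpowMulAux X p n).inv ▷ X ≫ (α_ (tpow X p) (tpow X n) X).hom
    rw [dag_comp, dag_whiskerRight, dag_tpowMulAux_hom X p n, h]

lemma dag_tpowMul_hom (X : C) {p n m : ℕ} (h : p + n = m) :
    dag (tpowMul X h).hom = (tpowMul X h).inv := by
  simp [tpowMul, dag_comp, dag_tpowMulAux_hom, dag_eqToHom]

lemma dag_tpowMul_inv (X : C) {p n m : ℕ} (h : p + n = m) :
    dag (tpowMul X h).inv = (tpowMul X h).hom := by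
  rw [← dag_tpowMul_hom, dag_dag]

/-- `w ↦ w ⊗ 1^{⊗ q}`, from `End (X^n)` to `End (X^m)` where `n + q = m`. -/
noncomputable def embR (X : C) {n q m : ℕ} (h : n + q = m) :
    End (tpow X n) →⋆ₐ[ℂ] End (tpow X m) where
  toFun w := (tpowMul X h).inv ≫ ((show tpow X n ⟶ tpow X n from w) ▷ tpow X q) ≫
    (tpowMul X h).hom
  map_one' := by
    change (tpowMul X h).inv ≫ (𝟙 (tpow X n) ▷ tpow X q) ≫ (tpowMul X h).hom = 𝟙 _
    simp
  map_mul' f g := by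
    change (tpowMul X h).inv ≫
      (((show tpow X n ⟶ tpow X n from g) ≫ (show tpow X n ⟶ tpow X n from f)) ▷ tpow X q) ≫
        (tpowMul X h).hom = (_ ≫ _ ≫ _) ≫ (_ ≫ _ ≫ _)
    simp
  map_zero' := by
    change (tpowMul X h).inv ≫ ((0 : tpow X n ⟶ tpow X n) ▷ tpow X q) ≫ (tpowMul X h).hom = 0
    simp
  map_add' f g := by
    change (tpowMul X h).inv ≫
      (((show tpow X n ⟶ tpow X n from f) + (show tpow X n ⟶ tpow X n from g)) ▷ tpow X q) ≫
        (tpowMul X h).hom = (_ ≫ _ ≫ _) + (_ ≫ _ ≫ _)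
    simp
  commutes' c := by
    change (tpowMul X h).inv ≫ ((c • 𝟙 (tpow X n)) ▷ tpow X q) ≫ (tpowMul X h).hom = c • 𝟙 _
    simp
  map_star' f := by
    change (tpowMul X h).inv ≫ (dag (show tpow X n ⟶ tpow X n from f) ▷ tpow X q) ≫
        (tpowMul X h).hom = dag (_ ≫ _ ≫ _)
    simp only [dag_comp, dag_tpowMul_hom, dag_tpowMul_inv, dag_whiskerRight, Category.assoc]

/-- `w ↦ 1^{⊗ p} ⊗ w`, from `End (X^n)` to `End (X^m)` where `p + n = m`. -/
noncomputable def embL (X : C) {p n m : ℕ} (h : p + n = m) :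
    End (tpow X n) →⋆ₐ[ℂ] End (tpow X m) where
  toFun w := (tpowMul X h).inv ≫ (tpow X p ◁ (show tpow X n ⟶ tpow X n from w)) ≫
    (tpowMul X h).hom
  map_one' := by
    change (tpowMul X h).inv ≫ (tpow X p ◁ 𝟙 (tpow X n)) ≫ (tpowMul X h).hom = 𝟙 _
    simp
  map_mul' f g := by
    change (tpowMul X h).inv ≫
      (tpow X p ◁ ((show tpow X n ⟶ tpow X n from g) ≫ (show tpow X n ⟶ tpow X n from f))) ≫
        (tpowMul X h).hom = (_ ≫ _ ≫ _) ≫ (_ ≫ _ ≫ _)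
    simp
  map_zero' := by
    change (tpowMul X h).inv ≫ (tpow X p ◁ (0 : tpow X n ⟶ tpow X n)) ≫ (tpowMul X h).hom = 0
    simp
  map_add' f g := by
    change (tpowMul X h).inv ≫
      (tpow X p ◁ ((show tpow X n ⟶ tpow X n from f) + (show tpow X n ⟶ tpow X n from g))) ≫
        (tpowMul X h).hom = (_ ≫ _ ≫ _) + (_ ≫ _ ≫ _)
    simp
  commutes' c := by
    change (tpowMul X h).inv ≫ (tpow X p ◁ (c • 𝟙 (tpow X n))) ≫ (tpowMul X h).hom = c • 𝟙 _
    simp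
  map_star' f := by
    change (tpowMul X h).inv ≫ (tpow X p ◁ dag (show tpow X n ⟶ tpow X n from f)) ≫
        (tpowMul X h).hom = dag (_ ≫ _ ≫ _)
    simp only [dag_comp, dag_tpowMul_hom, dag_tpowMul_inv, dag_whiskerLeft, Category.assoc]

lemma embR_zero (X : C) {n : ℕ} (h : n + 0 = n) (w : End (tpow X n)) : embR X h w = w := by
  change (tpowMul X h).inv ≫ ((show tpow X n ⟶ tpow X n from w) ▷ 𝟙_ C) ≫ (tpowMul X h).hom = w
  rw [tpowMul_zero_right]
  exact coherence_unit_right _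

lemma embL_zero (X : C) {n : ℕ} (h : 0 + n = n) (w : End (tpow X n)) : embL X h w = w := by
  have h' : tpowMul X h = λ_ (tpow X n) := Iso.ext (tpowMul_zero_left X h)
  change (tpowMul X h).inv ≫ (𝟙_ C ◁ (show tpow X n ⟶ tpow X n from w)) ≫ (tpowMul X h).hom = w
  rw [h']
  exact coherence_unit_left _

lemma embR_embR (X : C) {n q a q' b c : ℕ} (h₁ : n + q = a) (h₂ : a + q' = b) (h₃ : q + q' = c)
    (h₄ : n + c = b) (w : End (tpow X n)) : embR X h₂ (embR X h₁ w) = embR X h₄ w :=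
  coherence_RR _ _ _ _ (tpowMul_assoc X h₁ h₂ h₃ h₄) w

lemma embL_embL (X : C) {n p a p' b c : ℕ} (h₁ : p + n = a) (h₂ : p' + a = b) (h₃ : p' + p = c)
    (h₄ : c + n = b) (w : End (tpow X n)) : embL X h₂ (embL X h₁ w) = embL X h₄ w :=
  coherence_LL _ _ _ _ (tpowMul_assoc X h₃ h₄ h₁ h₂) w

lemma embL_embR (X : C) {n p q a b c : ℕ} (h₁ : n + q = a) (h₂ : p + a = b) (h₃ : p + n = c)
    (h₄ : c + q = b) (w : End (tpow X n)) :
    embL X h₂ (embR X h₁ w) = embR X h₄ (embL X h₃ w) :=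
  coherence_LR _ _ _ _ (tpowMul_assoc X h₃ h₄ h₁ h₂) w

lemma embR_embL_commute (X : C) {n q m : ℕ} (h : n + q = m) (w : End (tpow X n))
    (z : End (tpow X q)) : Commute (embR X h w) (embL X h z) :=
  coherence_comm (e := tpowMul X h) w z

section Injectivity

lemma whiskerRight_tpow_eq_zero {X : C} (hX : ∀ {Y Z : C} (w : Y ⟶ Z), w ▷ X = 0 → w = 0) :
    ∀ (q : ℕ) {Y Z : C} (w : Y ⟶ Z), w ▷ tpow X q = 0 → w = 0
  | 0, Y, Z, w, h => by
    have h' : w ▷ 𝟙_ C = 0 := h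
    rw [← cancel_epi (ρ_ Y).hom, ← rightUnitor_naturality, h']
    simp
  | q + 1, Y, Z, w, h => by
    have h' : w ▷ (tpow X q ⊗ X) = 0 := h
    refine whiskerRight_tpow_eq_zero hX q w (hX _ ?_)
    rw [whiskerRight_tensor] at h'
    simpa using h'

lemma whiskerLeft_tpow_eq_zero {X : C} (hX : ∀ {Y Z : C} (w : Y ⟶ Z), X ◁ w = 0 → w = 0) :
    ∀ (q : ℕ) {Y Z : C} (w : Y ⟶ Z), tpow X q ◁ w = 0 → w = 0
  | 0, Y, Z, w, h => by
    have h' : 𝟙_ C ◁ w = 0 := h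
    rw [← cancel_epi (λ_ Y).hom, ← leftUnitor_naturality, h']
    simp
  | q + 1, Y, Z, w, h => by
    have h' : (tpow X q ⊗ X) ◁ w = 0 := h
    refine hX w (whiskerLeft_tpow_eq_zero hX q _ ?_)
    rw [tensor_whiskerLeft] at h'
    simpa using h'

lemma StronglyTensorGenerating.whiskerLeft_eq_zero {X : C} (hX : StronglyTensorGenerating X)
    {Y Z : C} (w : Y ⟶ Z) (h : X ◁ w = 0) : w = 0 := by
  obtain ⟨n, hn, hS⟩ := hX
  obtain ⟨i, r, hir⟩ := hS (𝟙_ C) IsFusion.simple_unit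
  obtain ⟨k, rfl⟩ : ∃ k, n = k + 1 := ⟨n - 1, by omega⟩
  have h1 : (tpow X k ⊗ X) ◁ w = 0 := by rw [tensor_whiskerLeft, h]; simp
  have h2 : 𝟙_ C ◁ w = 0 := by
    have h3 : 𝟙_ C ◁ w = i ▷ Y ≫ (tpow X (k + 1) ◁ w) ≫ r ▷ Z := by
      rw [whisker_exchange, ← comp_whiskerRight_assoc, hir]; simp
    have h1' : tpow X (k + 1) ◁ w = 0 := h1
    rw [h3, h1']; simp
  rw [← cancel_epi (λ_ Y).hom, ← leftUnitor_naturality, h2]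
  simp

lemma StronglyTensorGenerating.whiskerRight_eq_zero {X : C} (hX : StronglyTensorGenerating X)
    {Y Z : C} (w : Y ⟶ Z) (h : w ▷ X = 0) : w = 0 := by
  obtain ⟨n, hn, hS⟩ := hX
  obtain ⟨i, r, hir⟩ := hS (𝟙_ C) IsFusion.simple_unit
  obtain ⟨k, rfl⟩ : ∃ k, n = 1 + k := ⟨n - 1, by omega⟩
  have h0 : w ▷ (𝟙_ C ⊗ X) = 0 := by
    rw [← cancel_mono (Z ◁ (λ_ X).hom), ← whisker_exchange, h]; simp
  have h1 : w ▷ (tpow X 1 ⊗ tpow X k) = 0 := by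
    have h0' : w ▷ tpow X 1 = 0 := h0
    rw [whiskerRight_tensor, h0']; simp
  have h1' : w ▷ tpow X (1 + k) = 0 := by
    rw [← cancel_epi (Y ◁ (tpowMul X (rfl : 1 + k = 1 + k)).hom), whisker_exchange, h1]; simp
  have h2 : w ▷ 𝟙_ C = 0 := by
    have h3 : w ▷ 𝟙_ C = Y ◁ i ≫ w ▷ tpow X (1 + k) ≫ Z ◁ r := by
      rw [← whisker_exchange, ← whiskerLeft_comp_assoc, hir]; simp
    rw [h3, h1']; simp
  rw [← cancel_epi (ρ_ Y).hom, ← rightUnitor_naturality, h2]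
  simp

lemma embR_injective {X : C} (hX : StronglyTensorGenerating X) {n q m : ℕ} (h : n + q = m) :
    Function.Injective (embR X h) := by
  rw [injective_iff_map_eq_zero]
  intro w hw
  have hw' : (tpowMul X h).inv ≫ ((show tpow X n ⟶ tpow X n from w) ▷ tpow X q) ≫
    (tpowMul X h).hom = 0 := hw
  refine whiskerRight_tpow_eq_zero hX.whiskerRight_eq_zero q _ ?_
  simpa using hw'

lemma embL_injective {X : C} (hX : StronglyTensorGenerating X) {p n m : ℕ} (h : p + n = m) :
    Function.Injective (embL X h) := by
  rw [injective_iff_map_eq_zero]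
  intro w hw
  have hw' : (tpowMul X h).inv ≫ (tpow X p ◁ (show tpow X n ⟶ tpow X n from w)) ≫
    (tpowMul X h).hom = 0 := hw
  refine whiskerLeft_tpow_eq_zero hX.whiskerLeft_eq_zero p _ ?_
  simpa using hw'

end Injectivity

end EndAlgebra

end UnitaryFusion
/-! ### Abstract spin chains -/

/-- An abstract spin chain with quasi-local algebra `A`. Finite nonempty intervals `[a, b]` of the
lattice `ℤ` are elements of `NonemptyInterval ℤ`, ordered by inclusion. -/
structure AbstractSpinChain (A : Type*) [CStarAlgebra A] where
  /-- The algebra `A_I` of operators localized in the interval `I`. -/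
  net : NonemptyInterval ℤ →o StarSubalgebra ℂ A
  finiteDimensional : ∀ I, FiniteDimensional ℂ (net I)
  locality : ∀ I J : NonemptyInterval ℤ, Disjoint (I : Set ℤ) (J : Set ℤ) →
    ∀ a ∈ net I, ∀ b ∈ net J, Commute a b
  quasiLocal : Dense (⋃ I, (net I : Set A))

/-! ### Fusion spin chains -/

section FusionChain

open CategoryTheory MonoidalCategory

universe v u

variable {C : Type u} [Category.{v} C] [Abelian C] [Linear ℂ C] [MonoidalCategory C]
  [MonoidalPreadditive C] [MonoidalLinear ℂ C] [RigidCategory C] [UnitaryFusionCategory C]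

/-- The number of sites of an interval. -/
def siteCount (I : NonemptyInterval ℤ) : ℕ := (I.snd - I.fst + 1).toNat

/-- The inclusion `End (X^|I|) → End (X^|J|)`, `w ↦ 1^{⊗ a-c} ⊗ w ⊗ 1^{⊗ d-b}`, for
`I = [a, b] ⊆ J = [c, d]`. -/
noncomputable def fusionIncl (X : C) (I J : NonemptyInterval ℤ) (h : I ≤ J) :
    End (tpow X (siteCount I)) →⋆ₐ[ℂ] End (tpow X (siteCount J)) :=
  (embR X (n := (I.fst - J.fst).toNat + siteCount I) (q := (J.snd - I.snd).toNat) (by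
    have h₁ : J.fst ≤ I.fst := h.1
    have h₂ : I.snd ≤ J.snd := h.2
    have h₃ := I.fst_le_snd
    simp only [siteCount]; omega)).comp
  (embL X (p := (I.fst - J.fst).toNat) (n := siteCount I) rfl)

lemma fusionIncl_eq (X : C) (I J : NonemptyInterval ℤ) (h : I ≤ J) {p q m : ℕ}
    (hp : (p : ℤ) = I.fst - J.fst) (hq : (q : ℤ) = J.snd - I.snd) (hm : p + siteCount I = m)
    (hJ : m + q = siteCount J) (w) : fusionIncl X I J h w = embR X hJ (embL X hm w) := by
  subst hm
  obtain rfl : p = (I.fst - J.fst).toNat := by omega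
  obtain rfl : q = (J.snd - I.snd).toNat := by omega
  rfl

instance fusionSystem (X : C) :
    DirectedSystem (fun I : NonemptyInterval ℤ => End (tpow X (siteCount I)))
      (fun I J h => fusionIncl X I J h) where
  map_self I w := by
    rw [fusionIncl_eq X I I le_rfl (p := 0) (q := 0) (m := siteCount I) (by simp) (by simp)
      (by simp) (by simp), embL_zero, embR_zero]
  map_map K J I hIJ hJK w := by
    have h₁ : J.fst ≤ I.fst := hIJ.1
    have h₂ : I.snd ≤ J.snd := hIJ.2
    have h₃ : K.fst ≤ J.fst := hJK.1
    have h₄ : J.snd ≤ K.snd := hJK.2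
    have h₅ := I.fst_le_snd
    obtain ⟨p, hp⟩ := Int.eq_ofNat_of_zero_le (sub_nonneg.2 h₁)
    obtain ⟨q, hq⟩ := Int.eq_ofNat_of_zero_le (sub_nonneg.2 h₂)
    obtain ⟨p', hp'⟩ := Int.eq_ofNat_of_zero_le (sub_nonneg.2 h₃)
    obtain ⟨q', hq'⟩ := Int.eq_ofNat_of_zero_le (sub_nonneg.2 h₄)
    have e₁ : p + siteCount I + q = siteCount J := by simp only [siteCount]; omega
    have e₂ : p' + siteCount J + q' = siteCount K := by simp only [siteCount]; omega
    rw [fusionIncl_eq X I J hIJ hp.symm hq.symm rfl e₁,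
      fusionIncl_eq X J K hJK hp'.symm hq'.symm rfl e₂,
      fusionIncl_eq X I K (hIJ.trans hJK) (p := p' + p) (q := q + q') (by push_cast; omega)
        (by push_cast; omega) (by omega : _ = p' + (p + siteCount I)) (by omega),
      embL_embR X e₁ rfl (rfl : p' + (p + siteCount I) = _) (by omega),
      embL_embL X rfl rfl rfl (by omega : p' + p + siteCount I = p' + (p + siteCount I)),
      embR_embR X _ _ rfl (by omega)]

lemma fusionIncl_injective {X : C} (hX : StronglyTensorGenerating X)
    (I J : NonemptyInterval ℤ) (h : I ≤ J) : Function.Injective (fusionIncl X I J h) :=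
  (embR_injective hX _).comp (embL_injective hX _)

variable {X : C} (hX : StronglyTensorGenerating X)

/-- The quasi-local C⋆-algebra of the fusion spin chain: the colimit of the C⋆-algebras
`End (X^|I|)` over all finite nonempty intervals `I`. -/
def FusionAlgebra : Type v :=
  CStarColimit (fun I J h => fusionIncl X I J h) (fusionIncl_injective hX)

noncomputable instance : CStarAlgebra (FusionAlgebra hX) :=
  inferInstanceAs (CStarAlgebra (CStarColimit (fun I J h => fusionIncl X I J h)
    (fusionIncl_injective hX)))

noncomputable instance : PartialOrder (FusionAlgebra hX) := CStarAlgebra.spectralOrder _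

instance : StarOrderedRing (FusionAlgebra hX) := CStarAlgebra.spectralOrderedRing _

/-- The identification of `End (X^|I|)` with the local algebra at `I`. -/
noncomputable def fusionLocal (I : NonemptyInterval ℤ) :
    End (tpow X (siteCount I)) →⋆ₐ[ℂ] FusionAlgebra hX :=
  CStarColimit.of (fun I J h => fusionIncl X I J h) (fusionIncl_injective hX) I

lemma fusionLocal_incl {I J : NonemptyInterval ℤ} (h : I ≤ J) (w) :
    fusionLocal hX J (fusionIncl X I J h w) = fusionLocal hX I w :=
  CStarColimit.of_map (fun I J h => fusionIncl X I J h) (fusionIncl_injective hX) h w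

lemma fusionLocal_commute_of_lt {I J : NonemptyInterval ℤ} (h : I.snd < J.fst)
    (w : End (tpow X (siteCount I))) (z : End (tpow X (siteCount J))) :
    Commute (fusionLocal hX I w) (fusionLocal hX J z) := by
  have h₁ := I.fst_le_snd
  have h₂ := J.fst_le_snd
  have f₁ : (I ⊔ J).fst = I.fst := by rw [NonemptyInterval.fst_sup]; simp; omega
  have f₂ : (I ⊔ J).snd = J.snd := by rw [NonemptyInterval.snd_sup]; simp; omega
  obtain ⟨g, hg⟩ := Int.eq_ofNat_of_zero_le (by omega : 0 ≤ J.fst - I.snd - 1)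
  have e₁ : siteCount I + (g + siteCount J) = siteCount (I ⊔ J) := by
    simp only [siteCount, f₁, f₂]; omega
  have c₁ : ((siteCount I : ℕ) : ℤ) = I.snd - I.fst + 1 := by simp only [siteCount]; omega
  have c₂ : ((siteCount J : ℕ) : ℤ) = J.snd - J.fst + 1 := by simp only [siteCount]; omega
  rw [← fusionLocal_incl hX (le_sup_left : I ≤ I ⊔ J), ← fusionLocal_incl hX
    (le_sup_right : J ≤ I ⊔ J), fusionIncl_eq X I _ le_sup_left (p := 0) (q := g + siteCount J)
      (by omega) (by push_cast; omega) (Nat.zero_add _) e₁, embL_zero,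
    fusionIncl_eq X J _ le_sup_right (p := siteCount I + g) (q := 0) (by push_cast; omega) (by omega)
      (by omega : _ = siteCount (I ⊔ J)) (by omega), embR_zero,
    ← embL_embL X rfl e₁ rfl]
  exact (embR_embL_commute X e₁ w _).map _

/-- The fusion spin chain `A(C, X)`. -/
noncomputable def fusionSpinChain : AbstractSpinChain (FusionAlgebra hX) where
  net :=
    { toFun := fun I => (fusionLocal hX I).range
      monotone' := by
        rintro I J h _ ⟨w, rfl⟩
        exact ⟨fusionIncl X I J h w, fusionLocal_incl hX h w⟩ }
  finiteDimensional I := by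
    exact Module.Finite.range (fusionLocal hX I).toAlgHom.toLinearMap
  locality := by
    rintro I J h _ ⟨w, rfl⟩ _ ⟨z, rfl⟩
    rcases lt_or_ge I.snd J.fst with h' | h'
    · exact fusionLocal_commute_of_lt hX h' w z
    · refine (fusionLocal_commute_of_lt hX ?_ z w).symm
      by_contra! h''
      have h₁ := I.fst_le_snd
      have h₂ := J.fst_le_snd
      refine (Set.disjoint_left.1 h : ∀ ⦃a⦄, _) (a := max I.fst J.fst) ?_ ?_
      · exact ⟨le_max_left _ _, max_le h₁ h'⟩
      · exact ⟨le_max_right _ _, max_le h'' h₂⟩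
  quasiLocal := CStarColimit.dense_of (fun I J h => fusionIncl X I J h) (fusionIncl_injective hX)

end FusionChain

/-! ### Von Neumann algebras, Murray-von Neumann dimension and Jones index -/

section VonNeumann

open scoped ENNReal

variable {H : Type*} [NormedAddCommGroup H] [InnerProductSpace ℂ H] [CompleteSpace H]

/-- The von Neumann algebra `S''` generated by a set `S` of operators. (The commutant is that of
`S ∪ S⋆`; below `S` is always closed under adjoints.) -/
noncomputable def vonNeumannGenerated (S : Set (H →L[ℂ] H)) : VonNeumannAlgebra H :=
  VonNeumannAlgebra.commutant
    { toStarSubalgebra := StarSubalgebra.centralizer ℂ S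
      centralizer_centralizer' := by
        change Set.centralizer (Set.centralizer (StarSubalgebra.centralizer ℂ S : Set (H →L[ℂ] H)))
          = (StarSubalgebra.centralizer ℂ S : Set (H →L[ℂ] H))
        rw [StarSubalgebra.coe_centralizer, Set.centralizer_centralizer_centralizer] }

/-- The image of a von Neumann algebra under conjugation by a unitary. -/
noncomputable def VonNeumannAlgebra.conj (M : VonNeumannAlgebra H) (U : H ≃ₗᵢ[ℂ] H) :
    VonNeumannAlgebra H where
  toStarSubalgebra := M.toStarSubalgebra.map
    (StarAlgHomClass.toStarAlgHom (R := ℂ) U.conjStarAlgEquiv)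
  centralizer_centralizer' := by
    have key : ∀ S : Set (H →L[ℂ] H), Set.centralizer (U.conjStarAlgEquiv '' S) =
        U.conjStarAlgEquiv '' Set.centralizer S := by
      intro S
      ext T
      constructor
      · intro hT
        have hT' := U.conjStarAlgEquiv.apply_symm_apply T
        refine ⟨U.conjStarAlgEquiv.symm T, fun s hs => ?_, hT'⟩
        have h := hT _ ⟨s, hs, rfl⟩
        rw [← hT', ← map_mul, ← map_mul] at h
        exact EquivLike.injective U.conjStarAlgEquiv h
      · rintro ⟨T, hT, rfl⟩ _ ⟨s, hs, rfl⟩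
        rw [← map_mul, hT s hs, map_mul]
    change Set.centralizer (Set.centralizer (U.conjStarAlgEquiv '' (M : Set (H →L[ℂ] H)))) =
      U.conjStarAlgEquiv '' (M : Set (H →L[ℂ] H))
    rw [key, key, M.centralizer_centralizer]

/-- A factor: a von Neumann algebra with trivial center. -/
def VonNeumannAlgebra.IsFactor (M : VonNeumannAlgebra H) : Prop :=
  ∀ z ∈ M, z ∈ M.commutant → ∃ c : ℂ, z = c • 1

/-- `φ` is a normal tracial state of `M`. A state is normal iff it is of the form
`T ↦ ∑ ⟨ξₙ, T ξₙ⟩` for a sequence of vectors with `∑ ‖ξₙ‖² < ∞`; such a functional is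
automatically linear and positive. -/
def VonNeumannAlgebra.IsNormalTracialState (M : VonNeumannAlgebra H) (φ : M → ℂ) : Prop :=
  (∃ ξ : ℕ → H, Summable (fun n => ‖ξ n‖ ^ 2) ∧
    ∀ T : M, HasSum (fun n => inner ℂ (ξ n) ((T : H →L[ℂ] H) (ξ n))) (φ T)) ∧
  φ 1 = 1 ∧ ∀ S T : M, φ (S * T) = φ (T * S)

/-- A II₁ factor: an infinite-dimensional factor with a normal tracial state. -/
def VonNeumannAlgebra.IsIIOneFactor (M : VonNeumannAlgebra H) : Prop :=
  M.IsFactor ∧ ¬ FiniteDimensional ℂ M.toStarSubalgebra ∧ ∃ φ, M.IsNormalTracialState φ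

/-- The orbit `M Ω` of a vector. -/
noncomputable def VonNeumannAlgebra.orbit (M : VonNeumannAlgebra H) (Ω : H) : Submodule ℂ H :=
  M.toStarSubalgebra.toSubmodule.map (ContinuousLinearMap.apply ℂ H Ω).toLinearMap

/-- `L²(M)` for a von Neumann algebra `M` whose tracial state is the vector state of `Ω`: the
closure of `M Ω` with `M` acting by restriction. -/
noncomputable abbrev VonNeumannAlgebra.l2 (M : VonNeumannAlgebra H) (Ω : H) : Submodule ℂ H :=
  (M.orbit Ω).topologicalClosure

lemma VonNeumannAlgebra.mem_l2 (M : VonNeumannAlgebra H) (Ω : H) : Ω ∈ M.l2 Ω :=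
  Submodule.le_topologicalClosure _ ⟨1, one_mem M.toStarSubalgebra, rfl⟩

/-- The maps `V 0, V 1, …` are the components of an isometry `V : K → ℓ²(ℕ) ⊗ L²(N)` that commutes
with the action of `N`. -/
structure IsModuleIsometry (N : VonNeumannAlgebra H) (Ω : H) (K : Submodule ℂ H)
    (V : ℕ → K →L[ℂ] N.l2 Ω) : Prop where
  isometry : ∀ ξ : K, HasSum (fun i => ‖V i ξ‖ ^ 2) (‖ξ‖ ^ 2)
  linear : ∀ T ∈ N, ∀ ξ η : K, (η : H) = T ξ → ∀ i, (V i η : H) = T (V i ξ)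

/-- The Murray-von Neumann dimension `dim_N K` of an `N`-invariant closed subspace `K`, where `N`
is a II₁ factor whose trace is the vector state of `Ω`: the trace
`(Tr ⊗ tr) (V V⋆) = ∑ᵢ ‖V⋆ (eᵢ ⊗ Ω)‖²` of the range projection of any `N`-linear isometry
`V : K → ℓ²(ℕ) ⊗ L²(N)`. This value does not depend on `V`, so that the infimum is over a
one-point set; it is `∞` if there is no such `V`. -/
noncomputable def mvnDim (N : VonNeumannAlgebra H) (Ω : H) (K : Submodule ℂ H) [CompleteSpace K] :
    ℝ≥0∞ :=
  ⨅ (V : ℕ → K →L[ℂ] N.l2 Ω) (_ : IsModuleIsometry N Ω K V),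
    ∑' i, ‖(V i).adjoint ⟨Ω, N.mem_l2 Ω⟩‖ₑ ^ 2

/-- The Jones index `[M : N] = dim_N L²(M)`. -/
noncomputable def jonesIndex (Ω : H) (M N : VonNeumannAlgebra H) : ℝ≥0∞ :=
  mvnDim N Ω (M.l2 Ω)

end VonNeumann

/-! ### Tracial states and their GNS representations -/

section Tracial

open scoped ComplexOrder

variable {A : Type*} [CStarAlgebra A] [PartialOrder A] [StarOrderedRing A]

/-- A tracial state on a unital C⋆-algebra. -/
structure IsTracialState (τ : A →ₚ[ℂ] ℂ) : Prop where
  map_one : τ 1 = 1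
  map_mul_comm : ∀ a b, τ (a * b) = τ (b * a)

/-- `τ` is the unique tracial state of `A`. -/
structure IsUniqueTracialState (τ : A →ₚ[ℂ] ℂ) : Prop extends IsTracialState τ where
  unique : ∀ σ : A →ₚ[ℂ] ℂ, IsTracialState σ → σ = τ

/-- The class of `1` in the GNS space `L²(A, τ)`. -/
noncomputable def vacuum (τ : A →ₚ[ℂ] ℂ) : τ.GNS :=
  ((τ.toPreGNS 1 : τ.PreGNS) : UniformSpace.Completion τ.PreGNS)

lemma IsUniqueTracialState.map_aut {τ : A →ₚ[ℂ] ℂ} (hτ : IsUniqueTracialState τ)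
    (α : A ≃⋆ₐ[ℂ] A) (a : A) : τ (α a) = τ a := by
  let σ : A →ₚ[ℂ] ℂ := PositiveLinearMap.mk₀
    (τ.toLinearMap.comp (α : A →⋆ₐ[ℂ] A).toAlgHom.toLinearMap)
    (fun x hx => τ.map_nonneg (map_nonneg α hx))
  have hσ : ∀ x, σ x = τ (α x) := fun x => rfl
  have : σ = τ := hτ.unique σ
    ⟨by rw [hσ, map_one, hτ.map_one], fun a b => by
      rw [hσ, hσ, map_mul α, map_mul α, hτ.map_mul_comm]⟩
  rw [← hσ, this]

/-- The isometry of the pre-Hilbert space `A` with inner product `⟨a, b⟩ = τ (a⋆ b)` given by a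
`τ`-preserving automorphism. -/
noncomputable def preGNSIsometry {τ : A →ₚ[ℂ] ℂ} (hτ : IsUniqueTracialState τ)
    (α : A ≃⋆ₐ[ℂ] A) : τ.PreGNS →ₗᵢ[ℂ] τ.PreGNS where
  toLinearMap := τ.toPreGNS.toLinearMap ∘ₗ (α : A →⋆ₐ[ℂ] A).toAlgHom.toLinearMap ∘ₗ
    τ.ofPreGNS.toLinearMap
  norm_map' a := by
    have h : star (α (τ.ofPreGNS a)) * α (τ.ofPreGNS a) =
        α (star (τ.ofPreGNS a) * τ.ofPreGNS a) := by rw [map_mul, map_star]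
    rw [τ.preGNS_norm_def, τ.preGNS_norm_def]
    change √(τ (star (α (τ.ofPreGNS a)) * α (τ.ofPreGNS a))).re = _
    rw [h, hτ.map_aut]

lemma completion_preGNSIsometry_coe {τ : A →ₚ[ℂ] ℂ} (hτ : IsUniqueTracialState τ)
    (α : A ≃⋆ₐ[ℂ] A) (a : A) :
    (preGNSIsometry hτ α).toContinuousLinearMap.completion (τ.toPreGNS a : τ.GNS) =
      (τ.toPreGNS (α a) : τ.GNS) := by
  rw [ContinuousLinearMap.completion_apply_coe]
  rfl

lemma completion_preGNSIsometry_comp {τ : A →ₚ[ℂ] ℂ} (hτ : IsUniqueTracialState τ)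
    (α β : A ≃⋆ₐ[ℂ] A) (h : ∀ a, α (β a) = a) (x : τ.GNS) :
    (preGNSIsometry hτ α).toContinuousLinearMap.completion
      ((preGNSIsometry hτ β).toContinuousLinearMap.completion x) = x := by
  induction x using UniformSpace.Completion.induction_on with
  | hp => apply isClosed_eq <;> fun_prop
  | ih a =>
    obtain ⟨a, rfl⟩ := τ.toPreGNS.surjective a
    rw [completion_preGNSIsometry_coe, completion_preGNSIsometry_coe, h]

/-- The unitary on `L²(A, τ)` determined by `a ↦ α a`. Conjugation by it is the automorphism of
`A''` that extends `α`. -/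
noncomputable def gnsUnitary {τ : A →ₚ[ℂ] ℂ} (hτ : IsUniqueTracialState τ) (α : A ≃⋆ₐ[ℂ] A) :
    τ.GNS ≃ₗᵢ[ℂ] τ.GNS where
  toLinearEquiv := LinearEquiv.ofLinearMap
    (preGNSIsometry hτ α).toContinuousLinearMap.completion.toLinearMap
    (preGNSIsometry hτ α.symm).toContinuousLinearMap.completion.toLinearMap
    (LinearMap.ext fun x => completion_preGNSIsometry_comp hτ α α.symm (by simp) x)
    (LinearMap.ext fun x => completion_preGNSIsometry_comp hτ α.symm α (by simp) x)
  norm_map' x := by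
    change ‖(preGNSIsometry hτ α).toContinuousLinearMap.completion x‖ = ‖x‖
    induction x using UniformSpace.Completion.induction_on with
    | hp => apply isClosed_eq <;> fun_prop
    | ih a =>
      rw [ContinuousLinearMap.completion_apply_coe, UniformSpace.Completion.norm_coe,
        UniformSpace.Completion.norm_coe]
      exact (preGNSIsometry hτ α).norm_map a

lemma gnsUnitary_apply {τ : A →ₚ[ℂ] ℂ} (hτ : IsUniqueTracialState τ) (α : A ≃⋆ₐ[ℂ] A) (a : A) :
    gnsUnitary hτ α (τ.toPreGNS a : τ.GNS) = (τ.toPreGNS (α a) : τ.GNS) :=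
  completion_preGNSIsometry_coe hτ α a

end Tracial
/-! ### The finite index property, cellular automata and circuits -/

namespace AbstractSpinChain

open scoped ComplexOrder ENNReal

variable {A : Type*} [CStarAlgebra A] (𝔄 : AbstractSpinChain A)

/-- The interval `I^{+l} = [a - l, b + l]` for `I = [a, b]`. -/
def thicken (I : NonemptyInterval ℤ) (l : ℕ) : NonemptyInterval ℤ :=
  ⟨(I.fst - l, I.snd + l), by have := I.fst_le_snd; simp only; omega⟩

/-- The group of quantum cellular automata. -/
def QCA : Subgroup (A ≃⋆ₐ[ℂ] A) where
  carrier := {α | ∃ l : ℕ, ∀ I, (∀ a ∈ 𝔄.net I, α a ∈ 𝔄.net (thicken I l)) ∧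
    ∀ a ∈ 𝔄.net I, α.symm a ∈ 𝔄.net (thicken I l)}
  one_mem' := ⟨0, fun I => by
    have h : I ≤ thicken I 0 := ⟨by simp [thicken], by simp [thicken]⟩
    exact ⟨fun a ha => 𝔄.net.monotone h ha, fun a ha => 𝔄.net.monotone h ha⟩⟩
  mul_mem' := by
    rintro α β ⟨l, hl⟩ ⟨m, hm⟩
    refine ⟨l + m, fun I => ?_⟩
    have h₁ : thicken (thicken I m) l ≤ thicken I (l + m) := by
      constructor <;> simp only [thicken] <;> omega
    have h₂ : thicken (thicken I l) m ≤ thicken I (l + m) := by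
      constructor <;> simp only [thicken] <;> omega
    exact ⟨fun a ha => 𝔄.net.monotone h₁ ((hl _).1 _ ((hm I).1 a ha)),
      fun a ha => 𝔄.net.monotone h₂ ((hm _).2 _ ((hl I).2 a ha))⟩
  inv_mem' := by
    rintro α ⟨l, hl⟩
    exact ⟨l, fun I => ⟨(hl I).2, (hl I).1⟩⟩

/-- `α` is a depth one circuit: there are a partition of `ℤ` into intervals `I₀, I₁, …` of bounded
size and unitaries `uᵢ ∈ A_{Iᵢ}` such that `α w = (∏ uᵢ) w (∏ uᵢ)⋆` for every local `w`. The `uᵢ`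
commute with each other and all but finitely many of them commute with `w`, so that the conjugates
by the partial products are eventually constant; this constant is the right-hand side. -/
def IsDepthOneCircuit (α : A ≃⋆ₐ[ℂ] A) : Prop :=
  ∃ (I : ℕ → NonemptyInterval ℤ) (l : ℕ) (u : ℕ → A),
    (∀ k : ℤ, ∃! i, k ∈ I i) ∧ (∀ i, (I i).snd - (I i).fst < l) ∧
    (∀ i, u i ∈ 𝔄.net (I i) ∧ u i ∈ unitary A) ∧
    ∀ J, ∀ w ∈ 𝔄.net J, ∀ᶠ n in Filter.atTop,
      α w = ((List.range n).map u).prod * w * star ((List.range n).map u).prod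

/-- The group of finite depth circuits: compositions of depth one circuits. (Inverses of depth one
circuits are depth one circuits.) -/
def FDQC : Subgroup 𝔄.QCA := Subgroup.closure {α | 𝔄.IsDepthOneCircuit α}

variable [PartialOrder A] [StarOrderedRing A]

/-- The left half-infinite von Neumann algebra `𝒜_x = (⋃_{I ≤ x} A_I)''` on `L²(A, τ)`. -/
noncomputable def leftAlgebra (τ : A →ₚ[ℂ] ℂ) (x : ℤ) : VonNeumannAlgebra τ.GNS :=
  vonNeumannGenerated (τ.gnsStarAlgHom '' ⋃ (I : NonemptyInterval ℤ) (_ : I.snd ≤ x),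
    (𝔄.net I : Set A))

/-- The (left) finite index property of a spin chain with respect to its tracial state. -/
structure FiniteIndexProperty (τ : A →ₚ[ℂ] ℂ) : Prop where
  factor : ∀ x : ℤ, (𝔄.leftAlgebra τ x).IsFactor ∧
    ¬ FiniteDimensional ℂ (𝔄.leftAlgebra τ x).toStarSubalgebra
  finite_index : ∀ x z : ℤ, x < z →
    jonesIndex (vacuum τ) (𝔄.leftAlgebra τ z) (𝔄.leftAlgebra τ x) < ⊤

/-- The image `α(𝒜_x)` under the extension of `α` to the von Neumann algebra `A''`. -/
noncomputable def imageAlgebra {τ : A →ₚ[ℂ] ℂ} (hτ : IsUniqueTracialState τ) (α : A ≃⋆ₐ[ℂ] A)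
    (x : ℤ) : VonNeumannAlgebra τ.GNS :=
  (𝔄.leftAlgebra τ x).conj (gnsUnitary hτ α)

/-- `([α(𝒜_x) : 𝒜_y] / [𝒜_x : 𝒜_y])^{1/2}`. -/
noncomputable def indexRatio {τ : A →ₚ[ℂ] ℂ} (hτ : IsUniqueTracialState τ) (α : A ≃⋆ₐ[ℂ] A)
    (x y : ℤ) : ℝ :=
  √(jonesIndex (vacuum τ) (𝔄.imageAlgebra hτ α x) (𝔄.leftAlgebra τ y) /
    jonesIndex (vacuum τ) (𝔄.leftAlgebra τ x) (𝔄.leftAlgebra τ y)).toReal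

end AbstractSpinChain

open scoped ComplexOrder
open CategoryTheory MonoidalCategory

/-! The index theory uses only a few properties of the chain, collected in `IsRegular`: a unique
tracial state, uniqueness of the normalized positive trace already on each local half line
⋆-algebra, arbitrarily large τ-orthogonal families in it, and finite generation of a longer half
line algebra as a left module over a shorter one.

Uniqueness of the trace is the categorical heart. Let `Q` be a tensor power of `X` that contains
every simple object. Moving the left end of the interval further left, any local element of a half
line takes the form `1_Q ⊗ w` with `w` in some `End Z`. For minimal projections `p`, `q` of `End Z`,
every simple summand of the range of `1 ⊗ p` embeds in the range of `1 ⊗ q`, and the number of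
summands is at most a constant `K` independent of `Z`, as there are finitely many simple objects.
Hence any two normalized traces φ, ψ are comparable with the universal factor `K²`
(`IsEndTrace.harnack`). Such a comparison forces equality: subtracting a multiple of φ from ψ and
renormalizing gives another normalized trace, and iteration makes the error decay geometrically
(`eq_of_comparable`). Existence follows by extending traces of finite intervals and taking an
ultrafilter limit (`exists_isTracialState`).

Uniqueness yields the rest of the structure. A self-adjoint central element of the generated von
Neumann algebra would perturb the trace, so that algebra is a factor (`isFactor_gnsAlgebra`). The
trace is multiplicative over separated regions (`map_mul_of_lt`), so centered observables in
disjoint blocks are orthogonal; `X ≇ 𝟙` is needed only to find an observable that is not a scalar.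
Frobenius reciprocity gives finite generation (`ContainsSimples.exists_generators`), and a polar
decomposition turns generators into a module isometry with finitely many components
(`jonesIndex_lt_top`).

Multiplicativity of the index (`jonesIndex_mul`) comes from composing module isometries. It requires
that the trace on `P'`, restricted to the commutant of `N` on `L²(N)`, be a multiple of the vector
state of Ω. On right multiplications by a core this is uniqueness of the trace; density and the
parallelogram law extend it to the whole commutant. Towers of half line algebras and their images
then show that the ratio does not depend on `x`, `y` and is multiplicative in α.

A depth one circuit preserves the half line algebra that ends where one of its blocks ends, so its
index is one. Normality holds because conjugating a circuit by an automaton gives an infinite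
product of commuting unitaries in blocks of bounded length; sorting these blocks by residue classes
of their positions writes the product as finitely many depth one circuits. -/

/-! ### Antiunitary involutions and tracial vectors -/

section TracialVector

open scoped ENNReal InnerProductSpace

/-- A positive tracial linear functional on a ⋆-algebra. -/
structure IsTraceFunctional {D : Type*} [Ring D] [StarRing D] [Algebra ℂ D] (φ : D →ₗ[ℂ] ℂ) :
    Prop where
  nonneg : ∀ a, 0 ≤ φ (star a * a)
  mul_comm : ∀ a b, φ (a * b) = φ (b * a)

/-- A functional that takes the same values at `a⋆ a` and `a a⋆` is tracial. -/
lemma mul_comm_of_star_mul_self {D : Type*} [Ring D] [StarRing D] [Algebra ℂ D] [StarModule ℂ D]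
    (φ : D →ₗ[ℂ] ℂ) (h : ∀ a, φ (star a * a) = φ (a * star a)) (a b : D) :
    φ (a * b) = φ (b * a) := by
  -- Polarization: the two substitutions give the sum and the difference of `φ (a * b)` and `φ (star
  -- b * star a)`.
  have h1 := h (star a + b)
  have h2 := h (star a + Complex.I • b)
  have h3 := h a
  have h4 := h b
  simp only [star_add, star_star, star_smul, add_mul, mul_add, smul_mul_assoc, mul_smul_comm,
    map_add, map_smul, smul_eq_mul, Complex.star_def, Complex.conj_I] at h1 h2
  have e1 : φ (a * b) + φ (star b * star a) = φ (b * a) + φ (star a * star b) := by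
    linear_combination h1 + h3 - h4
  have e2 : Complex.I * φ (a * b) - Complex.I * φ (star b * star a) =
      Complex.I * φ (b * a) - Complex.I * φ (star a * star b) := by
    have hI := Complex.I_mul_I
    linear_combination h2 + h3 + (φ (star b * b) - φ (b * star b)) * hI - h4
  have e3 : φ (a * b) - φ (star b * star a) = φ (b * a) - φ (star a * star b) := by
    refine mul_left_cancel₀ Complex.I_ne_zero ?_
    rw [mul_sub, mul_sub, e2]
  linear_combination (e1 + e3) / 2

variable {H : Type*} [NormedAddCommGroup H] [InnerProductSpace ℂ H]

/-- An antiunitary involution of a Hilbert space. -/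
structure AntiunitaryInvolution (H : Type*) [NormedAddCommGroup H] [InnerProductSpace ℂ H] where
  /-- The underlying map. -/
  toFun : H → H
  inner_map : ∀ x y, ⟪toFun x, toFun y⟫_ℂ = ⟪y, x⟫_ℂ
  map_map : ∀ x, toFun (toFun x) = x

namespace AntiunitaryInvolution

variable (J : AntiunitaryInvolution H)

instance : CoeFun (AntiunitaryInvolution H) fun _ => H → H := ⟨toFun⟩

lemma inner_left (x y : H) : ⟪J x, y⟫_ℂ = ⟪J y, x⟫_ℂ := by
  rw [← J.inner_map, J.map_map]

/-- Additivity, like conjugate linearity below, need not be an axiom: the inner product identity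
determines `J` against every vector. -/
lemma map_add (x y : H) : J (x + y) = J x + J y := by
  refine ext_inner_right ℂ fun z => ?_
  rw [inner_add_left, J.inner_left, J.inner_left x, J.inner_left y, inner_add_right]

lemma map_smul (c : ℂ) (x : H) : J (c • x) = star c • J x := by
  refine ext_inner_right ℂ fun z => ?_
  rw [inner_smul_left, J.inner_left, J.inner_left x, inner_smul_right]
  simp

lemma map_sub (x y : H) : J (x - y) = J x - J y := by
  refine ext_inner_right ℂ fun z => ?_
  rw [inner_sub_left, J.inner_left, J.inner_left x, J.inner_left y, inner_sub_right]

lemma norm_map (x : H) : ‖J x‖ = ‖x‖ := by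
  have h := J.inner_map x x
  rw [inner_self_eq_norm_sq_to_K, inner_self_eq_norm_sq_to_K] at h
  have h' : ‖J x‖ ^ 2 = ‖x‖ ^ 2 := by exact_mod_cast h
  exact (sq_eq_sq₀ (norm_nonneg _) (norm_nonneg _)).1 h'

lemma continuous : Continuous J := by
  refine (AddMonoidHomClass.isometry_of_norm (⟨⟨J, ?_⟩, J.map_add⟩ : H →+ H) J.norm_map).continuous
  have := J.map_sub 0 0
  simpa using this

variable [CompleteSpace H]

/-- The conjugate `J d⋆ J`. If `J (n Ω) = n⋆ Ω` then this is right multiplication by `d`. -/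
noncomputable def rightMul (d : H →L[ℂ] H) : H →L[ℂ] H :=
  LinearMap.mkContinuous
    { toFun := fun x => J (star d (J x))
      map_add' := fun x y => by rw [J.map_add, _root_.map_add, J.map_add]
      map_smul' := fun c x => by
        rw [J.map_smul, _root_.map_smul, J.map_smul, star_star]; rfl } ‖star d‖
    (fun x => by
      change ‖J (star d (J x))‖ ≤ _
      rw [J.norm_map, ← J.norm_map x]
      exact (star d).le_opNorm _)

lemma rightMul_apply (d : H →L[ℂ] H) (x : H) : J.rightMul d x = J (star d (J x)) := rfl

lemma rightMul_add (d e : H →L[ℂ] H) : J.rightMul (d + e) = J.rightMul d + J.rightMul e := by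
  ext x
  simp [rightMul_apply, J.map_add]

lemma rightMul_smul (c : ℂ) (d : H →L[ℂ] H) : J.rightMul (c • d) = c • J.rightMul d := by
  ext x
  simp [rightMul_apply, J.map_smul]

lemma rightMul_mul (d e : H →L[ℂ] H) : J.rightMul (d * e) = J.rightMul e * J.rightMul d := by
  ext x
  simp [rightMul_apply, J.map_map]

lemma inner_rightMul (d : H →L[ℂ] H) (x y : H) :
    ⟪J.rightMul d x, y⟫_ℂ = ⟪x, J.rightMul (star d) y⟫_ℂ := by
  rw [rightMul_apply, rightMul_apply, J.inner_left, star_star, ContinuousLinearMap.star_eq_adjoint,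
    ContinuousLinearMap.adjoint_inner_right, ← J.inner_map (J x), J.map_map]

end AntiunitaryInvolution

variable [CompleteSpace H]

/-- `J (n Ω) = n⋆ Ω` for all `n ∈ N`, so that the vector state of `Ω` is tracial on `N` and `J`
restricts to the canonical conjugation of `L²(N)`. -/
def IsTracialConj (J : AntiunitaryInvolution H) (Ω : H) (N : VonNeumannAlgebra H) : Prop :=
  ∀ n ∈ N, J (n Ω) = star n Ω

namespace VonNeumannAlgebra

/-- `N`-linearity of a map between `N`-invariant subspaces. -/
def IsLinear (N : VonNeumannAlgebra H) {K L : Submodule ℂ H} (T : K →L[ℂ] L) : Prop :=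
  ∀ n ∈ N, ∀ ξ η : K, (η : H) = n ξ → (T η : H) = n (T ξ)

/-- Invariance of a subspace. -/
def Leaves (N : VonNeumannAlgebra H) (K : Submodule ℂ H) : Prop := ∀ n ∈ N, ∀ ξ ∈ K, n ξ ∈ K

variable {N M : VonNeumannAlgebra H} {Ω : H} {K L L' : Submodule ℂ H}

lemma mem_orbit {n : H →L[ℂ] H} (hn : n ∈ N) : n Ω ∈ N.orbit Ω := ⟨n, hn, rfl⟩

lemma mem_l2_of_mem {n : H →L[ℂ] H} (hn : n ∈ N) : n Ω ∈ N.l2 Ω :=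
  Submodule.le_topologicalClosure _ (mem_orbit hn)

lemma l2_mono (h : N ≤ M) : N.l2 Ω ≤ M.l2 Ω :=
  Submodule.topologicalClosure_mono (by rintro _ ⟨n, hn, rfl⟩; exact ⟨n, h hn, rfl⟩)

lemma Leaves.mono (hNM : N ≤ M) (h : M.Leaves K) : N.Leaves K := fun n hn => h n (hNM hn)

lemma leaves_l2 : N.Leaves (N.l2 Ω) := by
  intro n hn ξ hξ
  refine map_mem_closure n.continuous hξ ?_
  rintro _ ⟨m, hm, rfl⟩
  exact ⟨n * m, mul_mem (S := VonNeumannAlgebra H) hn hm, rfl⟩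

lemma leaves_l2_of_le (h : N ≤ M) : N.Leaves (M.l2 Ω) := leaves_l2.mono h

/-- A closed condition holds on `L²(N)` if it holds on `N Ω`. -/
lemma l2_induction {p : H → Prop} (hp : IsClosed {x | p x}) (h : ∀ n ∈ N, p (n Ω)) {ξ : H}
    (hξ : ξ ∈ N.l2 Ω) : p ξ :=
  closure_minimal (s := (N.orbit Ω : Set H)) (by rintro _ ⟨n, hn, rfl⟩; exact h n hn) hp hξ

lemma ext_l2 {ξ η : H} (hξ : ξ ∈ N.l2 Ω) (hη : η ∈ N.l2 Ω)
    (h : ∀ n ∈ N, ⟪ξ, n Ω⟫_ℂ = ⟪η, n Ω⟫_ℂ) : ξ = η := by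
  rw [← sub_eq_zero, ← inner_self_eq_zero (𝕜 := ℂ)]
  refine l2_induction (N := N) (Ω := Ω) (p := fun ζ => ⟪ξ - η, ζ⟫_ℂ = 0)
    (isClosed_eq (by fun_prop) (by fun_prop)) (fun n hn => ?_) (sub_mem hξ hη)
  rw [inner_sub_left, h n hn, sub_self]

lemma IsLinear.mono (hNM : N ≤ M) {T : K →L[ℂ] L} (h : M.IsLinear T) : N.IsLinear T :=
  fun n hn => h n (hNM hn)

lemma IsLinear.comp {S : L →L[ℂ] L'} {T : K →L[ℂ] L} (hS : N.IsLinear S)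
    (hT : N.IsLinear T) : N.IsLinear (S ∘L T) := by
  intro n hn ξ η h
  exact hS n hn (T ξ) (T η) (hT n hn ξ η h)

lemma IsLinear.sub {S T : K →L[ℂ] L} (hS : N.IsLinear S) (hT : N.IsLinear T) :
    N.IsLinear (S - T) := by
  intro n hn ξ η h
  simp [hS n hn ξ η h, hT n hn ξ η h]

/-- `N` is closed under adjoints, so commutation with `star n` passes to commutation of the adjoint
with `n`. Invariance of `K` is needed because linearity only speaks of vectors whose image under `n`
stays in `K`. -/
lemma IsLinear.adjoint [CompleteSpace K] [CompleteSpace L] (hK : N.Leaves K)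
    {T : K →L[ℂ] L} (hT : N.IsLinear T) : N.IsLinear T.adjoint := by
  intro n hn ξ η h
  have key : T.adjoint η = ⟨n (T.adjoint ξ), hK n hn _ (T.adjoint ξ).2⟩ := by
    refine ext_inner_right ℂ fun z => ?_
    rw [ContinuousLinearMap.adjoint_inner_left, Submodule.coe_inner, h, Submodule.coe_inner]
    have hz : star n (z : H) ∈ K := hK _ (star_mem hn) _ z.2
    have e := hT (star n) (star_mem hn) z ⟨star n z, hz⟩ rfl
    rw [← ContinuousLinearMap.adjoint_inner_right, ← ContinuousLinearMap.adjoint_inner_right,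
      ← ContinuousLinearMap.star_eq_adjoint, ← e]
    have := ContinuousLinearMap.adjoint_inner_left T ⟨star n z, hz⟩ ξ
    rw [Submodule.coe_inner, Submodule.coe_inner] at this
    exact this.symm
  rw [key]

end VonNeumannAlgebra

open VonNeumannAlgebra

variable {J : AntiunitaryInvolution H} {Ω : H} {N M : VonNeumannAlgebra H}

lemma IsTracialConj.mono (hNM : N ≤ M) (h : IsTracialConj J Ω M) : IsTracialConj J Ω N :=
  fun n hn => h n (hNM hn)

namespace IsTracialConj

lemma map_mem_l2 (h : IsTracialConj J Ω N) {ξ : H} (hξ : ξ ∈ N.l2 Ω) : J ξ ∈ N.l2 Ω := by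
  refine l2_induction (p := fun ξ => J ξ ∈ N.l2 Ω) ?_ (fun n hn => ?_) hξ
  · exact (Submodule.isClosed_topologicalClosure _).preimage J.continuous
  · rw [h n hn]
    exact mem_l2_of_mem (star_mem hn)

lemma norm_star_apply (h : IsTracialConj J Ω N) {n : H →L[ℂ] H} (hn : n ∈ N) :
    ‖star n Ω‖ = ‖n Ω‖ := by rw [← h n hn, J.norm_map]

/-- Right multiplication on `N Ω`. -/
lemma rightMul_apply (h : IsTracialConj J Ω N) {n d : H →L[ℂ] H} (hn : n ∈ N) (hd : d ∈ N) :
    J.rightMul d (n Ω) = n (d Ω) := by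
  have h1 := h (n * d) (mul_mem hn hd)
  rw [AntiunitaryInvolution.rightMul_apply, h n hn, ← J.map_map (n (d Ω))]
  congr 1
  rw [star_mul] at h1
  exact h1.symm

lemma rightMul_apply_self (h : IsTracialConj J Ω N) {d : H →L[ℂ] H} (hd : d ∈ N) :
    J.rightMul d Ω = d Ω :=
  h.rightMul_apply (n := 1) (one_mem N) hd

lemma rightMul_mem_l2 (hNM : N ≤ M) (h : IsTracialConj J Ω M) {d : H →L[ℂ] H} (hd : d ∈ M) {ξ : H}
    (hξ : ξ ∈ N.l2 Ω) : J.rightMul d ξ ∈ M.l2 Ω := by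
  refine l2_induction (p := fun ξ => J.rightMul d ξ ∈ M.l2 Ω) ?_ (fun n hn => ?_) hξ
  · exact (Submodule.isClosed_topologicalClosure _).preimage (J.rightMul d).continuous
  · rw [h.rightMul_apply (hNM hn) hd]
    exact leaves_l2 n (hNM hn) _ (mem_l2_of_mem hd)

/-- Right multiplication by an element of `M`, as an operator from `L²(N)` to `L²(M)`. -/
noncomputable def rightMulL (hNM : N ≤ M) (h : IsTracialConj J Ω M) {d : H →L[ℂ] H} (hd : d ∈ M) :
    N.l2 Ω →L[ℂ] M.l2 Ω :=
  (J.rightMul d ∘L (N.l2 Ω).subtypeL).codRestrict (M.l2 Ω) fun ξ => rightMul_mem_l2 hNM h hd ξ.2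

lemma coe_rightMulL (hNM : N ≤ M) (h : IsTracialConj J Ω M) {d : H →L[ℂ] H} (hd : d ∈ M)
    (ξ : N.l2 Ω) : (rightMulL hNM h hd ξ : H) = J.rightMul d ξ := rfl

/-- Left and right multiplication commute by associativity on `N Ω`, hence on its closure. -/
lemma isLinear_rightMulL (hNM : N ≤ M) (h : IsTracialConj J Ω M) {d : H →L[ℂ] H} (hd : d ∈ M) :
    N.IsLinear (rightMulL hNM h hd) := by
  rintro n hn ⟨ξ, hξ⟩ ⟨η, hη⟩ (rfl : η = n ξ)
  rw [coe_rightMulL, coe_rightMulL]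
  refine l2_induction (p := fun ξ => J.rightMul d (n ξ) = n (J.rightMul d ξ))
    (isClosed_eq (by fun_prop) (by fun_prop)) (fun m hm => ?_) hξ
  rw [h.rightMul_apply (hNM hm) hd]
  exact h.rightMul_apply (n := n * m) (mul_mem (hNM hn) (hNM hm)) hd

lemma adjoint_rightMulL (h : IsTracialConj J Ω N) {d : H →L[ℂ] H} (hd : d ∈ N) :
    (rightMulL le_rfl h hd).adjoint = rightMulL le_rfl h (star_mem hd) := by
  symm
  rw [ContinuousLinearMap.eq_adjoint_iff]
  intro x y
  rw [Submodule.coe_inner, Submodule.coe_inner, coe_rightMulL, coe_rightMulL, J.inner_rightMul,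
    star_star]

/-- The conjugation takes `T Ω` to `T⋆ Ω` also for operators `T` on `L²(N)` that commute
with `N`. -/
lemma map_apply_of_isLinear (h : IsTracialConj J Ω N) {T : N.l2 Ω →L[ℂ] N.l2 Ω}
    (hT : N.IsLinear T) : J (T ⟨Ω, N.mem_l2 Ω⟩) = T.adjoint ⟨Ω, N.mem_l2 Ω⟩ := by
  refine ext_l2 (h.map_mem_l2 (T _).2) (T.adjoint _).2 fun n hn => ?_
  have e := hT n hn ⟨Ω, N.mem_l2 Ω⟩ ⟨n Ω, mem_l2_of_mem hn⟩ rfl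
  have := ContinuousLinearMap.adjoint_inner_left T ⟨n Ω, mem_l2_of_mem hn⟩ ⟨Ω, N.mem_l2 Ω⟩
  rw [Submodule.coe_inner, Submodule.coe_inner, e] at this
  rw [this, J.inner_left, h n hn, ContinuousLinearMap.star_eq_adjoint,
    ContinuousLinearMap.adjoint_inner_left]

/-- The vector state of Ω is therefore tracial on the commutant of `N` in `L²(N)` as well; all trace
identities for module isometries reduce to this. -/
lemma norm_adjoint_apply (h : IsTracialConj J Ω N) {T : N.l2 Ω →L[ℂ] N.l2 Ω}
    (hT : N.IsLinear T) :
    ‖T.adjoint ⟨Ω, N.mem_l2 Ω⟩‖ = ‖T ⟨Ω, N.mem_l2 Ω⟩‖ := by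
  rw [Submodule.coe_norm, ← h.map_apply_of_isLinear hT, J.norm_map, Submodule.coe_norm]

end IsTracialConj

end TracialVector

/-! ### The Murray-von Neumann dimension and the multiplicativity of the index -/

section Index

open scoped ENNReal InnerProductSpace
open VonNeumannAlgebra

variable {H : Type*} [NormedAddCommGroup H] [InnerProductSpace ℂ H] [CompleteSpace H]
  {J : AntiunitaryInvolution H} {Ω : H} {N M P : VonNeumannAlgebra H} {K K' : Submodule ℂ H}

lemma inner_self_eq_ofReal {E : Type*} [NormedAddCommGroup E] [InnerProductSpace ℂ E] (x : E) :
    ⟪x, x⟫_ℂ = ((‖x‖ ^ 2 : ℝ) : ℂ) := by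
  rw [inner_self_eq_norm_sq_to_K]
  simp

/-- The vector `Ω` as an element of `L²(N)`. -/
noncomputable def VonNeumannAlgebra.vac (N : VonNeumannAlgebra H) (Ω : H) : N.l2 Ω :=
  ⟨Ω, N.mem_l2 Ω⟩

lemma IsModuleIsometry.isLinear {V : ℕ → K →L[ℂ] N.l2 Ω} (hV : IsModuleIsometry N Ω K V) (i : ℕ) :
    N.IsLinear (V i) := fun n hn ξ η h => hV.linear n hn ξ η h i

lemma IsModuleIsometry.tsum_enorm {V : ℕ → K →L[ℂ] N.l2 Ω} (hV : IsModuleIsometry N Ω K V)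
    (ξ : K) : ∑' i, ‖V i ξ‖ₑ ^ 2 = ‖ξ‖ₑ ^ 2 := by
  have h := hV.isometry ξ
  have h2 := ENNReal.ofReal_tsum_of_nonneg (fun i => sq_nonneg ‖V i ξ‖) h.summable
  rw [h.tsum_eq] at h2
  rw [← ofReal_norm, ← ENNReal.ofReal_pow (norm_nonneg _), h2]
  refine tsum_congr fun i => ?_
  rw [← ofReal_norm, ← ENNReal.ofReal_pow (norm_nonneg _)]

/-- The trace property of the functional `T ↦ ∑ᵢ ⟨Vᵢ⋆ Ω, T Vᵢ⋆ Ω⟩` on the commutant. -/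
lemma tsum_enorm_adjoint_comm [CompleteSpace K] [CompleteSpace K'] (hJ : IsTracialConj J Ω N)
    (hK : N.Leaves K)
    {V : ℕ → K →L[ℂ] N.l2 Ω} (hV : IsModuleIsometry N Ω K V)
    {W : ℕ → K' →L[ℂ] N.l2 Ω} (hW : IsModuleIsometry N Ω K' W)
    {T : K →L[ℂ] K'} (hT : N.IsLinear T) :
    ∑' i, ‖T ((V i).adjoint (N.vac Ω))‖ₑ ^ 2 = ∑' j, ‖T.adjoint ((W j).adjoint (N.vac Ω))‖ₑ ^ 2 := by
  -- Both sides become double sums over the matrix entries `W j ∘ T ∘ (V i)⋆` and their adjoints.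
  -- Each entry lies in the commutant of `N` on `L²(N)`, where an operator and its adjoint have the
  -- same norm at Ω.
  have h1 : ∀ i, ‖T ((V i).adjoint (N.vac Ω))‖ₑ ^ 2 =
      ∑' j, ‖(W j ∘L T ∘L (V i).adjoint) (N.vac Ω)‖ₑ ^ 2 :=
    fun i => (hW.tsum_enorm _).symm
  have h2 : ∀ j, ‖T.adjoint ((W j).adjoint (N.vac Ω))‖ₑ ^ 2 =
      ∑' i, ‖(V i ∘L T.adjoint ∘L (W j).adjoint) (N.vac Ω)‖ₑ ^ 2 :=
    fun j => (hV.tsum_enorm _).symm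
  simp_rw [h1, h2]
  rw [ENNReal.tsum_comm]
  refine tsum_congr fun j => tsum_congr fun i => ?_
  have hlin : N.IsLinear (W j ∘L T ∘L (V i).adjoint) :=
    (hW.isLinear j).comp (hT.comp ((hV.isLinear i).adjoint hK))
  have h3 := hJ.norm_adjoint_apply hlin
  rw [ContinuousLinearMap.adjoint_comp, ContinuousLinearMap.adjoint_comp,
    ContinuousLinearMap.adjoint_adjoint, ContinuousLinearMap.comp_assoc] at h3
  rw [← ofReal_norm, ← ofReal_norm]
  exact congrArg (fun r => ENNReal.ofReal r ^ 2) h3.symm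

lemma adjoint_id_eq (E : Type*) [NormedAddCommGroup E] [InnerProductSpace ℂ E] [CompleteSpace E] :
    (ContinuousLinearMap.id ℂ E).adjoint = ContinuousLinearMap.id ℂ E :=
  ((ContinuousLinearMap.eq_adjoint_iff _ _).2 fun _ _ => rfl).symm

/-- The dimension can be computed from any module isometry. -/
lemma mvnDim_eq [CompleteSpace K] (hJ : IsTracialConj J Ω N) (hK : N.Leaves K)
    {V : ℕ → K →L[ℂ] N.l2 Ω} (hV : IsModuleIsometry N Ω K V) :
    mvnDim N Ω K = ∑' i, ‖(V i).adjoint (N.vac Ω)‖ₑ ^ 2 := by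
  refine le_antisymm (iInf₂_le V hV) (le_iInf₂ fun W hW => ?_)
  refine le_of_eq ?_
  have h := tsum_enorm_adjoint_comm hJ hK hV hW (T := ContinuousLinearMap.id ℂ K)
    (fun n _ ξ η h => h)
  simp only [adjoint_id_eq, ContinuousLinearMap.id_apply] at h
  exact h

/-- Restriction of a module isometry to a smaller module. -/
lemma IsModuleIsometry.restrict (h : K ≤ K') {V : ℕ → K' →L[ℂ] N.l2 Ω}
    (hV : IsModuleIsometry N Ω K' V) :
    IsModuleIsometry N Ω K fun i =>
      V i ∘L (K.subtypeL.codRestrict K' fun ξ => h ξ.2) where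
  isometry ξ := hV.isometry ⟨ξ, h ξ.2⟩
  linear T hT ξ η e i := hV.linear T hT ⟨ξ, h ξ.2⟩ ⟨η, h η.2⟩ e i

/-- Restricting an isometry composes its adjoint with the adjoint of an inclusion, a contraction. No
finiteness or tracial vector is needed. -/
lemma mvnDim_mono [CompleteSpace K] [CompleteSpace K'] (h : K ≤ K') :
    mvnDim N Ω K ≤ mvnDim N Ω K' := by
  refine le_iInf₂ fun V hV => (iInf₂_le _ (hV.restrict h)).trans ?_
  refine ENNReal.tsum_le_tsum fun i => ?_
  rw [ContinuousLinearMap.adjoint_comp]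
  have hn : ‖(K.subtypeL.codRestrict K' fun ξ => h ξ.2).adjoint‖ ≤ 1 := by
    rw [LinearIsometryEquiv.norm_map]
    exact ContinuousLinearMap.opNorm_le_bound _ zero_le_one fun ξ => by simp
  rw [← ofReal_norm, ← ofReal_norm]
  gcongr
  refine ((K.subtypeL.codRestrict K' fun ξ => h ξ.2).adjoint.le_opNorm _).trans ?_
  exact mul_le_of_le_one_left (norm_nonneg _) hn

/-- An infimum over the empty set is `⊤`. -/
lemma exists_of_mvnDim_lt_top [CompleteSpace K] (h : mvnDim N Ω K < ⊤) :
    ∃ V : ℕ → K →L[ℂ] N.l2 Ω, IsModuleIsometry N Ω K V := by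
  by_contra! hV
  refine h.ne ?_
  simp [mvnDim, hV]

lemma jonesIndex_mono (M' : VonNeumannAlgebra H) (h : M ≤ M') :
    jonesIndex Ω M N ≤ jonesIndex Ω M' N := mvnDim_mono (l2_mono h)

lemma jonesIndex_self (hJ : IsTracialConj J Ω N) (hΩ : ‖Ω‖ = 1) : jonesIndex Ω N N = 1 := by
  have hV : IsModuleIsometry N Ω (N.l2 Ω)
      (fun i => if i = 0 then ContinuousLinearMap.id ℂ _ else 0) :=
    { isometry := fun ξ => by
        convert hasSum_single (f := fun i : ℕ => ‖(if i = 0 then ContinuousLinearMap.id ℂ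
          (N.l2 Ω) else 0) ξ‖ ^ 2) 0 fun i hi => ?_ <;> simp_all
      linear := fun T hT ξ η h i => by
        by_cases hi : i = 0 <;> simp [hi, h] }
  rw [jonesIndex, mvnDim_eq hJ leaves_l2 hV, tsum_eq_single 0]
  · have : ‖N.vac Ω‖ = 1 := hΩ
    rw [if_pos rfl, adjoint_id_eq, ContinuousLinearMap.id_apply, ← ofReal_norm, this]
    simp
  · intro i hi
    simp [hi]

/-- `N` is generated, as far as `L²(N)` is concerned, by a ⋆-subalgebra with a unique normalized
positive trace, the vector state of `Ω`. -/
def HasUniqueTraceCore (Ω : H) (N : VonNeumannAlgebra H) : Prop :=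
  ∃ D : StarSubalgebra ℂ (H →L[ℂ] H), (∀ d ∈ D, d ∈ N) ∧
    (N.l2 Ω : Set H) ⊆ closure ((fun d : H →L[ℂ] H => d Ω) '' D) ∧
    ∀ φ : D →ₗ[ℂ] ℂ, IsTraceFunctional φ → φ 1 = 1 → ∀ d : D, φ d = ⟪Ω, (d : H →L[ℂ] H) Ω⟫_ℂ

/-- The values at `a⋆ a` and `a a⋆` are `‖a Ω‖²` and `‖a⋆ Ω‖²`, which agree because `J` is
isometric. -/
lemma IsTracialConj.isTraceFunctional (hJ : IsTracialConj J Ω N)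
    (D : StarSubalgebra ℂ (H →L[ℂ] H)) (hD : ∀ d ∈ D, d ∈ N) (φ : D →ₗ[ℂ] ℂ)
    (hφ : ∀ d : D, φ d = ⟪Ω, (d : H →L[ℂ] H) Ω⟫_ℂ) : IsTraceFunctional φ := by
  have key : ∀ a : D, φ (star a * a) = ((‖(a : H →L[ℂ] H) Ω‖ ^ 2 : ℝ) : ℂ) := fun a => by
    rw [hφ, ← inner_self_eq_ofReal]
    change ⟪Ω, (star (a : H →L[ℂ] H)) ((a : H →L[ℂ] H) Ω)⟫_ℂ = _
    rw [ContinuousLinearMap.star_eq_adjoint, ContinuousLinearMap.adjoint_inner_right]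
  refine ⟨fun a => ?_, mul_comm_of_star_mul_self φ fun a => ?_⟩
  · rw [key]
    exact Complex.zero_le_real.2 (sq_nonneg _)
  · have := key (star a)
    rw [star_star] at this
    rw [key, this]
    change _ = ((‖star (a : H →L[ℂ] H) Ω‖ ^ 2 : ℝ) : ℂ)
    rw [hJ.norm_star_apply (hD _ a.2)]

/-- The functional `d ↦ ∑ⱼ ⟨ξⱼ, ξⱼ d⟩`. -/
noncomputable def rightFunctional (J : AntiunitaryInvolution H) (D : StarSubalgebra ℂ (H →L[ℂ] H))
    (ξ : ℕ → H) (hξ : Summable fun j => ‖ξ j‖ ^ 2) : D →ₗ[ℂ] ℂ :=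
  have hs : ∀ d : H →L[ℂ] H, Summable fun j => ⟪ξ j, J.rightMul d (ξ j)⟫_ℂ := fun d => by
    refine Summable.of_norm_bounded (hξ.mul_left ‖J.rightMul d‖) fun j => ?_
    refine (norm_inner_le_norm _ _).trans ?_
    rw [sq, mul_left_comm]
    exact mul_le_mul_of_nonneg_left ((J.rightMul d).le_opNorm _) (norm_nonneg _)
  { toFun := fun d => ∑' j, ⟪ξ j, J.rightMul d (ξ j)⟫_ℂ
    map_add' := fun d e => by
      rw [← (hs d).tsum_add (hs e)]
      simp [J.rightMul_add]
    map_smul' := fun c d => by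
      rw [RingHom.id_apply, smul_eq_mul, ← tsum_mul_left]
      simp [J.rightMul_smul] }

/-- Right multiplication reverses products, which is why the adjoint of `d` appears in the norm. -/
lemma rightFunctional_star_mul_self {D : StarSubalgebra ℂ (H →L[ℂ] H)}
    {ξ : ℕ → H} (hξ : Summable fun j => ‖ξ j‖ ^ 2) (d : D) :
    rightFunctional J D ξ hξ (star d * d) =
      ((∑' j, ‖J.rightMul (star (d : H →L[ℂ] H)) (ξ j)‖ ^ 2 : ℝ) : ℂ) := by
  change ∑' j, ⟪ξ j, J.rightMul (star (d : H →L[ℂ] H) * d) (ξ j)⟫_ℂ = _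
  rw [Complex.ofReal_tsum]
  refine tsum_congr fun j => ?_
  rw [J.rightMul_mul, mul_apply_eq_comp, ← inner_conj_symm, J.inner_rightMul,
    inner_self_eq_ofReal, Complex.conj_ofReal]

lemma tsum_enorm_sq_eq_ofReal {E : Type*} [NormedAddCommGroup E] {f : ℕ → E}
    (hf : Summable fun j => ‖f j‖ ^ 2) :
    ∑' j, ‖f j‖ₑ ^ 2 = ENNReal.ofReal (∑' j, ‖f j‖ ^ 2) := by
  rw [ENNReal.ofReal_tsum_of_nonneg (fun j => sq_nonneg _) hf]
  refine tsum_congr fun j => ?_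
  rw [← ofReal_norm, ENNReal.ofReal_pow (norm_nonneg _)]

lemma summable_of_tsum_enorm_ne_top {E : Type*} [NormedAddCommGroup E] {f : ℕ → E}
    (hf : ∑' j, ‖f j‖ₑ ^ 2 ≠ ⊤) : Summable fun j => ‖f j‖ ^ 2 := by
  have := ENNReal.summable_toReal hf
  simpa using this

lemma summable_norm_sq_apply {E F : Type*} [NormedAddCommGroup E] [NormedSpace ℂ E]
    [NormedAddCommGroup F] [NormedSpace ℂ F] (T : E →L[ℂ] F) {f : ℕ → E}
    (hf : Summable fun j => ‖f j‖ ^ 2) : Summable fun j => ‖T (f j)‖ ^ 2 := by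
  refine Summable.of_nonneg_of_le (fun j => sq_nonneg _) (fun j => ?_) (hf.mul_left (‖T‖ ^ 2))
  rw [← mul_pow]
  exact pow_le_pow_left₀ (norm_nonneg _) (T.le_opNorm _) 2

/-- The trace of `P'` restricted to right multiplications by elements of `D`. -/
lemma tsum_rightMul_sq (hPN : P ≤ N) (hJ : IsTracialConj J Ω N) (hΩ : ‖Ω‖ = 1)
    {D : StarSubalgebra ℂ (H →L[ℂ] H)} (hD : ∀ d ∈ D, d ∈ N)
    (huniq : ∀ φ : D →ₗ[ℂ] ℂ, IsTraceFunctional φ → φ 1 = 1 →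
      ∀ d : D, φ d = ⟪Ω, (d : H →L[ℂ] H) Ω⟫_ℂ)
    {W : ℕ → N.l2 Ω →L[ℂ] P.l2 Ω} (hW : IsModuleIsometry P Ω (N.l2 Ω) W)
    (hs : Summable fun j => ‖(W j).adjoint (P.vac Ω)‖ ^ 2) {d : H →L[ℂ] H} (hd : d ∈ D) :
    ∑' j, ‖J.rightMul d ((W j).adjoint (P.vac Ω))‖ ^ 2 =
      (∑' j, ‖(W j).adjoint (P.vac Ω)‖ ^ 2) * ‖d Ω‖ ^ 2 := by
  set ξ : ℕ → N.l2 Ω := fun j => (W j).adjoint (P.vac Ω) with hξdef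
  have hξ : Summable fun j => ‖(ξ j : H)‖ ^ 2 := hs
  set ψ := rightFunctional J D (fun j => (ξ j : H)) hξ with hψ
  have hstar : ∀ d : D, ψ (star d * d) =
      ((∑' j, ‖J.rightMul (star (d : H →L[ℂ] H)) (ξ j)‖ ^ 2 : ℝ) : ℂ) :=
    rightFunctional_star_mul_self hξ
  -- Right multiplication by `d` is `P`-linear on `L²(N)` and its adjoint is right multiplication by
  -- `d⋆`, so the trace property on the commutant of `P` applies. It makes `ψ` tracial.
  have hsymm : ∀ d ∈ D, ∑' j, ‖J.rightMul (star (d : H →L[ℂ] H)) (ξ j)‖ ^ 2 =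
      ∑' j, ‖J.rightMul d (ξ j)‖ ^ 2 := by
    intro d hd
    have h := tsum_enorm_adjoint_comm (hJ.mono hPN) (leaves_l2_of_le hPN) hW hW
      (T := IsTracialConj.rightMulL le_rfl hJ (hD d hd))
      ((IsTracialConj.isLinear_rightMulL le_rfl hJ (hD d hd)).mono hPN)
    rw [hJ.adjoint_rightMulL, tsum_enorm_sq_eq_ofReal (summable_norm_sq_apply _ hs),
      tsum_enorm_sq_eq_ofReal (summable_norm_sq_apply _ hs),
      ENNReal.ofReal_eq_ofReal_iff (tsum_nonneg fun _ => sq_nonneg _)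
        (tsum_nonneg fun _ => sq_nonneg _)] at h
    exact h.symm
  have hψtr : IsTraceFunctional ψ := by
    refine ⟨fun a => ?_, mul_comm_of_star_mul_self ψ fun a => ?_⟩
    · rw [hstar]
      exact Complex.zero_le_real.2 (tsum_nonneg fun _ => sq_nonneg _)
    · have := hstar (star a)
      rw [star_star] at this
      rw [this, hstar]
      change _ = ((∑' j, ‖J.rightMul (star (star (a : H →L[ℂ] H))) (ξ j)‖ ^ 2 : ℝ) : ℂ)
      rw [star_star, hsymm a a.2]
  set c : ℝ := ∑' j, ‖ξ j‖ ^ 2 with hc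
  have hc0 : 0 ≤ c := tsum_nonneg fun _ => sq_nonneg _
  have hψ1 : ψ 1 = c := by
    have := hstar 1
    rw [star_one, one_mul] at this
    rw [this]
    congr 1
    refine tsum_congr fun j => ?_
    have h1 : J.rightMul (star ((1 : D) : H →L[ℂ] H)) = 1 := by
      ext x
      rw [AntiunitaryInvolution.rightMul_apply]
      simp [J.map_map]
    rw [h1]
    rfl
  let ω : D →ₗ[ℂ] ℂ := (innerSL ℂ Ω).toLinearMap ∘ₗ
    (ContinuousLinearMap.apply ℂ H Ω).toLinearMap ∘ₗ D.toSubalgebra.toSubmodule.subtype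
  have hω : ∀ d : D, ω d = ⟪Ω, (d : H →L[ℂ] H) Ω⟫_ℂ := fun d => rfl
  have hωtr := hJ.isTraceFunctional D hD ω hω
  have hω1 : ω 1 = 1 := by
    rw [hω]
    change ⟪Ω, Ω⟫_ℂ = 1
    rw [inner_self_eq_ofReal, hΩ]
    simp
  have hpos : (1 + c : ℂ) ≠ 0 := by
    have : (1 + c : ℝ) ≠ 0 := by positivity
    exact_mod_cast this
  have hinv : (0 : ℂ) ≤ (1 + c : ℂ)⁻¹ := by
    have : (0 : ℝ) ≤ (1 + c)⁻¹ := by positivity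
    exact_mod_cast this
  -- Only normalized traces are controlled, and `ψ 1 = c` could be zero. Adding the vector state
  -- first gives total mass `1 + c`, which cannot vanish.
  have huse := huniq ((1 + c : ℂ)⁻¹ • (ω + ψ))
    ⟨fun a => by
      simp only [LinearMap.smul_apply, LinearMap.add_apply, smul_eq_mul]
      exact mul_nonneg hinv (add_nonneg (hωtr.nonneg a) (hψtr.nonneg a)),
     fun a b => by
      simp only [LinearMap.smul_apply, LinearMap.add_apply]
      rw [hωtr.mul_comm, hψtr.mul_comm]⟩
    (by
      simp only [LinearMap.smul_apply, LinearMap.add_apply, smul_eq_mul]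
      rw [hω1, hψ1, inv_mul_cancel₀ hpos])
  have hψω : ∀ a : D, ψ a = c * ω a := by
    intro a
    have h := huse a
    rw [← hω] at h
    simp only [LinearMap.smul_apply, LinearMap.add_apply, smul_eq_mul] at h
    rw [inv_mul_eq_iff_eq_mul₀ hpos] at h
    linear_combination h
  have hfin := hψω (star ⟨d, hd⟩ * ⟨d, hd⟩)
  rw [hstar, hω] at hfin
  change ((∑' j, ‖J.rightMul (star d) (ξ j)‖ ^ 2 : ℝ) : ℂ) = c * ⟪Ω, star d (d Ω)⟫_ℂ at hfin
  rw [hsymm d hd, ContinuousLinearMap.star_eq_adjoint, ContinuousLinearMap.adjoint_inner_right,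
    inner_self_eq_ofReal, ← Complex.ofReal_mul] at hfin
  exact Complex.ofReal_injective hfin

/-- A pair of quadratic forms on operators; the second one dominates the first and they agree
at all right multiplications. -/
lemma tsum_apply_le (hJ : IsTracialConj J Ω N)
    {D : StarSubalgebra ℂ (H →L[ℂ] H)} (hD : ∀ d ∈ D, d ∈ N)
    (hdense : (N.l2 Ω : Set H) ⊆ closure ((fun d : H →L[ℂ] H => d Ω) '' D))
    {ξ : ℕ → N.l2 Ω} (hs : Summable fun j => ‖ξ j‖ ^ 2) {c : ℝ} (hc : 0 ≤ c)
    (hξ : ∀ d ∈ D, ∑' j, ‖J.rightMul d (ξ j)‖ ^ 2 = c * ‖d Ω‖ ^ 2)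
    {T : N.l2 Ω →L[ℂ] N.l2 Ω} (hT : N.IsLinear T) :
    ∑' j, ‖T (ξ j)‖ ^ 2 ≤ c * ‖T (N.vac Ω)‖ ^ 2 := by
  -- `T` is approximated by right multiplications through its value at Ω alone: `d k Ω → T Ω`. The
  -- operators `d k` need not be bounded in norm; the hypothesis on `ξ` still makes each sequence `ξ
  -- j · d k` Cauchy.
  obtain ⟨y, hy, hlim⟩ := mem_closure_iff_seq_limit.1 (hdense (T (N.vac Ω)).2)
  choose d hdD hdy using hy
  simp only at hdy
  have hsd : ∀ e : H →L[ℂ] H, Summable fun j => ‖J.rightMul e (ξ j)‖ ^ 2 := fun e =>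
    summable_norm_sq_apply (J.rightMul e) (f := fun j => (ξ j : H)) hs
  have hbound : ∀ e ∈ D, ∀ j, ‖J.rightMul e (ξ j)‖ ≤ √c * ‖e Ω‖ := by
    intro e he j
    refine abs_le_of_sq_le_sq' ?_ (by positivity) |>.2
    rw [mul_pow, Real.sq_sqrt hc, ← hξ e he]
    exact (hsd e).le_tsum j fun _ _ => sq_nonneg _
  have hconv : ∀ j, Filter.Tendsto (fun k => J.rightMul (d k) (ξ j)) Filter.atTop
      (nhds (T (ξ j) : H)) := by
    intro j
    have hcau : CauchySeq fun k => J.rightMul (d k) (ξ j : H) := by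
      have hy' : CauchySeq y := hlim.cauchySeq
      rw [Metric.cauchySeq_iff'] at hy' ⊢
      intro ε hε
      obtain ⟨n₀, hn₀⟩ := hy' (ε / (√c + 1)) (by positivity)
      refine ⟨n₀, fun n hn => ?_⟩
      have h1 := hn₀ n hn
      rw [dist_eq_norm, ← hdy, ← hdy] at h1
      have h2 := hbound (d n - d n₀) (sub_mem (hdD n) (hdD n₀)) j
      have h3 : J.rightMul (d n - d n₀) = J.rightMul (d n) - J.rightMul (d n₀) := by
        rw [sub_eq_add_neg, ← neg_one_smul ℂ (d n₀), J.rightMul_add, J.rightMul_smul]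
        simp [sub_eq_add_neg]
      rw [h3] at h2
      rw [dist_eq_norm]
      refine lt_of_le_of_lt h2 ?_
      calc √c * ‖d n Ω - d n₀ Ω‖ ≤ (√c + 1) * ‖d n Ω - d n₀ Ω‖ := by gcongr; simp
        _ < (√c + 1) * (ε / (√c + 1)) := by gcongr
        _ = ε := by field_simp
    obtain ⟨η, hη⟩ := cauchySeq_tendsto_of_complete hcau
    have hηmem : η ∈ N.l2 Ω := (Submodule.isClosed_topologicalClosure _).mem_of_tendsto hη
      (Filter.Eventually.of_forall fun k =>
        IsTracialConj.rightMul_mem_l2 le_rfl hJ (hD _ (hdD k)) (ξ j).2)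
    -- Tested against `n Ω`, right multiplication by `d k` moves to the other side as `n (J (d k
    -- Ω))`, which tends to `n (J (T Ω)) = n (T⋆ Ω) = T⋆ (n Ω)`.
    have : η = T (ξ j) := by
      refine ext_l2 hηmem (T (ξ j)).2 fun n hn => ?_
      have l1 : Filter.Tendsto (fun k => ⟪J.rightMul (d k) (ξ j), n Ω⟫_ℂ) Filter.atTop
          (nhds ⟪η, n Ω⟫_ℂ) := hη.inner tendsto_const_nhds
      have l2 : ∀ k, ⟪J.rightMul (d k) (ξ j), n Ω⟫_ℂ = ⟪(ξ j : H), n (J (d k Ω))⟫_ℂ := by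
        intro k
        rw [J.inner_rightMul, hJ.rightMul_apply hn (star_mem (hD _ (hdD k))),
          hJ _ (hD _ (hdD k))]
      simp_rw [l2, hdy] at l1
      have l3 : Filter.Tendsto (fun k => ⟪(ξ j : H), n (J (y k))⟫_ℂ) Filter.atTop
          (nhds ⟪(ξ j : H), n (J (T (N.vac Ω)))⟫_ℂ) :=
        tendsto_const_nhds.inner ((n.continuous.comp J.continuous).continuousAt.tendsto.comp hlim)
      rw [tendsto_nhds_unique l1 l3]
      have e1 := hJ.map_apply_of_isLinear hT
      change J (T (N.vac Ω)) = T.adjoint (N.vac Ω) at e1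
      have e2 := (hT.adjoint leaves_l2) n hn (N.vac Ω) ⟨n Ω, mem_l2_of_mem hn⟩ rfl
      rw [e1, ← e2]
      have e3 := ContinuousLinearMap.adjoint_inner_right T (ξ j) ⟨n Ω, mem_l2_of_mem hn⟩
      rw [Submodule.coe_inner, Submodule.coe_inner] at e3
      exact e3
    rwa [this] at hη
  -- A Fatou argument: only finite partial sums pass to the limit, hence merely an inequality.
  refine Real.tsum_le_of_sum_le (fun _ => sq_nonneg _) fun F => ?_
  have l1 : Filter.Tendsto (fun k => ∑ j ∈ F, ‖J.rightMul (d k) (ξ j)‖ ^ 2) Filter.atTop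
      (nhds (∑ j ∈ F, ‖(T (ξ j) : H)‖ ^ 2)) :=
    tendsto_finsetSum _ fun j _ => ((hconv j).norm).pow 2
  have l2 : Filter.Tendsto (fun k => c * ‖y k‖ ^ 2) Filter.atTop
      (nhds (c * ‖(T (N.vac Ω) : H)‖ ^ 2)) := ((hlim.norm).pow 2).const_mul c
  refine le_of_tendsto_of_tendsto' l1 l2 fun k => ?_
  rw [← hdy, ← hξ _ (hdD k)]
  exact (hsd (d k)).sum_le_tsum F fun _ _ => sq_nonneg _

lemma norm_sq_add_norm_sq_sub {E : Type*} [NormedAddCommGroup E] [InnerProductSpace ℂ E] (x y : E) :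
    ‖x + y‖ ^ 2 + ‖x - y‖ ^ 2 = 2 * ‖x‖ ^ 2 + 2 * ‖y‖ ^ 2 := by
  have := parallelogram_law_with_norm ℂ x y
  linarith

/-- If `∑ⱼ ‖ξⱼ d‖² = c ‖d‖²` for all `d ∈ D`, then this holds for all operators in the
commutant. -/
lemma tsum_apply_eq (hJ : IsTracialConj J Ω N)
    {D : StarSubalgebra ℂ (H →L[ℂ] H)} (hD : ∀ d ∈ D, d ∈ N)
    (hdense : (N.l2 Ω : Set H) ⊆ closure ((fun d : H →L[ℂ] H => d Ω) '' D))
    {ξ : ℕ → N.l2 Ω} (hs : Summable fun j => ‖ξ j‖ ^ 2) {c : ℝ} (hc : 0 ≤ c)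
    (hξ : ∀ d ∈ D, ∑' j, ‖J.rightMul d (ξ j)‖ ^ 2 = c * ‖d Ω‖ ^ 2)
    {T : N.l2 Ω →L[ℂ] N.l2 Ω} (hT : N.IsLinear T) :
    ∑' j, ‖T (ξ j)‖ ^ 2 = c * ‖T (N.vac Ω)‖ ^ 2 := by
  refine le_antisymm (tsum_apply_le hJ hD hdense hs hc hξ hT) ?_
  refine le_of_forall_pos_le_add fun ε hε => ?_
  obtain ⟨_, ⟨d, hd, rfl⟩, hdist⟩ := Metric.mem_closure_iff.1 (hdense (T (N.vac Ω)).2)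
    (√(ε / (2 * (c + 1)))) (by positivity)
  set R := IsTracialConj.rightMulL le_rfl hJ (hD d hd) with hR
  have hRlin : N.IsLinear R := IsTracialConj.isLinear_rightMulL le_rfl hJ (hD d hd)
  have hRΩ : (R (N.vac Ω) : H) = d Ω := hJ.rightMul_apply_self (hD d hd)
  have hS := fun S : N.l2 Ω →L[ℂ] N.l2 Ω => summable_norm_sq_apply S hs
  have p1 : ∑' j, ‖(T - R - R) (ξ j)‖ ^ 2 ≤ c * ‖(T - R - R) (N.vac Ω)‖ ^ 2 :=
    tsum_apply_le hJ hD hdense hs hc hξ ((hT.sub hRlin).sub hRlin)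
  have p2 : 0 ≤ ∑' j, ‖(T - R) (ξ j)‖ ^ 2 := tsum_nonneg fun _ => sq_nonneg _
  have e0 : T - R + R = T := sub_add_cancel _ _
  have q1 : ∑' j, ‖(T - R + R) (ξ j)‖ ^ 2 + ∑' j, ‖(T - R - R) (ξ j)‖ ^ 2 =
      2 * ∑' j, ‖(T - R) (ξ j)‖ ^ 2 + 2 * ∑' j, ‖R (ξ j)‖ ^ 2 := by
    rw [← tsum_mul_left, ← tsum_mul_left, ← (hS _).tsum_add (hS _),
      ← ((hS _).mul_left 2).tsum_add ((hS _).mul_left 2)]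
    exact tsum_congr fun j => norm_sq_add_norm_sq_sub _ _
  have q2 : ‖(T - R + R) (N.vac Ω)‖ ^ 2 + ‖(T - R - R) (N.vac Ω)‖ ^ 2 =
      2 * ‖(T - R) (N.vac Ω)‖ ^ 2 + 2 * ‖R (N.vac Ω)‖ ^ 2 := norm_sq_add_norm_sq_sub _ _
  rw [e0] at q1 q2
  have q3 : ∑' j, ‖R (ξ j)‖ ^ 2 = c * ‖R (N.vac Ω)‖ ^ 2 := by
    rw [Submodule.coe_norm, hRΩ, ← hξ d hd]
    rfl
  have hsmall : c * ‖(T - R) (N.vac Ω)‖ ^ 2 ≤ ε / 2 := by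
    change dist (T (N.vac Ω) : H) (d Ω) < _ at hdist
    rw [dist_eq_norm, ← hRΩ, ← Submodule.coe_sub, ← Submodule.coe_norm] at hdist
    have h1 : ‖(T - R) (N.vac Ω)‖ ^ 2 ≤ ε / (2 * (c + 1)) := by
      rw [← Real.sq_sqrt (by positivity : 0 ≤ ε / (2 * (c + 1)))]
      exact pow_le_pow_left₀ (norm_nonneg _) hdist.le 2
    calc c * ‖(T - R) (N.vac Ω)‖ ^ 2 ≤ (c + 1) * (ε / (2 * (c + 1))) := by
          gcongr; linarith
      _ = ε / 2 := by field_simp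
  have q2' := congrArg (c * ·) q2
  simp only [mul_add, mul_left_comm c 2] at q2'
  linarith

/-- Composition of module isometries. -/
lemma IsModuleIsometry.comp (hPN : P ≤ N) {V : ℕ → K →L[ℂ] N.l2 Ω}
    (hV : IsModuleIsometry N Ω K V)
    {W : ℕ → N.l2 Ω →L[ℂ] P.l2 Ω} (hW : IsModuleIsometry P Ω (N.l2 Ω) W) :
    IsModuleIsometry P Ω K fun k => W k.unpair.2 ∘L V k.unpair.1 where
  isometry ξ := by
    have h : HasSum (fun p : ℕ × ℕ => ‖W p.2 (V p.1 ξ)‖ ^ 2) (‖ξ‖ ^ 2) := by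
      have hs : Summable fun p : ℕ × ℕ => ‖W p.2 (V p.1 ξ)‖ ^ 2 := by
        rw [summable_prod_of_nonneg fun _ => sq_nonneg _]
        refine ⟨fun i => (hW.isometry (V i ξ)).summable, ?_⟩
        simp_rw [fun i => (hW.isometry (V i ξ)).tsum_eq]
        exact (hV.isometry ξ).summable
      have := hs.hasSum.prod_fiberwise fun i => hW.isometry (V i ξ)
      rw [(hV.isometry ξ).unique this]
      exact hs.hasSum
    exact (Nat.pairEquiv.symm.hasSum_iff (f := fun p : ℕ × ℕ => ‖W p.2 (V p.1 ξ)‖ ^ 2)).2 h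
  linear T hT ξ η e k :=
    hW.linear T hT _ _ (hV.linear T (hPN hT) ξ η e k.unpair.1) k.unpair.2

/-- Multiplicativity of the index. -/
theorem jonesIndex_mul (hPN : P ≤ N) (hNM : N ≤ M) (hJ : IsTracialConj J Ω N) (hΩ : ‖Ω‖ = 1)
    (hN : HasUniqueTraceCore Ω N) (h₁ : jonesIndex Ω M N < ⊤) (h₂ : jonesIndex Ω N P < ⊤) :
    jonesIndex Ω M P = jonesIndex Ω M N * jonesIndex Ω N P := by
  obtain ⟨V, hV⟩ := exists_of_mvnDim_lt_top h₁
  obtain ⟨W, hW⟩ := exists_of_mvnDim_lt_top h₂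
  obtain ⟨D, hD, hdense, huniq⟩ := hN
  have eV := mvnDim_eq hJ (leaves_l2_of_le hNM) hV
  have eW := mvnDim_eq (hJ.mono hPN) (leaves_l2_of_le hPN) hW
  have eC := mvnDim_eq (hJ.mono hPN) (leaves_l2_of_le (hPN.trans hNM)) (hV.comp hPN hW)
  have hs : Summable fun j => ‖(W j).adjoint (P.vac Ω)‖ ^ 2 :=
    summable_of_tsum_enorm_ne_top (by rw [← eW]; exact h₂.ne)
  have hξ := fun d (hd : d ∈ D) => tsum_rightMul_sq hPN hJ hΩ hD huniq hW hs hd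
  -- The crux: the trace attached to `W` is proportional to the vector state of Ω on the commutant
  -- of `N`, with the index of `P` in `N` as factor.
  have hT : ∀ T : N.l2 Ω →L[ℂ] N.l2 Ω, N.IsLinear T →
      ∑' j, ‖T ((W j).adjoint (P.vac Ω))‖ₑ ^ 2 =
        (∑' j, ‖(W j).adjoint (P.vac Ω)‖ₑ ^ 2) * ‖T (N.vac Ω)‖ₑ ^ 2 := by
    intro T hT
    rw [tsum_enorm_sq_eq_ofReal (summable_norm_sq_apply T hs), tsum_enorm_sq_eq_ofReal hs,
      tsum_apply_eq hJ hD hdense hs (tsum_nonneg fun _ => sq_nonneg _) hξ hT,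
      ENNReal.ofReal_mul (tsum_nonneg fun _ => sq_nonneg _), ENNReal.ofReal_pow (norm_nonneg _),
      ofReal_norm]
  rw [jonesIndex, jonesIndex, jonesIndex, eC, eV, eW,
    ← Nat.pairEquiv.tsum_eq, ENNReal.tsum_prod', ← ENNReal.tsum_mul_right]
  refine tsum_congr fun i => ?_
  -- Inserting the isometry `V` produces the operators `V l ∘ (V i)⋆` in the commutant of `N`, to
  -- which `hT` applies; afterwards `V` is removed again.
  calc ∑' j, ‖(W (Nat.pairEquiv (i, j)).unpair.2 ∘L V (Nat.pairEquiv (i, j)).unpair.1).adjoint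
        (P.vac Ω)‖ₑ ^ 2 = ∑' j, ‖(V i).adjoint ((W j).adjoint (P.vac Ω))‖ₑ ^ 2 := by
        refine tsum_congr fun j => ?_
        have e : (Nat.pairEquiv (i, j)).unpair = (i, j) := Nat.unpair_pair i j
        rw [e, ContinuousLinearMap.adjoint_comp]
        rfl
    _ = ∑' j, ∑' l, ‖V l ((V i).adjoint ((W j).adjoint (P.vac Ω)))‖ₑ ^ 2 :=
        tsum_congr fun j => (hV.tsum_enorm _).symm
    _ = ∑' l, ∑' j, ‖(V l ∘L (V i).adjoint) ((W j).adjoint (P.vac Ω))‖ₑ ^ 2 := ENNReal.tsum_comm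
    _ = ∑' l, (∑' j, ‖(W j).adjoint (P.vac Ω)‖ₑ ^ 2) *
          ‖(V l ∘L (V i).adjoint) (N.vac Ω)‖ₑ ^ 2 :=
        tsum_congr fun l =>
          hT _ ((hV.isLinear l).comp ((hV.isLinear i).adjoint (leaves_l2_of_le hNM)))
    _ = _ := by
        rw [ENNReal.tsum_mul_left, mul_comm]
        congr 1
        exact hV.tsum_enorm _

end Index

/-! ### Finiteness of the index for finitely generated modules, by polar decomposition. -/

section FiniteIndex

open scoped ENNReal InnerProductSpace
open VonNeumannAlgebra

variable {H : Type*} [NormedAddCommGroup H] [InnerProductSpace ℂ H] [CompleteSpace H]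
  {J : AntiunitaryInvolution H} {Ω : H} {N M P : VonNeumannAlgebra H} {K K' : Submodule ℂ H}

/-- The restriction of an operator to an invariant subspace. -/
noncomputable def VonNeumannAlgebra.Leaves.restrict (hK : N.Leaves K) {n : H →L[ℂ] H}
    (hn : n ∈ N) : K →L[ℂ] K :=
  (n ∘L K.subtypeL).codRestrict K fun ξ => hK n hn ξ ξ.2

lemma VonNeumannAlgebra.IsLinear.apply_restrict {L : Submodule ℂ H} (hK : N.Leaves K)
    {T : K →L[ℂ] L} (hT : N.IsLinear T) {n : H →L[ℂ] H} (hn : n ∈ N) (ξ : K) :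
    (T (hK.restrict hn ξ) : H) = n (T ξ) := hT n hn ξ _ rfl

section Polar

variable {E : Type*} [NormedAddCommGroup E] [InnerProductSpace ℂ E] [CompleteSpace E]
  {F : Type*} [NormedAddCommGroup F] [InnerProductSpace ℂ F] [CompleteSpace F]

/-- The absolute value of a finite column of operators. -/
noncomputable def columnAbs {k : ℕ} (B : Fin k → E →L[ℂ] F) : E →L[ℂ] E :=
  CFC.sqrt (∑ i, (B i).adjoint ∘L B i)

variable {k : ℕ} (B : Fin k → E →L[ℂ] F)

lemma column_nonneg : 0 ≤ ∑ i, (B i).adjoint ∘L B i :=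
  Finset.sum_nonneg fun i _ => by
    rw [ContinuousLinearMap.nonneg_iff_isPositive]
    exact ContinuousLinearMap.isPositive_adjoint_comp_self (B i)

lemma columnAbs_mul_self : columnAbs B * columnAbs B = ∑ i, (B i).adjoint ∘L B i :=
  CFC.sqrt_mul_sqrt_self _ (column_nonneg B)

lemma adjoint_columnAbs : (columnAbs B).adjoint = columnAbs B := by
  rw [← ContinuousLinearMap.star_eq_adjoint]
  exact (IsSelfAdjoint.of_nonneg (CFC.sqrt_nonneg _)).star_eq

/-- This identity makes the assignment from `columnAbs B ξ` to the vectors `B i ξ` well defined and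
isometric. -/
lemma norm_columnAbs_sq (ξ : E) : ‖columnAbs B ξ‖ ^ 2 = ∑ i, ‖B i ξ‖ ^ 2 := by
  have h : ⟪columnAbs B ξ, columnAbs B ξ⟫_ℂ = ∑ i, ⟪B i ξ, B i ξ⟫_ℂ := by
    rw [← ContinuousLinearMap.adjoint_inner_right, adjoint_columnAbs]
    change ⟪ξ, (columnAbs B * columnAbs B) ξ⟫_ℂ = _
    rw [columnAbs_mul_self, sum_apply, inner_sum]
    refine Finset.sum_congr rfl fun i _ => ?_
    rw [ContinuousLinearMap.comp_apply, ContinuousLinearMap.adjoint_inner_right]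
  simp only [inner_self_eq_ofReal, ← Complex.ofReal_sum] at h
  exact Complex.ofReal_injective h

/-- The square root belongs to the functional calculus of its square; this carries module linearity
to the polar part. -/
lemma commute_columnAbs {n : E →L[ℂ] E} (h : Commute n (∑ i, (B i).adjoint ∘L B i)) :
    Commute n (columnAbs B) :=
  (h.symm.cfcₙ_nnreal _).symm

/-- The absolute value is self-adjoint, so the orthogonal complement of its range is its kernel,
which is the joint kernel of the column. -/
lemma denseRange_columnAbs (hB : ∀ ξ, (∀ i, B i ξ = 0) → ξ = 0) : DenseRange (columnAbs B) := by
  change Dense ((LinearMap.range (columnAbs B).toLinearMap : Submodule ℂ E) : Set E)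
  rw [Submodule.dense_iff_topologicalClosure_eq_top, Submodule.topologicalClosure_eq_top_iff,
    eq_bot_iff]
  intro ξ hξ
  have h : columnAbs B ξ = 0 := by
    refine ext_inner_left ℂ fun z => ?_
    rw [← ContinuousLinearMap.adjoint_inner_left, adjoint_columnAbs, inner_zero_right]
    exact hξ _ ⟨z, rfl⟩
  have h2 := norm_columnAbs_sq B ξ
  rw [h, norm_zero, zero_pow two_ne_zero, eq_comm,
    Finset.sum_eq_zero_iff_of_nonneg fun i _ => sq_nonneg _] at h2
  exact hB ξ fun i => by simpa using h2 i (Finset.mem_univ i)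

/-- The components of the isometry in the polar decomposition of an injective column. -/
noncomputable def polarPart (i : Fin k) : E →L[ℂ] F :=
  (B i).toLinearMap.extendOfNorm (columnAbs B).toLinearMap

lemma norm_le_columnAbs (i : Fin k) (ξ : E) : ‖B i ξ‖ ≤ 1 * ‖columnAbs B ξ‖ := by
  rw [one_mul]
  refine abs_le_of_sq_le_sq' ?_ (norm_nonneg _) |>.2
  rw [norm_columnAbs_sq]
  exact Finset.single_le_sum (f := fun i => ‖B i ξ‖ ^ 2) (fun _ _ => sq_nonneg _)
    (Finset.mem_univ i)

lemma polarPart_apply (hB : ∀ ξ, (∀ i, B i ξ = 0) → ξ = 0) (i : Fin k) (ξ : E) :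
    polarPart B i (columnAbs B ξ) = B i ξ :=
  LinearMap.extendOfNorm_eq (denseRange_columnAbs B hB) ⟨1, norm_le_columnAbs B i⟩ ξ

lemma sum_norm_polarPart_sq (hB : ∀ ξ, (∀ i, B i ξ = 0) → ξ = 0) (ξ : E) :
    ∑ i, ‖polarPart B i ξ‖ ^ 2 = ‖ξ‖ ^ 2 := by
  refine (denseRange_columnAbs B hB).induction_on
    (p := fun ξ => ∑ i, ‖polarPart B i ξ‖ ^ 2 = ‖ξ‖ ^ 2) ξ
    (isClosed_eq (by fun_prop) (by fun_prop)) fun ξ => ?_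
  simp_rw [polarPart_apply B hB, norm_columnAbs_sq]

end Polar

/-- The index is finite if `L²(M)` is a finitely generated module. -/
theorem jonesIndex_lt_top (hNM : N ≤ M) (hJ : IsTracialConj J Ω M) {k : ℕ}
    (b : Fin k → H →L[ℂ] H) (hb : ∀ i, b i ∈ M)
    (hgen : (M.l2 Ω : Set H) ⊆ closure {ζ | ∃ n : Fin k → (H →L[ℂ] H),
      (∀ i, n i ∈ N) ∧ ζ = ∑ i, n i (b i Ω)}) : jonesIndex Ω M N < ⊤ := by
  set R : Fin k → N.l2 Ω →L[ℂ] M.l2 Ω := fun i => IsTracialConj.rightMulL hNM hJ (hb i) with hR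
  have hRlin : ∀ i, N.IsLinear (R i) := fun i => IsTracialConj.isLinear_rightMulL hNM hJ (hb i)
  set B : Fin k → M.l2 Ω →L[ℂ] N.l2 Ω := fun i => (R i).adjoint with hBdef
  have hlM : N.Leaves (M.l2 Ω) := leaves_l2_of_le hNM
  have hBlin : ∀ i, N.IsLinear (B i) := fun i => (hRlin i).adjoint leaves_l2
  -- The joint kernel of the adjoints is the orthogonal complement of the submodule generated by the
  -- `b i Ω`, which is dense.
  have hB : ∀ ξ, (∀ i, B i ξ = 0) → ξ = 0 := by
    intro ξ hξ
    have h1 : ∀ i, ∀ n ∈ N, ⟪(ξ : H), n (b i Ω)⟫_ℂ = 0 := by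
      intro i n hn
      have e := ContinuousLinearMap.adjoint_inner_left (R i) ⟨n Ω, mem_l2_of_mem hn⟩ ξ
      have e1 : (R i).adjoint ξ = 0 := hξ i
      rw [e1, inner_zero_left, Submodule.coe_inner] at e
      rw [← hJ.rightMul_apply (hNM hn) (hb i)]
      exact e.symm
    have h2 : ⟪(ξ : H), ξ⟫_ℂ = 0 := by
      refine closure_minimal (t := {ζ : H | ⟪(ξ : H), ζ⟫_ℂ = 0}) ?_
        (isClosed_eq (by fun_prop) (by fun_prop)) (hgen ξ.2)
      rintro _ ⟨n, hn, rfl⟩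
      simp only [Set.mem_ofPred_eq, inner_sum]
      exact Finset.sum_eq_zero fun i _ => h1 i _ (hn i)
    exact Subtype.ext (inner_self_eq_zero.1 h2)
  have hcomm : ∀ n (hn : n ∈ N), Commute (hlM.restrict hn) (columnAbs B) := by
    intro n hn
    refine commute_columnAbs B ?_
    refine Commute.sum_right _ _ _ fun i _ => ?_
    ext ξ
    have hlin : N.IsLinear ((B i).adjoint ∘L B i) := ((hBlin i).adjoint hlM).comp (hBlin i)
    exact (hlin.apply_restrict hlM hn ξ).symm
  have hlin : ∀ i, N.IsLinear (polarPart B i) := by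
    rintro i n hn ξ η h
    have hη : η = hlM.restrict hn ξ := Subtype.ext h
    subst hη
    refine (denseRange_columnAbs B hB).induction_on
      (p := fun ξ => (polarPart B i (hlM.restrict hn ξ) : H) = n (polarPart B i ξ)) ξ
      (isClosed_eq (by fun_prop) (by fun_prop)) fun ξ => ?_
    have e : hlM.restrict hn (columnAbs B ξ) = columnAbs B (hlM.restrict hn ξ) :=
      congrArg (fun T : M.l2 Ω →L[ℂ] M.l2 Ω => T ξ) (hcomm n hn).eq
    rw [e, polarPart_apply B hB, polarPart_apply B hB]
    exact (hBlin i).apply_restrict hlM hn ξ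
  -- The `k` components are padded by zeros, so the dimension is a finite sum of finite terms.
  have hV : IsModuleIsometry N Ω (M.l2 Ω)
      (fun i => if h : i < k then polarPart B ⟨i, h⟩ else 0) :=
    { isometry := fun ξ => by
        rw [← sum_norm_polarPart_sq B hB ξ]
        have h : ∑ i : Fin k, ‖polarPart B i ξ‖ ^ 2 = ∑ i ∈ Finset.range k,
            ‖(if h : i < k then polarPart B ⟨i, h⟩ else 0) ξ‖ ^ 2 := by
          rw [Finset.sum_range]
          exact Finset.sum_congr rfl fun i _ => by simp
        rw [h]
        refine hasSum_sum_of_ne_finset_zero fun i hi => ?_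
        rw [Finset.mem_range] at hi
        simp [hi]
      linear := fun T hT ξ η h i => by
        by_cases hi : i < k
        · simp only [hi, dite_true]
          exact hlin ⟨i, hi⟩ T hT ξ η h
        · simp [hi] }
  refine (iInf₂_le _ hV).trans_lt ?_
  rw [tsum_eq_sum (s := Finset.range k)]
  · refine ENNReal.sum_lt_top.2 fun i _ => ?_
    exact ENNReal.pow_lt_top enorm_lt_top
  · intro i hi
    rw [Finset.mem_range] at hi
    simp [hi]

end FiniteIndex

/-! ### Invariance of the index under unitaries fixing Ω. -/

section Conj

open scoped ENNReal InnerProductSpace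
open VonNeumannAlgebra

variable {H : Type*} [NormedAddCommGroup H] [InnerProductSpace ℂ H] [CompleteSpace H]
  {J : AntiunitaryInvolution H} {Ω : H} {N M P : VonNeumannAlgebra H} (U : H ≃ₗᵢ[ℂ] H)

lemma VonNeumannAlgebra.mem_conj {T : H →L[ℂ] H} :
    T ∈ N.conj U ↔ ∃ n ∈ N, U.conjStarAlgEquiv n = T := Iff.rfl

lemma VonNeumannAlgebra.conj_mem {n : H →L[ℂ] H} (hn : n ∈ N) :
    U.conjStarAlgEquiv n ∈ N.conj U := ⟨n, hn, rfl⟩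

lemma VonNeumannAlgebra.conj_symm_conj : (N.conj U).conj U.symm = N := by
  ext T
  rw [mem_conj]
  constructor
  · rintro ⟨_, ⟨n, hn, rfl⟩, rfl⟩
    have e : U.symm.conjStarAlgEquiv (U.conjStarAlgEquiv n) = n := by ext x; simp
    have hn' : n ∈ N := hn
    rw [← e] at hn'
    exact hn'
  · intro hT
    refine ⟨_, conj_mem U hT, ?_⟩
    ext x
    simp

lemma VonNeumannAlgebra.conj_mono (h : N ≤ M) : N.conj U ≤ M.conj U := by
  rintro _ ⟨n, hn, rfl⟩
  exact ⟨n, h hn, rfl⟩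

lemma VonNeumannAlgebra.map_mem_l2_conj (hU : U Ω = Ω) {ξ : H} (hξ : ξ ∈ N.l2 Ω) : U ξ ∈ (N.conj U).l2 Ω := by
  refine l2_induction (p := fun ξ => U ξ ∈ (N.conj U).l2 Ω) ?_ (fun n hn => ?_) hξ
  · exact (Submodule.isClosed_topologicalClosure _).preimage U.continuous
  · have := mem_l2_of_mem (Ω := Ω) (conj_mem U hn)
    rwa [LinearIsometryEquiv.conjStarAlgEquiv_apply_apply, (U.symm_apply_eq).2 hU.symm] at this

lemma VonNeumannAlgebra.symm_map_mem_l2 (hU : U Ω = Ω) {ξ : H} (hξ : ξ ∈ (N.conj U).l2 Ω) :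
    U.symm ξ ∈ N.l2 Ω := by
  have := map_mem_l2_conj U.symm ((U.symm_apply_eq).2 hU.symm) hξ
  rwa [conj_symm_conj] at this

/-- The restriction of `U` to a unitary from `L²(N)` to `L²(U N U⋆)`. -/
noncomputable def VonNeumannAlgebra.l2Conj (hU : U Ω = Ω) (N : VonNeumannAlgebra H) :
    N.l2 Ω ≃ₗᵢ[ℂ] (N.conj U).l2 Ω where
  toFun ξ := ⟨U ξ, map_mem_l2_conj U hU ξ.2⟩
  invFun ξ := ⟨U.symm ξ, symm_map_mem_l2 U hU ξ.2⟩
  map_add' ξ η := by ext; simp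
  map_smul' c ξ := by ext; simp
  left_inv ξ := by ext; simp
  right_inv ξ := by ext; simp
  norm_map' ξ := U.norm_map ξ

/-- Every module isometry is transported by the restrictions of `U`; since `U` fixes Ω, its value in
the infimum is unchanged. One inequality suffices, the other being the case of the inverse unitary.
-/
lemma jonesIndex_conj_le (hU : U Ω = Ω) : jonesIndex Ω (M.conj U) (N.conj U) ≤ jonesIndex Ω M N := by
  refine le_iInf₂ fun V hV => ?_
  let V' : ℕ → (M.conj U).l2 Ω →L[ℂ] (N.conj U).l2 Ω := fun i =>
    (l2Conj U hU N).toContinuousLinearEquiv.toContinuousLinearMap ∘L V i ∘L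
      (l2Conj U hU M).symm.toContinuousLinearEquiv.toContinuousLinearMap
  have hV' : IsModuleIsometry (N.conj U) Ω ((M.conj U).l2 Ω) V' :=
    { isometry := fun ξ => by
        have := hV.isometry ((l2Conj U hU M).symm ξ)
        rw [LinearIsometryEquiv.norm_map] at this
        convert this using 3 with i
        exact (l2Conj U hU N).norm_map _
      linear := by
        rintro _ ⟨T, hT, rfl⟩ ξ η h i
        have := hV.linear T hT ((l2Conj U hU M).symm ξ) ((l2Conj U hU M).symm η) (by
          change U.symm η = T (U.symm ξ)
          rw [h]
          exact U.symm_apply_apply _) i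
        change U (V i ((l2Conj U hU M).symm η)) =
          U (T (U.symm (U (V i ((l2Conj U hU M).symm ξ)))))
        rw [this, U.symm_apply_apply] }
  refine (iInf₂_le V' hV').trans (ENNReal.tsum_le_tsum fun i => ?_)
  refine le_of_eq ?_
  have e : (V' i).adjoint ((N.conj U).vac Ω) =
      l2Conj U hU M ((V i).adjoint (N.vac Ω)) := by
    refine ext_inner_right ℂ fun z => ?_
    obtain ⟨z, rfl⟩ := (l2Conj U hU M).surjective z
    rw [ContinuousLinearMap.adjoint_inner_left, LinearIsometryEquiv.inner_map_map,
      ContinuousLinearMap.adjoint_inner_left]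
    have e1 : (N.conj U).vac Ω = l2Conj U hU N (N.vac Ω) := Subtype.ext hU.symm
    have e2 : V' i (l2Conj U hU M z) = l2Conj U hU N (V i z) := by
      change l2Conj U hU N (V i ((l2Conj U hU M).symm (l2Conj U hU M z))) = _
      rw [LinearIsometryEquiv.symm_apply_apply]
    rw [e1, e2, LinearIsometryEquiv.inner_map_map]
  change ‖(V' i).adjoint ((N.conj U).vac Ω)‖ₑ ^ 2 = ‖(V i).adjoint (N.vac Ω)‖ₑ ^ 2
  rw [e, ← ofReal_norm, LinearIsometryEquiv.norm_map, ofReal_norm]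

/-- Invariance of the index under unitaries that fix `Ω`. -/
theorem jonesIndex_conj (hU : U Ω = Ω) : jonesIndex Ω (M.conj U) (N.conj U) = jonesIndex Ω M N := by
  refine le_antisymm (jonesIndex_conj_le U hU) ?_
  have := jonesIndex_conj_le (M := M.conj U) (N := N.conj U) U.symm
    ((U.symm_apply_eq).2 hU.symm)
  rwa [conj_symm_conj, conj_symm_conj] at this

end Conj

/-! ### Von Neumann algebras generated in the GNS representation of a trace -/

section GNS

open scoped ENNReal InnerProductSpace
open VonNeumannAlgebra UniformSpace

lemma mem_vonNeumannGenerated {H : Type*} [NormedAddCommGroup H] [InnerProductSpace ℂ H]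
    [CompleteSpace H] {S : Set (H →L[ℂ] H)} (hS : ∀ s ∈ S, star s ∈ S) {x : H →L[ℂ] H} :
    x ∈ vonNeumannGenerated S ↔ ∀ T : H →L[ℂ] H, (∀ s ∈ S, s * T = T * s) → T * x = x * T := by
  rw [vonNeumannGenerated, mem_commutant_iff]
  refine forall_congr' fun T => imp_congr_left ?_
  change T ∈ StarSubalgebra.centralizer ℂ S ↔ _
  rw [StarSubalgebra.mem_centralizer_iff]
  exact ⟨fun h s hs => (h s hs).1, fun h s hs => ⟨h s hs, h _ (hS s hs)⟩⟩

variable {A : Type*} [CStarAlgebra A] [PartialOrder A] [StarOrderedRing A] {τ : A →ₚ[ℂ] ℂ}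

lemma gns_vacuum (a : A) : τ.gnsStarAlgHom a (vacuum τ) = (τ.toPreGNS a : τ.GNS) := by
  rw [vacuum]
  change τ.gnsNonUnitalStarAlgHom a _ = _
  rw [PositiveLinearMap.gnsNonUnitalStarAlgHom_apply_coe]
  congr 1
  change τ.toPreGNS (a * 1) = _
  rw [mul_one]

lemma inner_gns (a b : A) :
    ⟪τ.gnsStarAlgHom a (vacuum τ), τ.gnsStarAlgHom b (vacuum τ)⟫_ℂ = τ (star a * b) := by
  rw [gns_vacuum, gns_vacuum, Completion.inner_coe]
  rfl

lemma inner_vacuum_gns (a : A) : ⟪vacuum τ, τ.gnsStarAlgHom a (vacuum τ)⟫_ℂ = τ a := by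
  have := inner_gns (τ := τ) 1 a
  rwa [map_one τ.gnsStarAlgHom, star_one, one_mul] at this

lemma gns_induction {p : τ.GNS → Prop} (hp : IsClosed {x | p x})
    (h : ∀ a, p (τ.gnsStarAlgHom a (vacuum τ))) (x : τ.GNS) : p x := by
  induction x using Completion.induction_on with
  | hp => exact hp
  | ih a =>
    obtain ⟨a, rfl⟩ := τ.toPreGNS.surjective a
    rw [← gns_vacuum]
    exact h a

namespace IsTracialState

variable (hτ : IsTracialState τ)

/-- The isometric involution of the pre-Hilbert space `A` given by the adjoint. -/
lemma isometry_star (hτ : IsTracialState τ) :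
    Isometry fun a : τ.PreGNS => τ.toPreGNS (star (τ.ofPreGNS a)) := by
  let s : τ.PreGNS →+ τ.PreGNS :=
    { toFun := fun a => τ.toPreGNS (star (τ.ofPreGNS a))
      map_zero' := by simp
      map_add' := fun a b => by simp }
  refine AddMonoidHomClass.isometry_of_norm s fun a => ?_
  rw [τ.preGNS_norm_def, τ.preGNS_norm_def]
  change √(τ (star (star (τ.ofPreGNS a)) * star (τ.ofPreGNS a))).re = _
  rw [star_star, hτ.map_mul_comm]

/-- The canonical conjugation of the GNS space of a tracial state. -/
noncomputable def conj (hτ : IsTracialState τ) : AntiunitaryInvolution τ.GNS where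
  toFun := Completion.map fun a : τ.PreGNS => τ.toPreGNS (star (τ.ofPreGNS a))
  inner_map x y := by
    induction x, y using Completion.induction_on₂ with
    | hp =>
      have := Completion.continuous_map (f := fun a : τ.PreGNS => τ.toPreGNS (star (τ.ofPreGNS a)))
      apply isClosed_eq <;> fun_prop
    | ih a b =>
      rw [Completion.map_coe hτ.isometry_star.uniformContinuous,
        Completion.map_coe hτ.isometry_star.uniformContinuous, Completion.inner_coe,
        Completion.inner_coe, τ.preGNS_inner_def, τ.preGNS_inner_def]
      simp only [PositiveLinearMap.ofPreGNS_toPreGNS, star_star]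
      exact hτ.map_mul_comm _ _
  map_map x := by
    induction x using Completion.induction_on with
    | hp =>
      have := Completion.continuous_map (f := fun a : τ.PreGNS => τ.toPreGNS (star (τ.ofPreGNS a)))
      apply isClosed_eq <;> fun_prop
    | ih a =>
      rw [Completion.map_coe hτ.isometry_star.uniformContinuous,
        Completion.map_coe hτ.isometry_star.uniformContinuous]
      simp

lemma conj_gns (a : A) : hτ.conj (τ.gnsStarAlgHom a (vacuum τ)) =
    τ.gnsStarAlgHom (star a) (vacuum τ) := by
  rw [gns_vacuum, gns_vacuum]
  exact Completion.map_coe hτ.isometry_star.uniformContinuous _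

lemma rightMul_gns (a b : A) :
    hτ.conj.rightMul (τ.gnsStarAlgHom a) (τ.gnsStarAlgHom b (vacuum τ)) =
      τ.gnsStarAlgHom (b * a) (vacuum τ) := by
  rw [AntiunitaryInvolution.rightMul_apply, conj_gns, ← map_star]
  have : τ.gnsStarAlgHom (star a) (τ.gnsStarAlgHom (star b) (vacuum τ)) =
      τ.gnsStarAlgHom (star (b * a)) (vacuum τ) := by
    rw [star_mul, map_mul]; rfl
  rw [this, conj_gns, star_star]

lemma rightMul_gns_vacuum (a : A) :
    hτ.conj.rightMul (τ.gnsStarAlgHom a) (vacuum τ) = τ.gnsStarAlgHom a (vacuum τ) := by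
  have := hτ.rightMul_gns a 1
  rwa [_root_.map_one τ.gnsStarAlgHom, one_mul] at this

/-- Associativity of `A`, read on the dense set of vectors `c Ω`. -/
lemma rightMul_comm (a b : A) : τ.gnsStarAlgHom b * hτ.conj.rightMul (τ.gnsStarAlgHom a) =
    hτ.conj.rightMul (τ.gnsStarAlgHom a) * τ.gnsStarAlgHom b := by
  ext x
  refine gns_induction (p := fun x => (τ.gnsStarAlgHom b *
    hτ.conj.rightMul (τ.gnsStarAlgHom a)) x = (hτ.conj.rightMul (τ.gnsStarAlgHom a) *
      τ.gnsStarAlgHom b) x) (isClosed_eq (by fun_prop) (by fun_prop)) (fun c => ?_) x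
  have e : ∀ c, τ.gnsStarAlgHom b (τ.gnsStarAlgHom c (vacuum τ)) =
      τ.gnsStarAlgHom (b * c) (vacuum τ) := fun c => by rw [map_mul]; rfl
  change τ.gnsStarAlgHom b (hτ.conj.rightMul (τ.gnsStarAlgHom a) (τ.gnsStarAlgHom c (vacuum τ))) =
    hτ.conj.rightMul (τ.gnsStarAlgHom a) (τ.gnsStarAlgHom b (τ.gnsStarAlgHom c (vacuum τ)))
  rw [rightMul_gns, e, e, rightMul_gns, mul_assoc]

lemma norm_vacuum (hτ : IsTracialState τ) : ‖vacuum τ‖ = 1 := by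
  have h := inner_vacuum_gns (τ := τ) 1
  rw [_root_.map_one τ.gnsStarAlgHom, hτ.map_one] at h
  change ⟪vacuum τ, vacuum τ⟫_ℂ = 1 at h
  rw [inner_self_eq_ofReal] at h
  have h' : ‖vacuum τ‖ ^ 2 = 1 := by exact_mod_cast h
  exact (pow_eq_one_iff_of_nonneg (norm_nonneg _) two_ne_zero).1 h'

end IsTracialState

/-- The von Neumann algebra generated by a ⋆-subalgebra in the GNS representation. -/
noncomputable def gnsAlgebra (τ : A →ₚ[ℂ] ℂ) (D : StarSubalgebra ℂ A) : VonNeumannAlgebra τ.GNS :=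
  vonNeumannGenerated (τ.gnsStarAlgHom '' (D : Set A))

variable {D E : StarSubalgebra ℂ A}

lemma star_mem_gns_image (D : StarSubalgebra ℂ A) :
    ∀ s ∈ τ.gnsStarAlgHom '' (D : Set A), star s ∈ τ.gnsStarAlgHom '' (D : Set A) := by
  rintro _ ⟨d, hd, rfl⟩
  exact ⟨star d, star_mem hd, map_star _ _⟩

lemma mem_gnsAlgebra {x : τ.GNS →L[ℂ] τ.GNS} : x ∈ gnsAlgebra τ D ↔
    ∀ T : τ.GNS →L[ℂ] τ.GNS, (∀ d ∈ D, τ.gnsStarAlgHom d * T = T * τ.gnsStarAlgHom d) →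
      T * x = x * T := by
  rw [gnsAlgebra, mem_vonNeumannGenerated (star_mem_gns_image D)]
  simp only [Set.forall_mem_image, SetLike.mem_coe]

lemma gns_mem_gnsAlgebra {d : A} (hd : d ∈ D) : τ.gnsStarAlgHom d ∈ gnsAlgebra τ D :=
  mem_gnsAlgebra.2 fun _ hT => (hT d hd).symm

lemma gnsAlgebra_mono (h : D ≤ E) : gnsAlgebra τ D ≤ gnsAlgebra τ E := fun _ hx =>
  mem_gnsAlgebra.2 fun T hT => mem_gnsAlgebra.1 hx T fun d hd => hT d (h hd)

/-- Right multiplications by all of `A` lie in the commutant of `D`, hence commute with its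
bicommutant. As they move Ω to a dense set, Ω is separating for the generated algebra. -/
lemma gnsAlgebra_comm (hτ : IsTracialState τ) {x : τ.GNS →L[ℂ] τ.GNS} (hx : x ∈ gnsAlgebra τ D)
    (a : A) : hτ.conj.rightMul (τ.gnsStarAlgHom a) * x =
      x * hτ.conj.rightMul (τ.gnsStarAlgHom a) :=
  mem_gnsAlgebra.1 hx _ fun d _ => hτ.rightMul_comm a d

/-- The relation, clear for elements of `A`, passes to weak limits by testing against `a Ω` and
replacing `x (a Ω)` by the right multiple of `x Ω` by `a`. -/
lemma isTracialConj_gnsAlgebra (hτ : IsTracialState τ) (D : StarSubalgebra ℂ A) :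
    IsTracialConj hτ.conj (vacuum τ) (gnsAlgebra τ D) := by
  intro x hx
  refine ext_inner_right ℂ fun y => ?_
  refine gns_induction (p := fun y => ⟪hτ.conj (x (vacuum τ)), y⟫_ℂ = ⟪star x (vacuum τ), y⟫_ℂ)
    (isClosed_eq (by fun_prop) (by fun_prop)) (fun a => ?_) y
  have h := congrArg (fun T : τ.GNS →L[ℂ] τ.GNS => T (vacuum τ)) (gnsAlgebra_comm hτ hx a)
  simp only [mul_apply_eq_comp, hτ.rightMul_gns_vacuum] at h
  rw [ContinuousLinearMap.star_eq_adjoint, ContinuousLinearMap.adjoint_inner_left, ← h,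
    AntiunitaryInvolution.inner_left, hτ.conj_gns, ← hτ.rightMul_gns_vacuum, hτ.conj.inner_rightMul,
    map_star, star_star]

/-- Elements of `A''` are determined by their action on the vacuum. -/
lemma gnsAlgebra_ext (hτ : IsTracialState τ) {x y : τ.GNS →L[ℂ] τ.GNS} (hx : x ∈ gnsAlgebra τ D)
    (hy : y ∈ gnsAlgebra τ D) (h : x (vacuum τ) = y (vacuum τ)) : x = y := by
  ext z
  refine gns_induction (p := fun z => x z = y z) (isClosed_eq (by fun_prop) (by fun_prop))
    (fun a => ?_) z
  have h1 := congrArg (fun T : τ.GNS →L[ℂ] τ.GNS => T (vacuum τ)) (gnsAlgebra_comm hτ hx a)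
  have h2 := congrArg (fun T : τ.GNS →L[ℂ] τ.GNS => T (vacuum τ)) (gnsAlgebra_comm hτ hy a)
  simp only [mul_apply_eq_comp, hτ.rightMul_gns_vacuum] at h1 h2
  rw [← h1, ← h2, h]

/-- `L²` of the generated algebra is the closure of `D Ω`. -/
lemma l2_gnsAlgebra_subset (D : StarSubalgebra ℂ A) :
    ((gnsAlgebra τ D).l2 (vacuum τ) : Set τ.GNS) ⊆
      closure ((fun a => τ.gnsStarAlgHom a (vacuum τ)) '' (D : Set A)) := by
  let O : Submodule ℂ τ.GNS := D.toSubalgebra.toSubmodule.map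
    ((ContinuousLinearMap.apply ℂ τ.GNS (vacuum τ)).toLinearMap ∘ₗ
      τ.gnsStarAlgHom.toAlgHom.toLinearMap)
  let L : Submodule ℂ τ.GNS := O.topologicalClosure
  have hinv : ∀ d ∈ D, ∀ ξ ∈ L, τ.gnsStarAlgHom d ξ ∈ L := by
    intro d hd ξ hξ
    refine map_mem_closure (τ.gnsStarAlgHom d).continuous hξ ?_
    rintro _ ⟨a, ha, rfl⟩
    exact ⟨d * a, mul_mem (S := StarSubalgebra ℂ A) hd ha, by
      change τ.gnsStarAlgHom (d * a) (vacuum τ) = _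
      rw [map_mul]; rfl⟩
  have hΩ : vacuum τ ∈ L := Submodule.le_topologicalClosure _
    ⟨1, one_mem D, by simp⟩
  -- The projection onto the closure of `D Ω` commutes with `D`, the range being invariant under `D`
  -- and its adjoints. It therefore commutes with the bicommutant, which then cannot move Ω out of
  -- that closure.
  set p := L.starProjection with hp
  have hcomm : ∀ d ∈ D, τ.gnsStarAlgHom d * p = p * τ.gnsStarAlgHom d := by
    intro d hd
    have h1 : ∀ d ∈ D, p * τ.gnsStarAlgHom d * p = τ.gnsStarAlgHom d * p := by
      intro d hd
      ext ξ
      exact Submodule.starProjection_eq_self_iff.2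
        (hinv d hd _ (Submodule.starProjection_apply_mem L ξ))
    have hps : star p = p := isSelfAdjoint_starProjection L
    have h2 := congrArg star (h1 (star d) (star_mem hd))
    simp only [star_mul, map_star, star_star, hps] at h2
    rw [← h1 d hd, mul_assoc, h2]
  intro ξ hξ
  change ξ ∈ closure (O : Set τ.GNS)
  refine l2_induction (p := fun ξ => ξ ∈ closure (O : Set τ.GNS)) isClosed_closure
    (fun n hn => ?_) hξ
  have := congrArg (fun T : τ.GNS →L[ℂ] τ.GNS => T (vacuum τ)) (mem_gnsAlgebra.1 hn p hcomm)
  simp only [mul_apply_eq_comp] at this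
  rw [Submodule.starProjection_eq_self_iff.2 hΩ] at this
  rw [← this]
  exact Submodule.starProjection_apply_mem L _

/-- `τ` is the only normalized positive trace on the ⋆-algebra `D`. -/
def HasUniqueTrace (τ : A →ₚ[ℂ] ℂ) (D : StarSubalgebra ℂ A) : Prop :=
  ∀ φ : D →ₗ[ℂ] ℂ, IsTraceFunctional φ → φ 1 = 1 → ∀ d : D, φ d = τ d

/-- The image of `D` serves as the core: a trace on the image pulls back to one on `D`. -/
lemma HasUniqueTrace.core (h : HasUniqueTrace τ D) :
    HasUniqueTraceCore (vacuum τ) (gnsAlgebra τ D) := by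
  refine ⟨D.map τ.gnsStarAlgHom, ?_, ?_, ?_⟩
  · rintro _ ⟨d, hd, rfl⟩
    exact gns_mem_gnsAlgebra hd
  · refine (l2_gnsAlgebra_subset D).trans (closure_mono ?_)
    rintro _ ⟨d, hd, rfl⟩
    exact ⟨τ.gnsStarAlgHom d, ⟨d, hd, rfl⟩, rfl⟩
  · rintro φ hφ h1 ⟨_, d, hd, rfl⟩
    let f : D →⋆ₐ[ℂ] D.map τ.gnsStarAlgHom :=
      (τ.gnsStarAlgHom.comp D.subtype).codRestrict _ fun d => ⟨d, d.2, rfl⟩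
    have := h (φ ∘ₗ f.toAlgHom.toLinearMap)
      ⟨fun a => by
        change 0 ≤ φ (f (star a * a))
        rw [map_mul, map_star]
        exact hφ.nonneg _, fun a b => by
        change φ (f (a * b)) = φ (f (b * a))
        rw [map_mul f, map_mul f, hφ.mul_comm]⟩
      (by
        change φ (f 1) = 1
        rw [map_one, h1]) ⟨d, hd⟩
    change _ = ⟪vacuum τ, τ.gnsStarAlgHom d (vacuum τ)⟫_ℂ
    rw [inner_vacuum_gns]
    exact this

/-- The generated von Neumann algebra is a factor if the trace is unique. -/
theorem isFactor_gnsAlgebra (hτ : IsTracialState τ) (h : HasUniqueTrace τ D) :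
    (gnsAlgebra τ D).IsFactor := by
  have key : ∀ z ∈ gnsAlgebra τ D, z ∈ (gnsAlgebra τ D).commutant → star z = z →
      ∃ c : ℂ, z = c • 1 := by
    intro z hz hz' hsa
    rw [mem_commutant_iff] at hz'
    set Ω := vacuum τ with hΩ
    have hzd : ∀ d ∈ D, ∀ ξ, τ.gnsStarAlgHom d (z ξ) = z (τ.gnsStarAlgHom d ξ) := fun d hd ξ =>
      congrArg (fun T : τ.GNS →L[ℂ] τ.GNS => T ξ) (hz' _ (gns_mem_gnsAlgebra hd))
    -- The shift makes `t + z` positive with trace at least one, so `d ↦ ⟪Ω, d (t + z) Ω⟫` can be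
    -- normalized. Centrality of `z` makes it a trace, and uniqueness forces `z` to be scalar.
    set t : ℝ := ‖z‖ + 1 with ht
    let y : τ.GNS := (t : ℂ) • Ω + z Ω
    have hreal : ∀ ξ, ∃ r : ℝ, ⟪ξ, z ξ⟫_ℂ = r ∧ -(‖z‖ * ‖ξ‖ ^ 2) ≤ r := by
      intro ξ
      have h1 : (starRingEnd ℂ) ⟪ξ, z ξ⟫_ℂ = ⟪ξ, z ξ⟫_ℂ := by
        rw [inner_conj_symm]
        nth_rewrite 1 [← hsa]
        rw [ContinuousLinearMap.star_eq_adjoint, ContinuousLinearMap.adjoint_inner_left]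
      refine ⟨(⟪ξ, z ξ⟫_ℂ).re, (Complex.conj_eq_iff_re.1 h1).symm, ?_⟩
      have h2 : ‖⟪ξ, z ξ⟫_ℂ‖ ≤ ‖z‖ * ‖ξ‖ ^ 2 := by
        refine (norm_inner_le_norm _ _).trans ?_
        rw [sq, mul_left_comm]
        exact mul_le_mul_of_nonneg_left (z.le_opNorm _) (norm_nonneg _)
      exact (abs_le.1 ((Complex.abs_re_le_norm _).trans h2)).1
    let φ : D →ₗ[ℂ] ℂ := (innerSL ℂ Ω).toLinearMap ∘ₗ
      (ContinuousLinearMap.apply ℂ τ.GNS y).toLinearMap ∘ₗ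
        τ.gnsStarAlgHom.toAlgHom.toLinearMap ∘ₗ D.toSubalgebra.toSubmodule.subtype
    have hφ : ∀ d : D, φ d = ⟪Ω, τ.gnsStarAlgHom d y⟫_ℂ := fun d => rfl
    have hφ' : ∀ a b : D, φ (star a * b) = t * ⟪τ.gnsStarAlgHom a Ω, τ.gnsStarAlgHom b Ω⟫_ℂ +
        ⟪τ.gnsStarAlgHom a Ω, z (τ.gnsStarAlgHom b Ω)⟫_ℂ := by
      intro a b
      rw [hφ]
      have e : τ.gnsStarAlgHom ((star a * b : D) : A) y =
          star (τ.gnsStarAlgHom a) (τ.gnsStarAlgHom b y) := by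
        change τ.gnsStarAlgHom (star (a : A) * (b : A)) y = _
        rw [map_mul, map_star]; rfl
      rw [e, ContinuousLinearMap.star_eq_adjoint, ContinuousLinearMap.adjoint_inner_right]
      simp only [y, map_add, map_smul, inner_add_right, inner_smul_right, hzd b b.2]
    have hpos : ∀ a : D, 0 ≤ φ (star a * a) := by
      intro a
      obtain ⟨r, hr, hr'⟩ := hreal (τ.gnsStarAlgHom a Ω)
      rw [hφ', hr, inner_self_eq_ofReal, ← Complex.ofReal_mul, ← Complex.ofReal_add]
      refine Complex.zero_le_real.2 ?_
      nlinarith [sq_nonneg ‖τ.gnsStarAlgHom (a : A) Ω‖]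
    have hJ := isTracialConj_gnsAlgebra hτ D
    have hstar : ∀ a : D, ((star a : D) : A) = star (a : A) := fun _ => rfl
    -- As `z` is self-adjoint and commutes with `D`, the conjugation takes `z a Ω` to `z a⋆ Ω`;
    -- hence the values at `a⋆ a` and `a a⋆` agree.
    have htr : ∀ a b : D, φ (a * b) = φ (b * a) := by
      refine mul_comm_of_star_mul_self φ fun a => ?_
      have e1 := hφ' (star a) (star a)
      rw [star_star] at e1
      have hja := hJ _ (gns_mem_gnsAlgebra a.2)
      have hza := hJ _ (mul_mem hz (gns_mem_gnsAlgebra a.2))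
      rw [star_mul, hsa, mul_apply_eq_comp, mul_apply_eq_comp, ← map_star, ← hstar,
        hzd _ (star a).2] at hza
      rw [← map_star, ← hstar] at hja
      rw [e1, hφ', ← hza, ← hja, hτ.conj.inner_map, hτ.conj.inner_map]
      congr 1
      nth_rewrite 2 [← hsa]
      rw [ContinuousLinearMap.star_eq_adjoint, ContinuousLinearMap.adjoint_inner_left]
    obtain ⟨r, hr, hr'⟩ := hreal Ω
    have hΩ1 : ‖Ω‖ = 1 := hτ.norm_vacuum
    rw [hΩ1, one_pow, mul_one] at hr'
    have hφ1 : φ 1 = ((t + r : ℝ) : ℂ) := by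
      rw [hφ]
      change ⟪Ω, τ.gnsStarAlgHom 1 y⟫_ℂ = _
      rw [map_one τ.gnsStarAlgHom]
      change ⟪Ω, (t : ℂ) • Ω + z Ω⟫_ℂ = _
      rw [inner_add_right, inner_smul_right, hr, inner_self_eq_ofReal, hΩ1]
      simp
    have htr0 : 0 < t + r := by rw [ht]; linarith
    have hne : ((t + r : ℝ) : ℂ) ≠ 0 := by exact_mod_cast htr0.ne'
    have huse := h (((t + r : ℝ) : ℂ)⁻¹ • φ)
      ⟨fun a => by
        rw [LinearMap.smul_apply, smul_eq_mul]
        refine mul_nonneg ?_ (hpos a)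
        rw [← Complex.ofReal_inv]
        exact Complex.zero_le_real.2 (inv_pos.2 htr0).le,
       fun a b => by rw [LinearMap.smul_apply, LinearMap.smul_apply, htr]⟩
      (by rw [LinearMap.smul_apply, hφ1, smul_eq_mul, inv_mul_cancel₀ hne])
    -- Uniqueness of the trace says that the difference is orthogonal to `D Ω`, while it also lies
    -- in the closure of `D Ω`.
    have hy : y = ((t + r : ℝ) : ℂ) • Ω := by
      have hyl : y ∈ (gnsAlgebra τ D).l2 Ω :=
        add_mem (Submodule.smul_mem _ _ (mem_l2 _ _)) (mem_l2_of_mem hz)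
      rw [← sub_eq_zero, ← inner_self_eq_zero (𝕜 := ℂ)]
      refine closure_minimal (t := {ζ : τ.GNS | ⟪ζ, y - ((t + r : ℝ) : ℂ) • Ω⟫_ℂ = 0}) ?_
        (isClosed_eq (by fun_prop) (by fun_prop)) (l2_gnsAlgebra_subset D
          (sub_mem hyl (Submodule.smul_mem _ _ (mem_l2 _ _))))
      rintro _ ⟨d, hd, rfl⟩
      have h1 := huse (star ⟨d, hd⟩)
      rw [LinearMap.smul_apply, smul_eq_mul, inv_mul_eq_iff_eq_mul₀ hne, hφ, hstar,
        ← inner_vacuum_gns] at h1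
      simp only [map_star] at h1
      rw [ContinuousLinearMap.star_eq_adjoint, ContinuousLinearMap.adjoint_inner_right,
        ContinuousLinearMap.adjoint_inner_right] at h1
      change ⟪τ.gnsStarAlgHom d Ω, _⟫_ℂ = 0
      rw [inner_sub_right, inner_smul_right, h1, sub_self]
    refine ⟨r, gnsAlgebra_ext hτ hz
      (StarSubalgebra.smul_mem (gnsAlgebra τ D).toStarSubalgebra (one_mem _) _) ?_⟩
    have hy' : (t : ℂ) • Ω + z Ω = ((t + r : ℝ) : ℂ) • Ω := hy
    rw [Complex.ofReal_add t r, add_smul] at hy'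
    exact add_left_cancel hy'
  intro z hz hz'
  have hsz := star_mem hz
  have hsz' := star_mem hz'
  -- Reduction to the self-adjoint case through real and imaginary parts.
  obtain ⟨c, hc⟩ := key (z + star z) (add_mem hz hsz) (add_mem hz' hsz') (by
    rw [star_add, star_star, add_comm])
  obtain ⟨d, hd⟩ := key (Complex.I • (z - star z))
    (StarSubalgebra.smul_mem (gnsAlgebra τ D).toStarSubalgebra (sub_mem hz hsz) _)
    (StarSubalgebra.smul_mem (gnsAlgebra τ D).commutant.toStarSubalgebra (sub_mem hz' hsz') _) (by
      rw [star_smul, star_sub, star_star, Complex.star_def, Complex.conj_I, neg_smul, ← smul_neg,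
        neg_sub])
  refine ⟨(c - Complex.I * d) / 2, ?_⟩
  have h1 : (2 : ℂ) • z = (c - Complex.I * d) • (1 : τ.GNS →L[ℂ] τ.GNS) := by
    rw [sub_smul, ← hc, mul_smul, ← hd, smul_smul, Complex.I_mul_I, two_smul]
    simp
    abel
  rw [div_eq_inv_mul, mul_smul, ← h1, smul_smul, inv_mul_cancel₀ two_ne_zero, one_smul]

/-- The image of the generated algebra under an automorphism. -/
lemma conj_gnsAlgebra (hτ : IsUniqueTracialState τ) (α : A ≃⋆ₐ[ℂ] A) (D : StarSubalgebra ℂ A) :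
    (gnsAlgebra τ D).conj (gnsUnitary hτ α) =
      gnsAlgebra τ (D.map (α : A →⋆ₐ[ℂ] A)) := by
  have himp : ∀ (α : A ≃⋆ₐ[ℂ] A) (a : A),
      (gnsUnitary hτ α).conjStarAlgEquiv (τ.gnsStarAlgHom a) = τ.gnsStarAlgHom (α a) := by
    intro α a
    ext x
    obtain ⟨x, rfl⟩ := (gnsUnitary hτ α).surjective x
    rw [LinearIsometryEquiv.conjStarAlgEquiv_apply_apply, LinearIsometryEquiv.symm_apply_apply]
    refine gns_induction (p := fun x => gnsUnitary hτ α (τ.gnsStarAlgHom a x) =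
      τ.gnsStarAlgHom (α a) (gnsUnitary hτ α x))
      (isClosed_eq (by fun_prop) (by fun_prop)) (fun b => ?_) x
    have e : ∀ c b, τ.gnsStarAlgHom c (τ.gnsStarAlgHom b (vacuum τ)) =
      τ.gnsStarAlgHom (c * b) (vacuum τ) := fun c b => by rw [map_mul]; rfl
    rw [e, gns_vacuum, gns_vacuum, gnsUnitary_apply, gnsUnitary_apply, ← gns_vacuum, ← gns_vacuum, e,
      map_mul]
  ext x
  rw [mem_conj, mem_gnsAlgebra]
  set Φ := (gnsUnitary hτ α).conjStarAlgEquiv with hΦ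
  constructor
  · rintro ⟨y, hy, rfl⟩ T hT
    have := mem_gnsAlgebra.1 hy (Φ.symm T) fun d hd => by
      have h1 := congrArg Φ.symm (hT (α d) ⟨d, hd, rfl⟩)
      rwa [map_mul, map_mul, ← himp, ← hΦ, StarAlgEquiv.symm_apply_apply] at h1
    have h2 := congrArg Φ this
    rwa [map_mul, map_mul, StarAlgEquiv.apply_symm_apply] at h2
  · intro hx
    refine ⟨Φ.symm x, mem_gnsAlgebra.2 fun T hT => ?_, StarAlgEquiv.apply_symm_apply _ _⟩
    have := hx (Φ T) (by
      rintro _ ⟨d, hd, rfl⟩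
      have h1 := congrArg Φ (hT d hd)
      rwa [map_mul, map_mul, hΦ, himp] at h1)
    have h2 := congrArg Φ.symm this
    rwa [map_mul, map_mul, StarAlgEquiv.symm_apply_apply] at h2

lemma gnsUnitary_vacuum (hτ : IsUniqueTracialState τ) (α : A ≃⋆ₐ[ℂ] A) :
    gnsUnitary hτ α (vacuum τ) = vacuum τ := by
  rw [vacuum, gnsUnitary_apply, map_one]

/-- A trace on the image pulls back along α, and τ is α-invariant because it is the only tracial
state. -/
lemma HasUniqueTrace.map (hτ : IsUniqueTracialState τ) (h : HasUniqueTrace τ D)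
    (α : A ≃⋆ₐ[ℂ] A) : HasUniqueTrace τ (D.map (α : A →⋆ₐ[ℂ] A)) := by
  rintro φ hφ h1 ⟨_, d, hd, rfl⟩
  let f : D →⋆ₐ[ℂ] D.map (α : A →⋆ₐ[ℂ] A) :=
    ((α : A →⋆ₐ[ℂ] A).comp D.subtype).codRestrict _ fun d => ⟨d, d.2, rfl⟩
  have := h (φ ∘ₗ f.toAlgHom.toLinearMap)
    ⟨fun a => by
      change 0 ≤ φ (f (star a * a))
      rw [map_mul, map_star]
      exact hφ.nonneg _, fun a b => by
      change φ (f (a * b)) = φ (f (b * a))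
      rw [map_mul f, map_mul f, hφ.mul_comm]⟩
    (by
      change φ (f 1) = 1
      rw [map_one, h1]) ⟨d, hd⟩
  change _ = τ (α d)
  rw [hτ.map_aut]
  exact this

end GNS

/-! ### The index of cellular automata on regular spin chains -/

set_option linter.unusedSectionVars false

namespace AbstractSpinChain

open scoped ENNReal InnerProductSpace

variable {A : Type*} [CStarAlgebra A] (𝔄 : AbstractSpinChain A)

/-- The ⋆-algebra of local operators supported in `(-∞, x]`. -/
def halfAlg (x : ℤ) : StarSubalgebra ℂ A where
  carrier := ⋃ (I : NonemptyInterval ℤ) (_ : I.snd ≤ x), (𝔄.net I : Set A)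
  mul_mem' := by
    simp only [Set.mem_iUnion, SetLike.mem_coe]
    rintro a b ⟨I, hI, ha⟩ ⟨K, hK, hb⟩
    exact ⟨I ⊔ K, by simp [hI, hK], mul_mem (𝔄.net.monotone le_sup_left ha)
      (𝔄.net.monotone le_sup_right hb)⟩
  add_mem' := by
    simp only [Set.mem_iUnion, SetLike.mem_coe]
    rintro a b ⟨I, hI, ha⟩ ⟨K, hK, hb⟩
    exact ⟨I ⊔ K, by simp [hI, hK], add_mem (𝔄.net.monotone le_sup_left ha)
      (𝔄.net.monotone le_sup_right hb)⟩
  algebraMap_mem' c := by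
    simp only [Set.mem_iUnion, SetLike.mem_coe]
    exact ⟨⟨(x, x), le_rfl⟩, le_rfl, algebraMap_mem _ c⟩
  star_mem' := by
    simp only [Set.mem_iUnion, SetLike.mem_coe]
    rintro a ⟨I, hI, ha⟩
    exact ⟨I, hI, star_mem ha⟩

variable {𝔄}

lemma mem_halfAlg {x : ℤ} {a : A} :
    a ∈ 𝔄.halfAlg x ↔ ∃ I : NonemptyInterval ℤ, I.snd ≤ x ∧ a ∈ 𝔄.net I := by
  change a ∈ ⋃ (I : NonemptyInterval ℤ) (_ : I.snd ≤ x), (𝔄.net I : Set A) ↔ _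
  simp

lemma halfAlg_mono {x y : ℤ} (h : x ≤ y) : 𝔄.halfAlg x ≤ 𝔄.halfAlg y := by
  intro a ha
  obtain ⟨I, hI, ha⟩ := mem_halfAlg.1 ha
  exact mem_halfAlg.2 ⟨I, hI.trans h, ha⟩

variable [PartialOrder A] [StarOrderedRing A] {τ : A →ₚ[ℂ] ℂ}

lemma leftAlgebra_eq (x : ℤ) : 𝔄.leftAlgebra τ x = gnsAlgebra τ (𝔄.halfAlg x) := rfl

lemma imageAlgebra_eq (hτ : IsUniqueTracialState τ) (α : A ≃⋆ₐ[ℂ] A) (x : ℤ) :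
    𝔄.imageAlgebra hτ α x = gnsAlgebra τ ((𝔄.halfAlg x).map (α : A →⋆ₐ[ℂ] A)) := by
  rw [imageAlgebra, leftAlgebra_eq, conj_gnsAlgebra]

lemma leftAlgebra_mono {x y : ℤ} (h : x ≤ y) : 𝔄.leftAlgebra τ x ≤ 𝔄.leftAlgebra τ y := by
  rw [leftAlgebra_eq, leftAlgebra_eq]
  exact gnsAlgebra_mono (halfAlg_mono h)

variable (𝔄 τ) in
/-- The properties of a spin chain that make the index theory work. -/
structure IsRegular : Prop where
  trace : IsUniqueTracialState τ
  unique_trace : ∀ x, HasUniqueTrace τ (𝔄.halfAlg x)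
  infinite : ∀ x n, ∃ p : Fin n → A, (∀ i, p i ∈ 𝔄.halfAlg x) ∧
    (∀ i j, i ≠ j → τ (star (p i) * p j) = 0) ∧ ∀ i, τ (star (p i) * p i) ≠ 0
  generated : ∀ x z, x ≤ z → ∃ (k : ℕ) (b : Fin k → A), (∀ i, b i ∈ 𝔄.halfAlg z) ∧
    ∀ f ∈ 𝔄.halfAlg z, ∃ n : Fin k → A, (∀ i, n i ∈ 𝔄.halfAlg x) ∧ f = ∑ i, n i * b i

namespace IsRegular

lemma tracialState (h : 𝔄.IsRegular τ) : IsTracialState τ := h.trace.toIsTracialState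

lemma isFactor (h : 𝔄.IsRegular τ) (x : ℤ) : (𝔄.leftAlgebra τ x).IsFactor := by
  rw [leftAlgebra_eq]
  exact isFactor_gnsAlgebra h.tracialState (h.unique_trace x)

/-- Nonzero τ-orthogonal elements give orthogonal vectors at the vacuum, so any finite dimension
would be exceeded. -/
lemma not_finiteDimensional (h : 𝔄.IsRegular τ) (x : ℤ) :
    ¬ FiniteDimensional ℂ (𝔄.leftAlgebra τ x).toStarSubalgebra := by
  rw [leftAlgebra_eq]
  set N := gnsAlgebra τ (𝔄.halfAlg x) with hN
  intro hfd
  set n := Module.finrank ℂ N.toStarSubalgebra with hn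
  obtain ⟨p, hp, horth, hne⟩ := h.infinite x (n + 1)
  let q : Fin (n + 1) → N.toStarSubalgebra := fun i =>
    ⟨τ.gnsStarAlgHom (p i), gns_mem_gnsAlgebra (hp i)⟩
  let e : N.toStarSubalgebra →ₗ[ℂ] τ.GNS :=
    (ContinuousLinearMap.apply ℂ τ.GNS (vacuum τ)).toLinearMap ∘ₗ
      N.toStarSubalgebra.toSubalgebra.toSubmodule.subtype
  have hq : ∀ i, e (q i) = τ.gnsStarAlgHom (p i) (vacuum τ) := fun i => rfl
  have hlin : LinearIndependent ℂ (e ∘ q) := by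
    refine linearIndependent_of_ne_zero_of_inner_eq_zero (𝕜 := ℂ) (fun i hi => hne i ?_)
      fun i j hij => ?_
    · rw [← inner_gns, ← hq]
      change e (q i) = 0 at hi
      rw [hi, inner_zero_left]
    · change ⟪e (q i), e (q j)⟫_ℂ = 0
      rw [hq, hq, inner_gns, horth i j hij]
  have := (LinearIndependent.of_comp e hlin).fintype_card_le_finrank
  rw [Fintype.card_fin, ← hn] at this
  omega

lemma tracialConj (h : 𝔄.IsRegular τ) (D : StarSubalgebra ℂ A) :
    IsTracialConj h.tracialState.conj (vacuum τ) (gnsAlgebra τ D) :=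
  isTracialConj_gnsAlgebra h.tracialState D

lemma tracialConj_left (h : 𝔄.IsRegular τ) (x : ℤ) :
    IsTracialConj h.tracialState.conj (vacuum τ) (𝔄.leftAlgebra τ x) := by
  rw [leftAlgebra_eq]
  exact h.tracialConj _

lemma tracialConj_image (h : 𝔄.IsRegular τ) (α : A ≃⋆ₐ[ℂ] A) (x : ℤ) :
    IsTracialConj h.tracialState.conj (vacuum τ) (𝔄.imageAlgebra h.trace α x) := by
  rw [imageAlgebra_eq]
  exact h.tracialConj _

lemma core_left (h : 𝔄.IsRegular τ) (x : ℤ) :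
    HasUniqueTraceCore (vacuum τ) (𝔄.leftAlgebra τ x) := by
  rw [leftAlgebra_eq]
  exact (h.unique_trace x).core

lemma core_image (h : 𝔄.IsRegular τ) (α : A ≃⋆ₐ[ℂ] A) (x : ℤ) :
    HasUniqueTraceCore (vacuum τ) (𝔄.imageAlgebra h.trace α x) := by
  rw [imageAlgebra_eq]
  exact ((h.unique_trace x).map h.trace α).core

lemma isIIOneFactor (h : 𝔄.IsRegular τ) (x : ℤ) : (𝔄.leftAlgebra τ x).IsIIOneFactor := by
  refine ⟨h.isFactor x, h.not_finiteDimensional x,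
    fun T => ⟪vacuum τ, (T : τ.GNS →L[ℂ] τ.GNS) (vacuum τ)⟫_ℂ,
    -- The vacuum state is normal: one vector of the sequence suffices.
    ⟨fun n => if n = 0 then vacuum τ else 0, ?_, fun T => ?_⟩, ?_, fun S T => ?_⟩
  · refine summable_of_ne_finset_zero (s := {0}) fun n hn => ?_
    rw [Finset.mem_singleton] at hn
    simp [hn]
  · have := hasSum_single (f := fun n : ℕ => ⟪(if n = 0 then vacuum τ else 0 : τ.GNS),
      (T : τ.GNS →L[ℂ] τ.GNS) (if n = 0 then vacuum τ else 0)⟫_ℂ) 0 fun n hn => by simp [hn]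
    simpa using this
  · change ⟪vacuum τ, vacuum τ⟫_ℂ = 1
    rw [inner_self_eq_ofReal, h.tracialState.norm_vacuum]
    simp
  · have hJ := h.tracialConj_left x
    let ω : (𝔄.leftAlgebra τ x).toStarSubalgebra →ₗ[ℂ] ℂ := (innerSL ℂ (vacuum τ)).toLinearMap ∘ₗ
      (ContinuousLinearMap.apply ℂ τ.GNS (vacuum τ)).toLinearMap ∘ₗ
        (𝔄.leftAlgebra τ x).toStarSubalgebra.toSubalgebra.toSubmodule.subtype
    exact (hJ.isTraceFunctional (𝔄.leftAlgebra τ x).toStarSubalgebra (fun d hd => hd) ω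
      fun d => rfl).mul_comm S T

lemma jonesIndex_left_lt_top (h : 𝔄.IsRegular τ) {x z : ℤ} (hxz : x ≤ z) :
    jonesIndex (vacuum τ) (𝔄.leftAlgebra τ z) (𝔄.leftAlgebra τ x) < ⊤ := by
  obtain ⟨k, b, hb, hgen⟩ := h.generated x z hxz
  rw [leftAlgebra_eq, leftAlgebra_eq]
  refine jonesIndex_lt_top (gnsAlgebra_mono (halfAlg_mono hxz)) (h.tracialConj _)
    (fun i => τ.gnsStarAlgHom (b i)) (fun i => gns_mem_gnsAlgebra (hb i)) ?_
  refine (l2_gnsAlgebra_subset _).trans (closure_mono ?_)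
  rintro _ ⟨f, hf, rfl⟩
  obtain ⟨n, hn, rfl⟩ := hgen f hf
  refine ⟨fun i => τ.gnsStarAlgHom (n i), fun i => gns_mem_gnsAlgebra (hn i), ?_⟩
  simp only [map_sum, map_mul, sum_apply]
  rfl

lemma finiteIndexProperty (h : 𝔄.IsRegular τ) : 𝔄.FiniteIndexProperty τ :=
  ⟨fun x => ⟨h.isFactor x, h.not_finiteDimensional x⟩, fun _ _ hxz =>
    h.jonesIndex_left_lt_top hxz.le⟩

/-- The first inclusion is the locality bound for the inverse of α, the second the one for α; a
single spread serves all `x`. -/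
lemma halfAlg_le_map (α : 𝔄.QCA) : ∃ l : ℕ, ∀ x : ℤ,
    𝔄.halfAlg x ≤ (𝔄.halfAlg (x + l)).map ((α : A ≃⋆ₐ[ℂ] A) : A →⋆ₐ[ℂ] A) ∧
    (𝔄.halfAlg x).map ((α : A ≃⋆ₐ[ℂ] A) : A →⋆ₐ[ℂ] A) ≤ 𝔄.halfAlg (x + l) := by
  obtain ⟨α, l, hl⟩ := α
  refine ⟨l, fun x => ⟨fun a ha => ?_, ?_⟩⟩
  · obtain ⟨I, hI, ha⟩ := mem_halfAlg.1 ha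
    exact ⟨α.symm a, mem_halfAlg.2 ⟨thicken I l, by simp only [thicken]; omega, (hl I).2 a ha⟩,
      α.apply_symm_apply a⟩
  · rintro _ ⟨a, ha, rfl⟩
    obtain ⟨I, hI, ha⟩ := mem_halfAlg.1 ha
    exact mem_halfAlg.2 ⟨thicken I l, by simp only [thicken]; omega, (hl I).1 a ha⟩

lemma one_le_jonesIndex (h : 𝔄.IsRegular τ) {y : ℤ} {M : VonNeumannAlgebra τ.GNS}
    (hM : 𝔄.leftAlgebra τ y ≤ M) :
    1 ≤ jonesIndex (vacuum τ) M (𝔄.leftAlgebra τ y) := by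
  rw [← jonesIndex_self (h.tracialConj_left y) h.tracialState.norm_vacuum]
  exact jonesIndex_mono _ hM

lemma exists_imageAlgebra_le (h : 𝔄.IsRegular τ) (α : 𝔄.QCA) (x : ℤ) : ∃ z : ℤ, x ≤ z ∧
    𝔄.imageAlgebra h.trace α x ≤ 𝔄.leftAlgebra τ z := by
  obtain ⟨l, hl⟩ := halfAlg_le_map α
  refine ⟨x + l, by omega, ?_⟩
  rw [imageAlgebra_eq, leftAlgebra_eq]
  exact gnsAlgebra_mono (hl x).2

/-- The image is contained in some half line algebra, whose index is finite, and the index is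
monotone in the larger algebra. -/
lemma jonesIndex_image_lt_top (h : 𝔄.IsRegular τ) (α : 𝔄.QCA) {x y : ℤ} (hyx : y ≤ x) :
    jonesIndex (vacuum τ) (𝔄.imageAlgebra h.trace α x) (𝔄.leftAlgebra τ y) < ⊤ := by
  obtain ⟨z, hz, hle⟩ := h.exists_imageAlgebra_le α x
  exact (jonesIndex_mono _ hle).trans_lt (h.jonesIndex_left_lt_top (hyx.trans hz))

lemma jonesIndex_image_image (h : 𝔄.IsRegular τ) (α : A ≃⋆ₐ[ℂ] A) (x y : ℤ) :
    jonesIndex (vacuum τ) (𝔄.imageAlgebra h.trace α x) (𝔄.imageAlgebra h.trace α y) =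
      jonesIndex (vacuum τ) (𝔄.leftAlgebra τ x) (𝔄.leftAlgebra τ y) :=
  jonesIndex_conj _ (gnsUnitary_vacuum h.trace α)

/-- The square of the index ratio, in `[0, ∞]`. -/
noncomputable def sqRatio (h : 𝔄.IsRegular τ) (α : A ≃⋆ₐ[ℂ] A) (x y : ℤ) : ℝ≥0∞ :=
  jonesIndex (vacuum τ) (𝔄.imageAlgebra h.trace α x) (𝔄.leftAlgebra τ y) /
    jonesIndex (vacuum τ) (𝔄.leftAlgebra τ x) (𝔄.leftAlgebra τ y)

lemma jonesIndex_mul_left (h : 𝔄.IsRegular τ) {x y z : ℤ} (hxy : x ≤ y) (hyz : y ≤ z) :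
    jonesIndex (vacuum τ) (𝔄.leftAlgebra τ z) (𝔄.leftAlgebra τ x) =
      jonesIndex (vacuum τ) (𝔄.leftAlgebra τ z) (𝔄.leftAlgebra τ y) *
        jonesIndex (vacuum τ) (𝔄.leftAlgebra τ y) (𝔄.leftAlgebra τ x) :=
  jonesIndex_mul (leftAlgebra_mono hxy) (leftAlgebra_mono hyz)
    (h.tracialConj_left y) h.tracialState.norm_vacuum (h.core_left y)
    (h.jonesIndex_left_lt_top hyz) (h.jonesIndex_left_lt_top hxy)

lemma jonesIndex_left_ne_zero (h : 𝔄.IsRegular τ) {x y : ℤ} (hxy : x ≤ y) :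
    jonesIndex (vacuum τ) (𝔄.leftAlgebra τ y) (𝔄.leftAlgebra τ x) ≠ 0 :=
  (zero_lt_one.trans_le (h.one_le_jonesIndex (leftAlgebra_mono hxy))).ne'

lemma sqRatio_ne_zero (h : 𝔄.IsRegular τ) (α : 𝔄.QCA) {x y : ℤ} (hyx : y ≤ x)
    (hle : 𝔄.leftAlgebra τ y ≤ 𝔄.imageAlgebra h.trace α x) : h.sqRatio α x y ≠ 0 := by
  rw [sqRatio, ne_eq, ENNReal.div_eq_zero_iff, not_or]
  refine ⟨?_, (h.jonesIndex_left_lt_top hyx).ne⟩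
  exact (zero_lt_one.trans_le (h.one_le_jonesIndex hle)).ne'

lemma sqRatio_ne_top (h : 𝔄.IsRegular τ) (α : 𝔄.QCA) {x y : ℤ} (hyx : y ≤ x) :
    h.sqRatio α x y ≠ ⊤ :=
  ENNReal.div_ne_top (h.jonesIndex_image_lt_top α hyx).ne (h.jonesIndex_left_ne_zero hyx)

lemma imageAlgebra_mono (h : 𝔄.IsRegular τ) (α : A ≃⋆ₐ[ℂ] A) {x x' : ℤ} (hx : x ≤ x') :
    𝔄.imageAlgebra h.trace α x ≤ 𝔄.imageAlgebra h.trace α x' :=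
  VonNeumannAlgebra.conj_mono _ (leftAlgebra_mono hx)

/-- Enlarging `x` and lowering `y` does not change the ratio. -/
lemma sqRatio_eq_of_le (h : 𝔄.IsRegular τ) (α : 𝔄.QCA) {x y x' y' : ℤ} (hyx : y ≤ x)
    (hle : 𝔄.leftAlgebra τ y ≤ 𝔄.imageAlgebra h.trace α x) (hx : x ≤ x') (hy : y' ≤ y) :
    h.sqRatio α x' y' = h.sqRatio α x y := by
  have hyy : 𝔄.leftAlgebra τ y' ≤ 𝔄.leftAlgebra τ y := leftAlgebra_mono hy
  -- Multiplicativity along the tower `𝒜_{y'} ⊆ 𝒜_y ⊆ α(𝒜_x) ⊆ α(𝒜_{x'})`. The outermost step has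
  -- the index of `𝒜_x ⊆ 𝒜_{x'}` by unitary invariance, so both outer factors cancel against those
  -- of the denominator.
  have e1 : jonesIndex (vacuum τ) (𝔄.imageAlgebra h.trace α x') (𝔄.leftAlgebra τ y') =
      jonesIndex (vacuum τ) (𝔄.leftAlgebra τ x') (𝔄.leftAlgebra τ x) *
        (jonesIndex (vacuum τ) (𝔄.imageAlgebra h.trace α x) (𝔄.leftAlgebra τ y) *
          jonesIndex (vacuum τ) (𝔄.leftAlgebra τ y) (𝔄.leftAlgebra τ y')) := by
    rw [jonesIndex_mul (hyy.trans hle) (h.imageAlgebra_mono α hx) (h.tracialConj_image α x)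
      h.tracialState.norm_vacuum (h.core_image α x) (by rw [h.jonesIndex_image_image]; exact h.jonesIndex_left_lt_top hx)
      (h.jonesIndex_image_lt_top α (hy.trans hyx)), h.jonesIndex_image_image,
      jonesIndex_mul hyy hle (h.tracialConj_left y) h.tracialState.norm_vacuum (h.core_left y)
        (h.jonesIndex_image_lt_top α hyx) (h.jonesIndex_left_lt_top hy)]
  rw [sqRatio, e1, h.jonesIndex_mul_left (hy.trans hyx) hx, h.jonesIndex_mul_left hy hyx,
    ENNReal.mul_div_mul_left _ _ (h.jonesIndex_left_ne_zero hx) (h.jonesIndex_left_lt_top hx).ne,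
    ENNReal.mul_div_mul_right _ _ (h.jonesIndex_left_ne_zero hy) (h.jonesIndex_left_lt_top hy).ne,
    sqRatio]

/-- Both ratios equal the one for the larger of the `x`'s and the smaller of the `y`'s. -/
lemma sqRatio_eq (h : 𝔄.IsRegular τ) (α : 𝔄.QCA) {x y x' y' : ℤ} (hyx : y ≤ x)
    (hle : 𝔄.leftAlgebra τ y ≤ 𝔄.imageAlgebra h.trace α x) (hyx' : y' ≤ x')
    (hle' : 𝔄.leftAlgebra τ y' ≤ 𝔄.imageAlgebra h.trace α x') :
    h.sqRatio α x y = h.sqRatio α x' y' := by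
  rw [← h.sqRatio_eq_of_le α hyx hle (le_max_left x x') (min_le_left y y'),
    h.sqRatio_eq_of_le α hyx' hle' (le_max_right x x') (min_le_right y y')]

lemma exists_leftAlgebra_le (h : 𝔄.IsRegular τ) (α : 𝔄.QCA) (y : ℤ) : ∃ x : ℤ, y ≤ x ∧
    𝔄.leftAlgebra τ y ≤ 𝔄.imageAlgebra h.trace α x := by
  obtain ⟨l, hl⟩ := halfAlg_le_map α
  refine ⟨y + l, by omega, ?_⟩
  rw [imageAlgebra_eq, leftAlgebra_eq]
  exact gnsAlgebra_mono (hl y).1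

/-- The index of a cellular automaton. -/
noncomputable def indVal (h : 𝔄.IsRegular τ) (α : 𝔄.QCA) : ℝ≥0∞ :=
  h.sqRatio α (h.exists_leftAlgebra_le α 0).choose 0

lemma indVal_eq (h : 𝔄.IsRegular τ) (α : 𝔄.QCA) {x y : ℤ} (hyx : y ≤ x)
    (hle : 𝔄.leftAlgebra τ y ≤ 𝔄.imageAlgebra h.trace α x) :
    h.indVal α = h.sqRatio α x y :=
  h.sqRatio_eq α (h.exists_leftAlgebra_le α 0).choose_spec.1
    (h.exists_leftAlgebra_le α 0).choose_spec.2 hyx hle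

lemma imageAlgebra_mul (h : 𝔄.IsRegular τ) (α β : A ≃⋆ₐ[ℂ] A) (x : ℤ) :
    𝔄.imageAlgebra h.trace (α * β) x =
      (𝔄.imageAlgebra h.trace β x).conj (gnsUnitary h.trace α) := by
  rw [imageAlgebra_eq, imageAlgebra_eq, conj_gnsAlgebra, StarSubalgebra.map_map]
  rfl

/-- The tower is `𝒜_0 ⊆ α(𝒜_y) ⊆ αβ(𝒜_x)`, where `𝒜_y ⊆ β(𝒜_x)`. Its upper step is the image under α
of `𝒜_y ⊆ β(𝒜_x)` and has the same index. -/
lemma indVal_mul (h : 𝔄.IsRegular τ) (α β : 𝔄.QCA) :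
    h.indVal (α * β) = h.indVal α * h.indVal β := by
  obtain ⟨y, hy0, hy⟩ := h.exists_leftAlgebra_le α 0
  obtain ⟨x, hxy, hx⟩ := h.exists_leftAlgebra_le β y
  have hmul : 𝔄.imageAlgebra h.trace (α * β : 𝔄.QCA) x =
      (𝔄.imageAlgebra h.trace β x).conj (gnsUnitary h.trace α) := h.imageAlgebra_mul α β x
  have hle : 𝔄.imageAlgebra h.trace α y ≤ 𝔄.imageAlgebra h.trace (α * β : 𝔄.QCA) x := by
    rw [hmul]
    exact VonNeumannAlgebra.conj_mono _ hx
  have hidx : jonesIndex (vacuum τ) (𝔄.imageAlgebra h.trace (α * β : 𝔄.QCA) x)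
      (𝔄.imageAlgebra h.trace α y) =
        jonesIndex (vacuum τ) (𝔄.imageAlgebra h.trace β x) (𝔄.leftAlgebra τ y) := by
    rw [hmul]
    exact jonesIndex_conj _ (gnsUnitary_vacuum h.trace α)
  rw [h.indVal_eq (α * β) (hy0.trans hxy) (hy.trans hle), h.indVal_eq α hy0 hy,
    h.indVal_eq β hxy hx, sqRatio, jonesIndex_mul hy hle (h.tracialConj_image α y)
      h.tracialState.norm_vacuum (h.core_image α y)
      (by rw [hidx]; exact h.jonesIndex_image_lt_top β hxy) (h.jonesIndex_image_lt_top α hy0),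
    hidx, h.jonesIndex_mul_left hy0 hxy, sqRatio, sqRatio, mul_comm (_ / _),
    ENNReal.mul_div_mul_comm (Or.inl (h.jonesIndex_left_ne_zero hxy))
      (Or.inl (h.jonesIndex_left_lt_top hxy).ne)]

/-- One preserved half line is enough, since the index may be evaluated at `y = x`. -/
lemma indVal_eq_one (h : 𝔄.IsRegular τ) (α : 𝔄.QCA) {x : ℤ}
    (hx : (𝔄.halfAlg x).map ((α : A ≃⋆ₐ[ℂ] A) : A →⋆ₐ[ℂ] A) = 𝔄.halfAlg x) :
    h.indVal α = 1 := by
  have e : 𝔄.imageAlgebra h.trace α x = 𝔄.leftAlgebra τ x := by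
    rw [imageAlgebra_eq, hx, leftAlgebra_eq]
  rw [h.indVal_eq α le_rfl e.ge, sqRatio, e]
  exact ENNReal.div_self (h.jonesIndex_left_ne_zero le_rfl) (h.jonesIndex_left_lt_top le_rfl).ne

lemma indVal_pos (h : 𝔄.IsRegular τ) (α : 𝔄.QCA) : 0 < √(h.indVal α).toReal := by
  obtain ⟨x, hx, hle⟩ := h.exists_leftAlgebra_le α 0
  rw [h.indVal_eq α hx hle]
  exact Real.sqrt_pos.2 (ENNReal.toReal_pos (h.sqRatio_ne_zero α hx hle) (h.sqRatio_ne_top α hx))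

/-- The index as a homomorphism on the group of cellular automata. -/
noncomputable def indHom (h : 𝔄.IsRegular τ) : 𝔄.QCA →* {r : ℝ // 0 < r} :=
  MonoidHom.mk' (fun α => ⟨√(h.indVal α).toReal, h.indVal_pos α⟩) fun α β => by
    refine Subtype.ext ?_
    change √(h.indVal (α * β)).toReal = √(h.indVal α).toReal * √(h.indVal β).toReal
    rw [h.indVal_mul, ENNReal.toReal_mul, Real.sqrt_mul ENNReal.toReal_nonneg]

end IsRegular

end AbstractSpinChain

/-! ### Finite depth circuits -/

section LimitAut

open Filter Topology

variable {A : Type*} [CStarAlgebra A]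

lemma StarAlgEquiv.norm_apply_eq (φ : A ≃⋆ₐ[ℂ] A) (a : A) : ‖φ a‖ = ‖a‖ :=
  NonUnitalStarAlgHom.norm_map (φ : A →⋆ₐ[ℂ] A) (EquivLike.injective φ) a

lemma StarAlgEquiv.continuous_of_isometric (φ : A ≃⋆ₐ[ℂ] A) : Continuous φ :=
  (AddMonoidHomClass.isometry_of_norm φ φ.norm_apply_eq).continuous

/-- Automorphisms that agree on a dense set are equal. -/
lemma StarAlgEquiv.ext_of_dense {D : Set A} (hD : Dense D) {φ ψ : A ≃⋆ₐ[ℂ] A}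
    (h : ∀ d ∈ D, φ d = ψ d) : φ = ψ :=
  DFunLike.coe_injective
    (Continuous.ext_on hD φ.continuous_of_isometric ψ.continuous_of_isometric h)

lemma tendsto_of_eventually_const {D : Set A} (hD : Dense D) (φ : ℕ → A ≃⋆ₐ[ℂ] A)
    (h : ∀ d ∈ D, ∃ e, ∀ᶠ n in atTop, φ n d = e) (a : A) :
    ∃ b, Tendsto (fun n => φ n a) atTop (𝓝 b) := by
  refine cauchySeq_tendsto_of_complete (Metric.cauchySeq_iff'.2 fun ε hε => ?_)
  obtain ⟨d, hd, had⟩ := Metric.mem_closure_iff.1 (hD a) (ε / 2) (by positivity)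
  obtain ⟨e, he⟩ := h d hd
  obtain ⟨n₀, hn₀⟩ := eventually_atTop.1 he
  refine ⟨n₀, fun n hn => ?_⟩
  have h1 : ∀ n, dist (φ n a) (φ n d) = dist a d := fun n => by
    rw [dist_eq_norm, dist_eq_norm, ← map_sub, StarAlgEquiv.norm_apply_eq]
  calc dist (φ n a) (φ n₀ a) ≤ dist (φ n a) (φ n d) + dist (φ n d) (φ n₀ a) := dist_triangle _ _ _
    _ = dist a d + dist a d := by rw [h1, hn₀ n hn, ← hn₀ n₀ le_rfl, dist_comm (φ n₀ d), h1]
    _ < ε := by linarith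

/-- Automorphisms whose values at a dense set are eventually constant converge. -/
lemma exists_limit_starAlgEquiv {D : Set A} (hD : Dense D) (φ : ℕ → A ≃⋆ₐ[ℂ] A)
    (h : ∀ d ∈ D, ∃ e, ∀ᶠ n in atTop, φ n d = e)
    (h' : ∀ d ∈ D, ∃ e, ∀ᶠ n in atTop, (φ n).symm d = e) :
    ∃ β : A ≃⋆ₐ[ℂ] A, ∀ a, Tendsto (fun n => φ n a) atTop (𝓝 (β a)) ∧
      Tendsto (fun n => (φ n).symm a) atTop (𝓝 (β.symm a)) := by
  choose f hf using tendsto_of_eventually_const hD φ h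
  choose g hg using tendsto_of_eventually_const hD (fun n => (φ n).symm) h'
  -- Automorphisms are isometric, so `φ n⁻¹ (f a) - a` has the norm of `f a - φ n a`, which tends to
  -- zero.
  have hinv : ∀ (φ : ℕ → A ≃⋆ₐ[ℂ] A) (f g : A → A),
      (∀ a, Tendsto (fun n => φ n a) atTop (𝓝 (f a))) →
      (∀ a, Tendsto (fun n => (φ n).symm a) atTop (𝓝 (g a))) → ∀ a, g (f a) = a := by
    intro φ f g hf hg a
    refine tendsto_nhds_unique (hg (f a)) ?_
    rw [tendsto_iff_norm_sub_tendsto_zero]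
    have h1 := tendsto_iff_norm_sub_tendsto_zero.1 (hf a)
    refine h1.congr fun n => ?_
    rw [← StarAlgEquiv.norm_apply_eq (φ n) ((φ n).symm (f a) - a), map_sub,
      StarAlgEquiv.apply_symm_apply, norm_sub_rev]
  refine ⟨{ toFun := f
            invFun := g
            left_inv := hinv φ f g hf hg
            right_inv := hinv (fun n => (φ n).symm) g f hg hf
            map_mul' := fun a b => tendsto_nhds_unique (hf (a * b))
              (by simpa only [map_mul] using (hf a).mul (hf b))
            map_add' := fun a b => tendsto_nhds_unique (hf (a + b))
              (by simpa only [map_add] using (hf a).add (hf b))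
            map_star' := fun a => tendsto_nhds_unique (hf (star a))
              (by simpa only [map_star] using (hf a).star)
            map_smul' := fun c a => tendsto_nhds_unique (hf (c • a))
              (by simpa only [map_smul] using (hf a).const_smul c) },
    fun a => ⟨hf a, hg a⟩⟩

end LimitAut

namespace AbstractSpinChain

variable {A : Type*} [CStarAlgebra A] {𝔄 : AbstractSpinChain A}

/-! #### Families of commuting local unitaries -/

/-- The interval `[k - R, k + R]`. -/
noncomputable def around (k : ℤ) (R : ℕ) : NonemptyInterval ℤ := ⟨(k - R, k + R), by simp only; omega⟩

/-- The positions whose surroundings can meet `J`. -/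
noncomputable def window (J : NonemptyInterval ℤ) (R : ℕ) : Finset ℤ := Finset.Icc (J.fst - R) (J.snd + R)

variable {G : Type*} [CommGroup G] {φ : G →* (A ≃⋆ₐ[ℂ] A)} {v w : ℤ → G} {R : ℕ}

variable (𝔄 φ) in
/-- The automorphisms `φ (v k)` act within distance `R` of the site `k`. -/
structure IsLocalFamily (v : ℤ → G) (R : ℕ) : Prop where
  map_eq : ∀ k J, k ∉ window J R → ∀ a ∈ 𝔄.net J, φ (v k) a = a
  map_mem : ∀ k J, ∀ a ∈ 𝔄.net J, φ (v k) a ∈ 𝔄.net (J ⊔ around k R)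
  inv_map_mem : ∀ k J, ∀ a ∈ 𝔄.net J, φ (v k)⁻¹ a ∈ 𝔄.net (J ⊔ around k R)

variable (𝔄 φ) in
/-- `β` is the infinite product of the automorphisms `φ (v k)`. -/
def IsInfiniteProduct (v : ℤ → G) (R : ℕ) (β : A ≃⋆ₐ[ℂ] A) : Prop :=
  ∀ J, ∀ a ∈ 𝔄.net J, ∀ F : Finset ℤ, window J R ⊆ F → β a = φ (∏ k ∈ F, v k) a

namespace IsLocalFamily

/-- Used to split an infinite product by residue classes of positions. -/
lemma mask (h : 𝔄.IsLocalFamily φ v R) (p : ℤ → Prop) [DecidablePred p] :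
    𝔄.IsLocalFamily φ (fun k => if p k then v k else 1) R where
  map_eq k J hk a ha := by
    by_cases hp : p k
    · simpa [hp] using h.map_eq k J hk a ha
    · simp [hp]
  map_mem k J a ha := by
    by_cases hp : p k
    · simpa [hp] using h.map_mem k J a ha
    · simpa [hp] using 𝔄.net.monotone le_sup_left ha
  inv_map_mem k J a ha := by
    by_cases hp : p k
    · simpa [hp] using h.inv_map_mem k J a ha
    · simpa [hp] using 𝔄.net.monotone le_sup_left ha

lemma inv (h : 𝔄.IsLocalFamily φ v R) : 𝔄.IsLocalFamily φ (fun k => (v k)⁻¹) R where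
  map_eq k J hk a ha := by
    have := h.map_eq k J hk a ha
    rw [map_inv]
    nth_rewrite 1 [← this]
    exact (φ (v k)).symm_apply_apply a
  map_mem k J a ha := h.inv_map_mem k J a ha
  inv_map_mem k J a ha := by simpa using h.map_mem k J a ha

lemma prod_eq_self (h : 𝔄.IsLocalFamily φ v R) {J : NonemptyInterval ℤ} {a : A}
    (ha : a ∈ 𝔄.net J) (F : Finset ℤ) (hF : Disjoint (window J R) F) :
    φ (∏ k ∈ F, v k) a = a := by
  induction F using Finset.induction_on with
  | empty => simp
  | insert k F hk ih =>
    rw [Finset.disjoint_insert_right] at hF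
    rw [Finset.prod_insert hk, map_mul, StarAlgEquiv.mul_apply, ih hF.2, h.map_eq k J hF.1 a ha]

lemma prod_eq (h : 𝔄.IsLocalFamily φ v R) {J : NonemptyInterval ℤ} {a : A}
    (ha : a ∈ 𝔄.net J) {F : Finset ℤ} (hF : window J R ⊆ F) :
    φ (∏ k ∈ F, v k) a = φ (∏ k ∈ window J R, v k) a := by
  rw [← Finset.prod_sdiff hF, mul_comm, map_mul, StarAlgEquiv.mul_apply,
    h.prod_eq_self ha _ Finset.disjoint_sdiff]

/-- The spread does not accumulate with the number of factors: each factor only adds the sites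
within `R` of a point of the window, and these already lie within `2 * R` of `J`. -/
lemma prod_mem (h : 𝔄.IsLocalFamily φ v R) {J : NonemptyInterval ℤ} {a : A}
    (ha : a ∈ 𝔄.net J) (F : Finset ℤ) (hF : F ⊆ window J R) :
    φ (∏ k ∈ F, v k) a ∈ 𝔄.net (thicken J (2 * R)) := by
  induction F using Finset.induction_on with
  | empty =>
    simp only [Finset.prod_empty, map_one]
    refine 𝔄.net.monotone ?_ ha
    constructor <;> simp only [thicken] <;> push_cast <;> omega
  | insert k F hk ih =>
    rw [Finset.insert_subset_iff] at hF
    rw [Finset.prod_insert hk, map_mul, StarAlgEquiv.mul_apply]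
    have h1 := h.map_mem k _ _ (ih hF.2)
    have hkw := hF.1
    rw [window, Finset.mem_Icc] at hkw
    have h2 : around k R ≤ thicken J (2 * R) := by
      constructor <;> simp only [thicken, around] <;> push_cast <;> omega
    rwa [sup_eq_left.2 h2] at h1

lemma prod_mem' (h : 𝔄.IsLocalFamily φ v R) {J : NonemptyInterval ℤ} {a : A}
    (ha : a ∈ 𝔄.net J) {F : Finset ℤ} (hF : window J R ⊆ F) :
    φ (∏ k ∈ F, v k) a ∈ 𝔄.net (thicken J (2 * R)) := by
  rw [h.prod_eq ha hF]
  exact h.prod_mem ha _ subset_rfl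

/-- A local family has an infinite product. -/
lemma exists_infiniteProduct (h : 𝔄.IsLocalFamily φ v R) :
    ∃ β : A ≃⋆ₐ[ℂ] A, 𝔄.IsInfiniteProduct φ v R β ∧ β ∈ 𝔄.QCA := by
  have hev : ∀ J, ∀ᶠ n : ℕ in Filter.atTop, window J R ⊆ Finset.Icc (-(n : ℤ)) n := by
    intro J
    filter_upwards [Filter.eventually_ge_atTop ((J.fst - R).natAbs + (J.snd + R).natAbs)] with n hn
    intro k hk
    rw [window, Finset.mem_Icc] at hk
    rw [Finset.mem_Icc]
    omega
  have key : ∀ v : ℤ → G, 𝔄.IsLocalFamily φ v R → ∀ J, ∀ a ∈ 𝔄.net J, ∀ᶠ n : ℕ in Filter.atTop,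
      φ (∏ k ∈ Finset.Icc (-(n : ℤ)) n, v k) a = φ (∏ k ∈ window J R, v k) a := by
    intro v h J a ha
    filter_upwards [hev J] with n hn
    exact h.prod_eq ha hn
  have hsymm : ∀ (F : Finset ℤ) a, (φ (∏ k ∈ F, v k)).symm a = φ (∏ k ∈ F, (v k)⁻¹) a := by
    intro F a
    rw [Finset.prod_inv_distrib, map_inv]
    rfl
  obtain ⟨β, hβ⟩ := exists_limit_starAlgEquiv 𝔄.quasiLocal
    (fun n : ℕ => φ (∏ k ∈ Finset.Icc (-(n : ℤ)) n, v k))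
    (fun d hd => by
      obtain ⟨J, hJ⟩ := Set.mem_iUnion.1 hd
      exact ⟨_, key v h J d hJ⟩)
    (fun d hd => by
      obtain ⟨J, hJ⟩ := Set.mem_iUnion.1 hd
      simp_rw [hsymm]
      exact ⟨_, key _ h.inv J d hJ⟩)
  have hβ1 : ∀ J, ∀ a ∈ 𝔄.net J, β a = φ (∏ k ∈ window J R, v k) a := fun J a ha =>
    tendsto_nhds_unique (hβ a).1 (tendsto_const_nhds.congr' ((key v h J a ha).mono fun _ h => h.symm))
  have hβ2 : ∀ J, ∀ a ∈ 𝔄.net J, β.symm a = φ (∏ k ∈ window J R, (v k)⁻¹) a := by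
    intro J a ha
    have := (hβ a).2
    simp_rw [hsymm] at this
    exact tendsto_nhds_unique this
      (tendsto_const_nhds.congr' ((key _ h.inv J a ha).mono fun _ h => h.symm))
  refine ⟨β, fun J a ha F hF => by rw [hβ1 J a ha, h.prod_eq ha hF], 2 * R, fun J =>
    ⟨fun a ha => ?_, fun a ha => ?_⟩⟩
  · rw [hβ1 J a ha]
    exact h.prod_mem ha _ subset_rfl
  · rw [hβ2 J a ha]
    exact h.inv.prod_mem ha _ subset_rfl

end IsLocalFamily

lemma IsInfiniteProduct.mul {β γ : A ≃⋆ₐ[ℂ] A} (hw : 𝔄.IsLocalFamily φ w R)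
    (hvw : 𝔄.IsLocalFamily φ (fun k => v k * w k) R)
    (hβ : 𝔄.IsInfiniteProduct φ v R β) (hγ : 𝔄.IsInfiniteProduct φ w R γ) :
    𝔄.IsInfiniteProduct φ (fun k => v k * w k) R (β * γ) := by
  intro J a ha F hF
  -- `γ` spreads `a` over the thickened interval, so the finite set must also contain the window of
  -- that interval before `β` can be evaluated.
  have hF' : window J R ⊆ F ∪ window (thicken J (2 * R)) R := hF.trans Finset.subset_union_left
  rw [hvw.prod_eq ha hF, ← hvw.prod_eq ha hF', StarAlgEquiv.mul_apply, hγ J a ha _ hF',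
    hβ _ _ (hw.prod_mem' ha hF') _ Finset.subset_union_right, ← StarAlgEquiv.mul_apply, ← map_mul,
    Finset.prod_mul_distrib]

lemma IsInfiniteProduct.unique {β γ : A ≃⋆ₐ[ℂ] A} (hβ : 𝔄.IsInfiniteProduct φ v R β)
    (hγ : 𝔄.IsInfiniteProduct φ v R γ) : β = γ :=
  StarAlgEquiv.ext_of_dense 𝔄.quasiLocal fun d hd => by
    obtain ⟨J, hJ⟩ := Set.mem_iUnion.1 hd
    rw [hβ J d hJ _ subset_rfl, hγ J d hJ _ subset_rfl]

end AbstractSpinChain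

namespace AbstractSpinChain

variable {A : Type*} [CStarAlgebra A] {𝔄 : AbstractSpinChain A}

/-! #### Depth one circuits -/

lemma partition_disjoint {I : ℕ → NonemptyInterval ℤ} (hI : ∀ k : ℤ, ∃! i, k ∈ I i) {i j : ℕ}
    (hij : i ≠ j) : Disjoint (I i : Set ℤ) (I j : Set ℤ) := by
  rw [Set.disjoint_left]
  intro k hi hj
  exact hij ((hI k).unique hi hj)

/-- Each of the finitely many sites of `J` belongs to exactly one block. -/
lemma partition_disjoint_of_large {I : ℕ → NonemptyInterval ℤ} (hI : ∀ k : ℤ, ∃! i, k ∈ I i)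
    (J : NonemptyInterval ℤ) : ∃ n₀ : ℕ, ∀ i ≥ n₀, Disjoint (I i : Set ℤ) (J : Set ℤ) := by
  choose f hf hf' using hI
  refine ⟨(Finset.Icc J.fst J.snd).sup f + 1, fun i hi => Set.disjoint_left.2 fun k hk hkJ => ?_⟩
  have h1 : i = f k := hf' k i hk
  have h2 : f k ≤ (Finset.Icc J.fst J.snd).sup f := Finset.le_sup (f := f) (Finset.mem_Icc.2 hkJ)
  omega

/-- Conjugation by a unitary of `(-∞, x]` or of `(x, ∞)` preserves `halfAlg x`. -/
lemma conj_mem_halfAlg {I : NonemptyInterval ℤ} {x : ℤ} (hI : I.snd ≤ x ∨ x < I.fst) {u a : A}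
    (hu : u ∈ 𝔄.net I) (hu' : u ∈ unitary A) (ha : a ∈ 𝔄.halfAlg x) :
    u * a * star u ∈ 𝔄.halfAlg x := by
  rcases hI with hI | hI
  · have : u ∈ 𝔄.halfAlg x := mem_halfAlg.2 ⟨I, hI, hu⟩
    exact mul_mem (mul_mem this ha) (star_mem this)
  · obtain ⟨K, hK, haK⟩ := mem_halfAlg.1 ha
    have hdisj : Disjoint (I : Set ℤ) (K : Set ℤ) :=
      Set.disjoint_left.2 fun k hk hk' => by
        have h1 : I.fst ≤ k := hk.1
        have h2 : k ≤ K.snd := hk'.2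
        omega
    have hc : u * a = a * u := 𝔄.locality I K hdisj u hu a haK
    rw [hc, mul_assoc, (Unitary.mem_iff.1 hu').2, mul_one]
    exact ha

/-- A depth one circuit preserves the algebra of the half line that ends with a block. -/
theorem IsDepthOneCircuit.exists_map_halfAlg {α : A ≃⋆ₐ[ℂ] A} (hα : 𝔄.IsDepthOneCircuit α) :
    ∃ x, (𝔄.halfAlg x).map (α : A →⋆ₐ[ℂ] A) = 𝔄.halfAlg x := by
  obtain ⟨I, l, u, hI, -, hu, hαu⟩ := hα
  -- With this cut no block straddles `x`: every block lies in `(-∞, x]` or in `(x, ∞)`.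
  set x := (I 0).snd with hx
  have hside : ∀ i, (I i).snd ≤ x ∨ x < (I i).fst := by
    intro i
    by_contra! hcon
    have h1 : x ∈ I i := ⟨hcon.2, hcon.1.le⟩
    have h2 : x ∈ I 0 := ⟨(I 0).fst_le_snd, le_rfl⟩
    obtain rfl : i = 0 := (hI x).unique h1 h2
    exact lt_irrefl _ hcon.1
  set P : ℕ → A := fun n => ((List.range n).map u).prod with hP
  have hP0 : P 0 = 1 := by simp [hP]
  have hPs : ∀ n, P (n + 1) = P n * u n := fun n => by simp [hP, List.range_succ]
  have hPu : ∀ n, P n ∈ unitary A := by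
    intro n
    induction n with
    | zero => rw [hP0]; exact one_mem _
    | succ n ih => rw [hPs]; exact mul_mem ih (hu n).2
  have hcomm : ∀ n m, n ≤ m → P n * u m = u m * P n := by
    intro n
    induction n with
    | zero => intro m _; rw [hP0, one_mul, mul_one]
    | succ n ih =>
      intro m hm
      have h1 : u n * u m = u m * u n := 𝔄.locality _ _
        (partition_disjoint hI (by omega)) _ (hu n).1 _ (hu m).1
      rw [hPs, mul_assoc, h1, ← mul_assoc, ih m (by omega), mul_assoc]
  have hmem : ∀ n, ∀ a ∈ 𝔄.halfAlg x, P n * a * star (P n) ∈ 𝔄.halfAlg x := by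
    intro n
    induction n with
    | zero => intro a ha; rw [hP0]; simpa using ha
    | succ n ih =>
      intro a ha
      have := ih _ (conj_mem_halfAlg (hside n) (hu n).1 (hu n).2 ha)
      rw [hPs, star_mul]
      simpa only [mul_assoc] using this
  have hmem' : ∀ n, ∀ a ∈ 𝔄.halfAlg x, star (P n) * a * P n ∈ 𝔄.halfAlg x := by
    intro n
    induction n with
    | zero => intro a ha; rw [hP0]; simpa using ha
    | succ n ih =>
      intro a ha
      have := conj_mem_halfAlg (hside n) (star_mem (hu n).1) (Unitary.star_mem (hu n).2) (ih a ha)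
      rw [star_star] at this
      rw [hPs, star_mul]
      simpa only [mul_assoc] using this
  refine ⟨x, le_antisymm ?_ fun a ha => ?_⟩
  · rintro _ ⟨a, ha, rfl⟩
    obtain ⟨J, hJ, haJ⟩ := mem_halfAlg.1 ha
    obtain ⟨n, hn⟩ := (hαu J a haJ).exists
    change α a ∈ _
    rw [hn]
    exact hmem n a ha
  · obtain ⟨J, hJ, haJ⟩ := mem_halfAlg.1 ha
    obtain ⟨n₀, hn₀⟩ := partition_disjoint_of_large hI J
    -- The conjugates by the inverse partial products are eventually constant too, and the constant
    -- is the preimage of `a`. No locality of the inverse of α is used.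
    have hstab : ∀ n ≥ n₀, star (P n) * a * P n = star (P n₀) * a * P n₀ := by
      intro n hn
      induction n, hn using Nat.le_induction with
      | base => rfl
      | succ n hn ih =>
        have h1 : u n * a = a * u n := 𝔄.locality _ _ (hn₀ n hn) _ (hu n).1 _ haJ
        have h2 : star (u n) * (a * u n) = a := by
          rw [← h1, ← mul_assoc, (Unitary.mem_iff.1 (hu n).2).1, one_mul]
        rw [← ih, hPs, hcomm n n le_rfl, star_mul]
        calc star (P n) * star (u n) * a * (u n * P n)
            = star (P n) * (star (u n) * (a * u n)) * P n := by simp only [mul_assoc]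
          _ = _ := by rw [h2]
    have hb := hmem' n₀ a ha
    obtain ⟨K, hK, hbK⟩ := mem_halfAlg.1 hb
    obtain ⟨n, hn1, hn2⟩ := ((hαu K _ hbK).and (Filter.eventually_ge_atTop n₀)).exists
    refine ⟨star (P n₀) * a * P n₀, hb, ?_⟩
    change α _ = a
    rw [hn1]
    change P n * _ * star (P n) = a
    rw [← hstab n hn2]
    have hPP := (Unitary.mem_iff.1 (hPu n)).2
    calc P n * (star (P n) * a * P n) * star (P n)
        = (P n * star (P n)) * a * (P n * star (P n)) := by simp only [mul_assoc]
      _ = a := by rw [hPP, one_mul, mul_one]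

/-! ### Infinite products of commuting unitaries in overlapping blocks. -/

section Conjugation

variable {G : Type*} [CommGroup G] (ι : G →* unitary A) {v : ℤ → G} {l L : ℕ}

/-- The block `[k - l, k - l + L - 1]`. -/
noncomputable def block (l L : ℕ) (hL : 0 < L) (k : ℤ) : NonemptyInterval ℤ :=
  ⟨(k - l, k - l + L - 1), by simp only; omega⟩

/-- A unitary acts trivially by conjugation on everything disjoint from its block, and the block at
`k` lies within `l + L` of `k`. -/
lemma isLocalFamily_of_mem (hL : 0 < L)
    (hv : ∀ k, (ι (v k) : A) ∈ 𝔄.net (block l L hL k)) :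
    𝔄.IsLocalFamily ((Unitary.conjStarAlgAut ℂ A).comp ι) v (l + L) where
  map_eq k J hk a ha := by
    have hdisj : Disjoint (block l L hL k : Set ℤ) (J : Set ℤ) :=
      Set.disjoint_left.2 fun m hm hm' => hk (by
        have h1 : k - l ≤ m := hm.1
        have h2 : m ≤ k - l + L - 1 := hm.2
        have h3 : J.fst ≤ m := hm'.1
        have h4 : m ≤ J.snd := hm'.2
        rw [window, Finset.mem_Icc]
        push_cast
        omega)
    have hc : (ι (v k) : A) * a = a * ι (v k) := 𝔄.locality _ _ hdisj _ (hv k) a ha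
    rw [MonoidHom.comp_apply, Unitary.conjStarAlgAut_apply, hc, mul_assoc,
      (Unitary.mem_iff.1 (ι (v k)).2).2, mul_one]
  map_mem k J a ha := by
    have hle : block l L hL k ≤ around k (l + L) := by
      constructor <;> simp only [block, around] <;> push_cast <;> omega
    have h1 := 𝔄.net.monotone (hle.trans le_sup_right : _ ≤ J ⊔ around k (l + L)) (hv k)
    rw [MonoidHom.comp_apply, Unitary.conjStarAlgAut_apply]
    exact mul_mem (mul_mem h1 (𝔄.net.monotone le_sup_left ha)) (star_mem h1)
  inv_map_mem k J a ha := by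
    have hle : block l L hL k ≤ around k (l + L) := by
      constructor <;> simp only [block, around] <;> push_cast <;> omega
    have h1 := 𝔄.net.monotone (hle.trans le_sup_right : _ ≤ J ⊔ around k (l + L)) (hv k)
    rw [MonoidHom.comp_apply, map_inv, Unitary.conjStarAlgAut_apply]
    have e : (((ι (v k))⁻¹ : unitary A) : A) = star (ι (v k) : A) := rfl
    rw [e]
    exact mul_mem (mul_mem (star_mem h1) (𝔄.net.monotone le_sup_left ha)) (star_mem (star_mem h1))

/-- The infinite product over a residue class is a depth one circuit. -/
lemma isDepthOneCircuit_residue (hL : 0 < L)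
    (hv : ∀ k, (ι (v k) : A) ∈ 𝔄.net (block l L hL k)) (r : ℤ) (hr : 0 ≤ r) (hrL : r < L)
    {β : A ≃⋆ₐ[ℂ] A} (hβ : 𝔄.IsInfiniteProduct ((Unitary.conjStarAlgAut ℂ A).comp ι)
      (fun k => if k % L = r then v k else 1) (l + L) β) : 𝔄.IsDepthOneCircuit β := by
  have hL' : (0 : ℤ) < L := by exact_mod_cast hL
  -- Blocks of length `L` placed at the positions `r + m L` tile the line; `e` enumerates them by
  -- natural numbers.
  let e : ℕ ≃ ℤ := (Denumerable.eqv ℤ).symm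
  refine ⟨fun i => block l L hL (r + e i * L), L, fun i => ι (v (r + e i * L)), ?_, ?_, ?_, ?_⟩
  · intro m
    have hiff : ∀ i, m ∈ block l L hL (r + e i * L) ↔ e i = (m - r + l) / L := by
      intro i
      have h1 : m ∈ block l L hL (r + e i * L) ↔
          r + e i * L - l ≤ m ∧ m ≤ r + e i * L - l + L - 1 := Iff.rfl
      rw [h1, eq_comm, Int.ediv_eq_iff_of_pos hL']
      constructor <;> rintro ⟨h2, h3⟩ <;> constructor <;> linarith
    refine ⟨e.symm ((m - r + l) / L), (hiff _).2 (e.apply_symm_apply _), fun j hj => ?_⟩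
    rw [← (hiff j).1 hj, e.symm_apply_apply]
  · intro i
    simp only [block]
    omega
  · exact fun i => ⟨hv _, (ι (v (r + e i * L))).2⟩
  · intro J w hw
    let g : ℕ → ℤ := fun i => r + e i * L
    have hg : Function.Injective g := fun i j hij => by
      have h1 : e i * (L : ℤ) = e j * L := by simpa [g] using hij
      exact e.injective (mul_right_cancel₀ hL'.ne' h1)
    have hgmod : ∀ i, g i % L = r := fun i => by
      simp only [g, Int.add_mul_emod_self_right]
      exact Int.emod_eq_of_lt hr hrL
    have hgsurj : ∀ k : ℤ, k % L = r → ∃ i, g i = k := fun k hk => by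
      refine ⟨e.symm (k / L), ?_⟩
      simp only [g, e.apply_symm_apply]
      rw [← hk, mul_comm]
      exact Int.emod_add_mul_ediv k L
    -- Beyond `n₀` the first `n` blocks include every position of the residue class in the window;
    -- positions outside the class contribute trivial factors.
    let n₀ := ((window J (l + L)).sup fun k => e.symm (k / L)) + 1
    filter_upwards [Filter.eventually_ge_atTop n₀] with n hn
    have hprod : ∀ n, ((List.range n).map fun i => (ι (v (g i)) : A)).prod =
        (ι (∏ k ∈ (Finset.range n).image g, if k % L = r then v k else 1) : A) := by
      intro n
      rw [Finset.prod_image fun i _ j _ h => hg h]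
      induction n with
      | zero => simp
      | succ n ih =>
        rw [List.range_succ, List.map_append, List.prod_append, ih, Finset.prod_range_succ, map_mul,
          if_pos (hgmod n)]
        simp
    have hsub : ∏ k ∈ (Finset.range n).image g, (if k % L = r then v k else 1) =
        ∏ k ∈ (Finset.range n).image g ∪ window J (l + L), (if k % L = r then v k else 1) := by
      refine Finset.prod_subset Finset.subset_union_left fun k hk hk' => ?_
      rw [if_neg]
      intro hkr
      refine hk' (Finset.mem_image.2 ⟨e.symm (k / L), Finset.mem_range.2 ?_, ?_⟩)
      · have hkw : k ∈ window J (l + L) := by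
          rcases Finset.mem_union.1 hk with h | h
          · exact absurd h hk'
          · exact h
        have := Finset.le_sup (f := fun k : ℤ => e.symm (k / L)) hkw
        have hk2 : e.symm (k / L) ≤ (window J (l + L)).sup fun k => e.symm (k / L) := this
        omega
      · simp only [g, e.apply_symm_apply]
        rw [← hkr, mul_comm]
        exact Int.emod_add_mul_ediv k L
    rw [hβ J w hw _ (Finset.subset_union_right (s₁ := (Finset.range n).image g)), ← hsub,
      MonoidHom.comp_apply, Unitary.conjStarAlgAut_apply, ← hprod]

/-- An infinite product of commuting unitaries supported in blocks of bounded length is a finite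
depth circuit. -/
lemma mem_FDQC_of_isInfiniteProduct (hL : 0 < L)
    (hv : ∀ k, (ι (v k) : A) ∈ 𝔄.net (block l L hL k)) (β : 𝔄.QCA)
    (hβ : 𝔄.IsInfiniteProduct ((Unitary.conjStarAlgAut ℂ A).comp ι) v (l + L) β) :
    β ∈ 𝔄.FDQC := by
  have hL' : (0 : ℤ) < L := by exact_mod_cast hL
  have hloc := isLocalFamily_of_mem ι hL hv
  -- Overlapping blocks are separated by residues modulo `L`; each further residue class contributes
  -- one depth one circuit.
  have key : ∀ s : ℕ, s ≤ L → ∃ γ : 𝔄.QCA, γ ∈ 𝔄.FDQC ∧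
      𝔄.IsInfiniteProduct ((Unitary.conjStarAlgAut ℂ A).comp ι)
        (fun k => if k % L < s then v k else 1) (l + L) γ := by
    intro s
    induction s with
    | zero =>
      intro _
      refine ⟨1, one_mem _, fun J a ha F hF => ?_⟩
      have : ∀ k : ℤ, (if k % L < ((0 : ℕ) : ℤ) then v k else 1) = 1 := fun k => by
        rw [if_neg]
        have := Int.emod_nonneg k hL'.ne'
        push_cast
        omega
      simp only [this, Finset.prod_const_one, map_one]
      rfl
    | succ s ih =>
      intro hs
      obtain ⟨γ, hγ, hγp⟩ := ih (by omega)
      obtain ⟨δ, hδp, hδ⟩ := (hloc.mask fun k => k % L = (s : ℤ)).exists_infiniteProduct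
      refine ⟨γ * ⟨δ, hδ⟩, mul_mem hγ (Subgroup.subset_closure ?_), ?_⟩
      · exact isDepthOneCircuit_residue ι hL hv s (by omega) (by omega) hδp
      · have e : (fun k : ℤ => if k % L < ((s + 1 : ℕ) : ℤ) then v k else 1) = fun k =>
            (if k % L < (s : ℤ) then v k else 1) * (if k % L = (s : ℤ) then v k else 1) := by
          funext k
          push_cast
          rcases lt_trichotomy (k % (L : ℤ)) s with h | h | h
          · rw [if_pos (by omega), if_pos h, if_neg (by omega), mul_one]
          · rw [if_pos (by omega), if_neg (by omega), if_pos h, one_mul]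
          · rw [if_neg (by omega), if_neg (by omega), if_neg (by omega), one_mul]
        have h2 := hloc.mask fun k => k % L < ((s + 1 : ℕ) : ℤ)
        rw [e] at h2 ⊢
        exact hγp.mul (hloc.mask _) h2 hδp
  obtain ⟨γ, hγ, hγp⟩ := key L le_rfl
  have e : (fun k : ℤ => if k % L < (L : ℤ) then v k else 1) = v := by
    funext k
    rw [if_pos (Int.emod_lt_of_pos k hL')]
  rw [e] at hγp
  have : β = γ := Subtype.ext (hβ.unique hγp)
  rwa [this]

end Conjugation

open scoped IsMulCommutative in
/-- A conjugate of a depth one circuit is a finite depth circuit. -/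
lemma conj_mem_FDQC (γ α : 𝔄.QCA) (hα : 𝔄.IsDepthOneCircuit α) : γ * α * γ⁻¹ ∈ 𝔄.FDQC := by
  obtain ⟨I, L₀, u, hI, hlen, hu, hαu⟩ := hα
  obtain ⟨l, hl⟩ := γ.2
  have hinj : Function.Injective fun i => (I i).fst := fun i j hij => by
    refine (hI (I i).fst).unique ⟨le_rfl, (I i).fst_le_snd⟩ ⟨?_, ?_⟩
    · exact hij.ge
    · exact hij.le.trans (I j).fst_le_snd
  have hgu : ∀ i, (γ : A ≃⋆ₐ[ℂ] A) (u i) ∈ unitary A := fun i => by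
    have h1 := Unitary.mem_iff.1 (hu i).2
    rw [Unitary.mem_iff, ← map_star, ← map_mul, ← map_mul, h1.1, h1.2, map_one]
    exact ⟨rfl, rfl⟩
  let v₀ : ℕ → unitary A := fun i => ⟨(γ : A ≃⋆ₐ[ℂ] A) (u i), hgu i⟩
  have hcomm : ∀ a ∈ Set.range v₀, ∀ b ∈ Set.range v₀, a * b = b * a := by
    rintro _ ⟨i, rfl⟩ _ ⟨j, rfl⟩
    rcases eq_or_ne i j with rfl | hij
    · rfl
    refine Subtype.ext ?_
    change (γ : A ≃⋆ₐ[ℂ] A) (u i) * (γ : A ≃⋆ₐ[ℂ] A) (u j) =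
      (γ : A ≃⋆ₐ[ℂ] A) (u j) * (γ : A ≃⋆ₐ[ℂ] A) (u i)
    have h1 : u i * u j = u j * u i := 𝔄.locality _ _
        (partition_disjoint hI hij) _ (hu i).1 _ (hu j).1
    rw [← map_mul, ← map_mul, h1]
  -- The images `γ (u i)` commute although their blocks may overlap, so they generate a commutative
  -- group in which finite products need no order.
  let G := Subgroup.closure (Set.range v₀)
  have : IsMulCommutative G := Subgroup.isMulCommutative_closure hcomm
  let ι : G →* unitary A := G.subtype
  let v₁ : ℕ → G := fun i => ⟨v₀ i, Subgroup.subset_closure ⟨i, rfl⟩⟩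
  classical
  -- Each unitary is attached to the left end of its original block; all other sites carry the
  -- identity.
  let v : ℤ → G := Function.extend (fun i => (I i).fst) v₁ 1
  have hvi : ∀ i, v (I i).fst = v₁ i := fun i => hinj.extend_apply v₁ 1 i
  -- A block has at most `L₀` sites and its thickening at most `L₀ + 2 * l`, starting `l` to the
  -- left; the extra site makes positivity immediate.
  have hL : 0 < L₀ + 2 * l + 1 := by omega
  have hv : ∀ k, (ι (v k) : A) ∈ 𝔄.net (block l (L₀ + 2 * l + 1) hL k) := by
    intro k
    by_cases hk : ∃ i, (I i).fst = k
    · obtain ⟨i, rfl⟩ := hk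
      rw [hvi]
      refine 𝔄.net.monotone ?_ ((hl (I i)).1 _ (hu i).1)
      have := hlen i
      constructor <;> simp only [block, thicken] <;> push_cast <;> omega
    · have h1 : v k = 1 := Function.extend_apply' v₁ (1 : ℤ → G) k hk
      rw [h1, map_one]
      exact one_mem _
  refine mem_FDQC_of_isInfiniteProduct (G := G) (v := v) (l := l) ι hL hv _ fun J a ha F hF => ?_
  have hloc := isLocalFamily_of_mem ι hL hv
  rw [hloc.prod_eq ha hF]
  have ha' := (hl J).2 a ha
  set W := window J (l + (L₀ + 2 * l + 1)) with hW
  choose f hf hf' using hI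
  obtain ⟨n, hn1, hn2⟩ := ((hαu _ _ ha').and
    (Filter.eventually_ge_atTop (W.sup f + 1))).exists
  have hprod : ∀ n, (γ : A ≃⋆ₐ[ℂ] A) ((List.range n).map u).prod =
      (ι (∏ k ∈ (Finset.range n).image (fun i => (I i).fst), v k) : A) := by
    intro n
    rw [Finset.prod_image fun i _ j _ h => hinj h]
    induction n with
    | zero => simp
    | succ n ih =>
      rw [List.range_succ, List.map_append, List.prod_append, map_mul, ih, Finset.prod_range_succ,
        map_mul, hvi]
      simp
      rfl
  have hsub : ∏ k ∈ (Finset.range n).image (fun i => (I i).fst), v k =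
      ∏ k ∈ (Finset.range n).image (fun i => (I i).fst) ∪ W, v k := by
    refine Finset.prod_subset Finset.subset_union_left fun k hk hk' => ?_
    refine Function.extend_apply' v₁ (1 : ℤ → G) k ?_
    rintro ⟨i, rfl⟩
    refine hk' (Finset.mem_image.2 ⟨i, Finset.mem_range.2 ?_, rfl⟩)
    have hkw : (I i).fst ∈ W := by
      rcases Finset.mem_union.1 hk with h | h
      · exact absurd h hk'
      · exact h
    have h1 : i = f (I i).fst := hf' _ i ⟨le_rfl, (I i).fst_le_snd⟩
    have h2 := Finset.le_sup (f := f) hkw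
    omega
  rw [← hloc.prod_eq ha (Finset.subset_union_right (s₁ := (Finset.range n).image
    (fun i => (I i).fst))), ← hsub, MonoidHom.comp_apply, Unitary.conjStarAlgAut_apply, ← hprod]
  change (γ : A ≃⋆ₐ[ℂ] A) ((α : A ≃⋆ₐ[ℂ] A) ((γ : A ≃⋆ₐ[ℂ] A).symm a)) = _
  rw [hn1, map_mul, map_mul, map_star, StarAlgEquiv.apply_symm_apply]

/-- Conjugation is a homomorphism, so it suffices to treat the generators. -/
instance FDQC_normal : 𝔄.FDQC.Normal := by
  refine ⟨fun α hα γ => ?_⟩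
  refine Subgroup.closure_induction (p := fun α _ => γ * α * γ⁻¹ ∈ 𝔄.FDQC)
    (fun α hα => conj_mem_FDQC γ α hα) (by simp [one_mem]) (fun α β _ _ h1 h2 => ?_)
    (fun α _ h1 => ?_) hα
  · have := mul_mem h1 h2
    simpa [mul_assoc] using this
  · have := inv_mem h1
    simpa [mul_assoc] using this

variable [PartialOrder A] [StarOrderedRing A] {τ : A →ₚ[ℂ] ℂ}

/-- The main theorem for regular spin chains. -/
theorem IsRegular.main (h : 𝔄.IsRegular τ) :
    𝔄.FiniteIndexProperty τ ∧ (∀ x : ℤ, (𝔄.leftAlgebra τ x).IsIIOneFactor) ∧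
      (∀ α : 𝔄.QCA, ∃ x y : ℤ, y ≤ x ∧
        𝔄.leftAlgebra τ y ≤ 𝔄.imageAlgebra h.trace α x) ∧
      ∃ _ : 𝔄.FDQC.Normal, ∃! ind : 𝔄.QCA ⧸ 𝔄.FDQC →* {r : ℝ // 0 < r},
          ∀ (α : 𝔄.QCA) (x y : ℤ), y ≤ x →
            𝔄.leftAlgebra τ y ≤ 𝔄.imageAlgebra h.trace α x →
            (ind (QuotientGroup.mk α) : ℝ) = 𝔄.indexRatio h.trace α x y := by
  have hex : ∀ α : 𝔄.QCA, ∃ x y : ℤ, y ≤ x ∧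
      𝔄.leftAlgebra τ y ≤ 𝔄.imageAlgebra h.trace α x := fun α => by
    obtain ⟨x, hx⟩ := h.exists_leftAlgebra_le α 0
    exact ⟨x, 0, hx⟩
  refine ⟨h.finiteIndexProperty, h.isIIOneFactor, hex, FDQC_normal, ?_⟩
  have hker : 𝔄.FDQC ≤ h.indHom.ker := by
    refine (Subgroup.closure_le _).2 fun α hα => ?_
    obtain ⟨x, hx⟩ := IsDepthOneCircuit.exists_map_halfAlg hα
    rw [SetLike.mem_coe, MonoidHom.mem_ker]
    refine Subtype.ext ?_
    change √(h.indVal α).toReal = 1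
    rw [h.indVal_eq_one α hx]
    simp
  refine ⟨QuotientGroup.lift _ h.indHom hker, fun α x y hyx hle => ?_, fun ind hind => ?_⟩
  · change √(h.indVal α).toReal = _
    rw [h.indVal_eq α hyx hle]
    rfl
  -- Every automaton admits some pair `y ≤ x` with the required inclusion, so the formula determines
  -- the homomorphism.
  · refine QuotientGroup.monoidHom_ext _ (MonoidHom.ext fun α => Subtype.ext ?_)
    obtain ⟨x, y, hyx, hle⟩ := hex α
    change (ind (QuotientGroup.mk α) : ℝ) = √(h.indVal α).toReal
    rw [hind α x y hyx hle, h.indVal_eq α hyx hle]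
    rfl

end AbstractSpinChain

/-! ### Orthogonal decompositions in unitary fusion categories -/

section Decomposition

open CStarCategory

universe v u

attribute [local instance] Abelian.hasFiniteBiproducts

variable {C : Type u} [Category.{v} C] [Abelian C] [Linear ℂ C] [MonoidalCategory C]
  [MonoidalPreadditive C] [MonoidalLinear ℂ C] [RigidCategory C] [UnitaryFusionCategory C]

lemma dag_zero {Y Z : C} : dag (0 : Y ⟶ Z) = 0 := by
  have := dag_smul (C := C) 0 (0 : Y ⟶ Z)
  simpa using this

lemma dag_sub {Y Z : C} (f g : Y ⟶ Z) : dag (f - g) = dag f - dag g := by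
  have h : dag (f - g) + dag g = dag f := by rw [← dag_add, sub_add_cancel]
  rw [← h, add_sub_cancel_right]

lemma dag_sum {ι : Type*} (s : Finset ι) {Y Z : C} (f : ι → (Y ⟶ Z)) :
    dag (∑ i ∈ s, f i) = ∑ i ∈ s, dag (f i) := by
  classical
  induction s using Finset.induction_on with
  | empty => simp [dag_zero]
  | insert a s ha ih => rw [Finset.sum_insert ha, Finset.sum_insert ha, dag_add, ih]

lemma comp_dag_eq_zero {Y Z : C} {f : Y ⟶ Z} (h : f ≫ dag f = 0) : f = 0 := by
  have h1 := nrm_comp_dag f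
  rw [h, (nrm_eq_zero (0 : Y ⟶ Y)).2 rfl] at h1
  exact (nrm_eq_zero f).1 (pow_eq_zero_iff two_ne_zero |>.1 h1.symm)

instance finiteDimensional_hom' (Y Z : C) : FiniteDimensional ℂ (Y ⟶ Z) :=
  IsFusion.finiteDimensional_hom Y Z

/-- Schur's lemma: an endomorphism of a simple object is a scalar. -/
lemma exists_smul_id {T : C} [Simple T] (f : T ⟶ T) : ∃ c : ℂ, c • 𝟙 T = f :=
  endomorphism_simple_eq_smul_id ℂ f

/-- By positivity the composite is `g ≫ dag g` for an endomorphism `g`, which Schur's lemma makes a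
scalar. -/
lemma exists_comp_dag_eq {T Z : C} [Simple T] (f : T ⟶ Z) :
    ∃ r : ℝ, 0 ≤ r ∧ f ≫ dag f = (r : ℂ) • 𝟙 T := by
  obtain ⟨g, hg⟩ := comp_dag_pos f
  obtain ⟨c, rfl⟩ := exists_smul_id g
  refine ⟨‖c‖ ^ 2, sq_nonneg _, ?_⟩
  rw [hg, dag_smul, dag_id, Linear.smul_comp, Linear.comp_smul, Category.comp_id, smul_smul]
  congr 1
  rw [RCLike.star_def, Complex.mul_conj, Complex.normSq_eq_norm_sq]

/-- A nonzero morphism out of a simple object can be rescaled to an isometry. -/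
lemma exists_isometry_smul {T Z : C} [Simple T] {f : T ⟶ Z} (hf : f ≠ 0) :
    ∃ c : ℂ, (c • f) ≫ dag (c • f) = 𝟙 T := by
  obtain ⟨r, hr, h⟩ := exists_comp_dag_eq f
  have hr0 : r ≠ 0 := by
    rintro rfl
    exact hf (comp_dag_eq_zero (by simpa using h))
  refine ⟨((√r)⁻¹ : ℝ), ?_⟩
  rw [dag_smul, Linear.smul_comp, Linear.comp_smul, h, smul_smul, smul_smul]
  have h1 : ((((√r)⁻¹ : ℝ) : ℂ) * (star (((√r)⁻¹ : ℝ) : ℂ) * (r : ℂ))) = 1 := by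
    rw [RCLike.star_def, Complex.conj_ofReal]
    norm_cast
    rw [← mul_assoc, ← mul_inv, Real.mul_self_sqrt hr, inv_mul_cancel₀ hr0]
  rw [mul_assoc, h1, one_smul]

/-- The scalar by which an endomorphism of a simple object acts. -/
noncomputable def scal (T : C) [Simple T] : (T ⟶ T) →ₗ[ℂ] ℂ where
  toFun f := (exists_smul_id f).choose
  map_add' f g := by
    refine smul_left_injective ℂ (id_nonzero T) ?_
    change (exists_smul_id (f + g)).choose • 𝟙 T = (_ + _ : ℂ) • 𝟙 T
    rw [add_smul, (exists_smul_id (f + g)).choose_spec, (exists_smul_id f).choose_spec,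
      (exists_smul_id g).choose_spec]
  map_smul' c f := by
    refine smul_left_injective ℂ (id_nonzero T) ?_
    change (exists_smul_id (c • f)).choose • 𝟙 T = (_ • _ : ℂ) • 𝟙 T
    rw [smul_assoc, (exists_smul_id (c • f)).choose_spec, (exists_smul_id f).choose_spec]
    rfl

lemma scal_smul_id {T : C} [Simple T] (f : T ⟶ T) : scal T f • 𝟙 T = f :=
  (exists_smul_id f).choose_spec

lemma scal_eq {T : C} [Simple T] {f : T ⟶ T} {c : ℂ} (h : f = c • 𝟙 T) : scal T f = c := by
  refine smul_left_injective ℂ (id_nonzero T) ?_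
  change scal T f • 𝟙 T = c • 𝟙 T
  rw [scal_smul_id, h]

/-- If `f` is nonzero it is invertible, and then `g` is a multiple of its inverse. -/
lemma scal_comp_comm {S T : C} [Simple S] [Simple T] (f : S ⟶ T) (g : T ⟶ S) :
    scal S (f ≫ g) = scal T (g ≫ f) := by
  by_cases hf : f = 0
  · simp [hf]
  have := isIso_of_hom_simple hf
  refine (scal_eq ?_).symm
  have h1 : g = scal S (f ≫ g) • inv f := by
    rw [← cancel_epi f, Linear.comp_smul, IsIso.hom_inv_id, scal_smul_id]
  conv_lhs => rw [h1, Linear.smul_comp, IsIso.inv_hom_id]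

lemma scal_comp_dag_nonneg {T Z : C} [Simple T] (f : T ⟶ Z) : 0 ≤ scal T (f ≫ dag f) := by
  obtain ⟨r, hr, h⟩ := exists_comp_dag_eq f
  rw [scal_eq h]
  exact_mod_cast hr

lemma nrm_id (T : C) [Simple T] : nrm (𝟙 T) = 1 := by
  have h := nrm_comp_dag (𝟙 T)
  rw [dag_id, Category.comp_id] at h
  have h0 : nrm (𝟙 T) ≠ 0 := fun h => id_nonzero T ((nrm_eq_zero _).1 h)
  have : nrm (𝟙 T) * (nrm (𝟙 T) - 1) = 0 := by linear_combination -h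
  rcases mul_eq_zero.1 this with h | h
  · exact absurd h h0
  · linarith

lemma nrm_dag {Y Z : C} (f : Y ⟶ Z) : nrm (dag f) = nrm f := by
  have key : ∀ {Y Z : C} (f : Y ⟶ Z), nrm f ≤ nrm (dag f) := fun f => by
    rcases (nrm_nonneg f).eq_or_lt with h | h
    · rw [← h]; exact nrm_nonneg _
    · have := nrm_comp_le f (dag f)
      rw [nrm_comp_dag, sq] at this
      exact le_of_mul_le_mul_left this h
  refine le_antisymm ?_ (key f)
  have := key (dag f)
  rwa [dag_dag] at this

lemma norm_scal {T : C} [Simple T] (f : T ⟶ T) : ‖scal T f‖ = nrm f := by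
  conv_rhs => rw [← scal_smul_id f, nrm_smul, nrm_id, mul_one]

/-- The objects `S i` are simple and the `v i : S i ⟶ Z` are isometries with orthogonal ranges. -/
structure IsOrthonormal {Z : C} {m : ℕ} {S : Fin m → C} (v : ∀ i, S i ⟶ Z) : Prop where
  simple : ∀ i, Simple (S i)
  isometry : ∀ i, v i ≫ dag (v i) = 𝟙 (S i)
  orthogonal : ∀ i j, i ≠ j → v i ≫ dag (v j) = 0

/-- An orthonormal family whose ranges span: an orthogonal decomposition into simple objects. -/
structure IsOrthDecomp {Z : C} {m : ℕ} {S : Fin m → C} (v : ∀ i, S i ⟶ Z) : Prop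
    extends IsOrthonormal v where
  complete : ∑ i, dag (v i) ≫ v i = 𝟙 Z

namespace IsOrthonormal

variable {Z : C} {m : ℕ} {S : Fin m → C} {v : ∀ i, S i ⟶ Z}

lemma comp_sum (h : IsOrthonormal v) (c : Fin m → ℂ) (j : Fin m) :
    v j ≫ ∑ i, c i • (dag (v i) ≫ v i) = c j • v j := by
  rw [Preadditive.comp_sum, Finset.sum_eq_single j]
  · rw [Linear.comp_smul, ← Category.assoc, h.isometry, Category.id_comp]
  · intro i _ hij
    rw [Linear.comp_smul, ← Category.assoc, h.orthogonal j i hij.symm, Limits.zero_comp, smul_zero]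
  · simp

lemma ne_zero (h : IsOrthonormal v) (j : Fin m) : v j ≠ 0 := fun h0 => by
  have := h.simple j
  have h1 := h.isometry j
  rw [h0, Limits.zero_comp] at h1
  exact id_nonzero (S j) h1.symm

lemma linearIndependent (h : IsOrthonormal v) :
    LinearIndependent ℂ fun i => dag (v i) ≫ v i := by
  rw [Fintype.linearIndependent_iff]
  intro c hc j
  have h1 := h.comp_sum c j
  rw [hc, Limits.comp_zero] at h1
  exact (smul_eq_zero.1 h1.symm).resolve_right (h.ne_zero j)

/-- Bounds the number of simple summands; it also makes the extension process below terminate. -/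
lemma card_le (h : IsOrthonormal v) : m ≤ Module.finrank ℂ (Z ⟶ Z) := by
  have := h.linearIndependent.fintype_card_le_finrank
  simpa using this

end IsOrthonormal

/-- Morphisms out of an object are detected on its simple subobjects. -/
lemma exists_simple_comp_ne_zero {Z W : C} {q : Z ⟶ W} (hq : q ≠ 0) :
    ∃ (T : C) (_ : Simple T) (f : T ⟶ Z), f ≫ q ≠ 0 := by
  obtain ⟨n, S, hS, ⟨e⟩⟩ := IsFusion.semisimple Z
  by_contra! hcon
  refine hq ?_
  rw [← cancel_epi e.inv, Limits.comp_zero]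
  refine Limits.biproduct.hom_ext' _ _ fun i => ?_
  rw [Limits.comp_zero, ← Category.assoc]
  exact hcon (S i) (hS i) _

/-- An orthonormal family that does not span can be enlarged: a simple object maps nontrivially
through the complementary projection, and that map is rescaled to an isometry. The dimension of `End
Z` bounds this process. -/
lemma exists_isOrthDecomp (Z : C) :
    ∃ (m : ℕ) (S : Fin m → C) (v : ∀ i, S i ⟶ Z), IsOrthDecomp v := by
  by_contra! hcon
  have key : ∀ m : ℕ, ∃ (S : Fin m → C) (v : ∀ i, S i ⟶ Z), IsOrthonormal v := by
    intro m
    induction m with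
    | zero => exact ⟨Fin.elim0, fun i => i.elim0, ⟨fun i => i.elim0, fun i => i.elim0,
        fun i => i.elim0⟩⟩
    | succ m ih =>
      obtain ⟨S, v, hv⟩ := ih
      set q : Z ⟶ Z := 𝟙 Z - ∑ i, dag (v i) ≫ v i with hq
      have hq0 : q ≠ 0 := fun h0 => hcon m S v ⟨hv, (sub_eq_zero.1 h0).symm⟩
      have hqv : ∀ j, q ≫ dag (v j) = 0 := by
        intro j
        have h1 := congrArg dag (hv.comp_sum (fun _ => 1) j)
        simp only [one_smul, dag_comp, dag_sum, dag_dag] at h1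
        rw [hq, Preadditive.sub_comp, Category.id_comp, h1, sub_self]
      obtain ⟨T, hT, f, hf⟩ := exists_simple_comp_ne_zero hq0
      obtain ⟨c, hc⟩ := exists_isometry_smul hf
      have hgv : ∀ j, (c • (f ≫ q)) ≫ dag (v j) = 0 := fun j => by
        rw [Linear.smul_comp, Category.assoc, hqv, Limits.comp_zero, smul_zero]
      have hvg : ∀ j, v j ≫ dag (c • (f ≫ q)) = 0 := fun j => by
        have := congrArg dag (hgv j)
        rwa [dag_comp, dag_dag, dag_zero] at this
      refine ⟨Fin.cons T S, Fin.cons (α := fun i => (Fin.cons T S : Fin (m + 1) → C) i ⟶ Z)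
        (c • (f ≫ q)) v, ?_, ?_, ?_⟩
      · intro i
        refine Fin.cases ?_ (fun i => ?_) i
        · exact hT
        · exact hv.simple i
      · intro i
        refine Fin.cases ?_ (fun i => ?_) i
        · exact hc
        · exact hv.isometry i
      · intro i j
        refine Fin.cases ?_ (fun i => ?_) i <;> refine Fin.cases ?_ (fun j => ?_) j
        · exact fun h => absurd rfl h
        · exact fun _ => hgv j
        · exact fun _ => hvg i
        · exact fun h => hv.orthogonal i j fun e => h (by rw [e])
  obtain ⟨S, v, hv⟩ := key (Module.finrank ℂ (Z ⟶ Z) + 1)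
  have := hv.card_le
  omega

/-- A positive trace on the endomorphism algebra of an object. -/
structure IsEndTrace {Z : C} (σ : (Z ⟶ Z) →ₗ[ℂ] ℂ) : Prop where
  nonneg : ∀ f : Z ⟶ Z, 0 ≤ σ (f ≫ dag f)
  comm : ∀ f g : Z ⟶ Z, σ (f ≫ g) = σ (g ≫ f)

lemma IsOrthDecomp.id_eq_zero {Z : C} {S : Fin 0 → C} {v : ∀ i, S i ⟶ Z}
    (h : IsOrthDecomp v) : 𝟙 Z = 0 := by
  rw [← h.complete, Finset.univ_eq_empty, Finset.sum_empty]

/-- Every nonzero object has a normalized positive trace, bounded by the norm. -/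
lemma exists_isEndTrace {Z : C} (hZ : 𝟙 Z ≠ 0) :
    ∃ σ : (Z ⟶ Z) →ₗ[ℂ] ℂ, IsEndTrace σ ∧ σ (𝟙 Z) = 1 ∧ ∀ f, ‖σ f‖ ≤ nrm f := by
  obtain ⟨m, S, v, h⟩ := exists_isOrthDecomp Z
  have := h.simple
  have hm : (m : ℂ) ≠ 0 := by
    rintro h0
    obtain rfl : m = 0 := by exact_mod_cast h0
    exact hZ h.id_eq_zero
  -- The trace is the unweighted average of the diagonal scalars. Traciality follows by inserting
  -- the decomposition of the identity and exchanging factors between simple objects.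
  let σ₀ : Fin m → (Z ⟶ Z) →ₗ[ℂ] ℂ := fun j =>
    scal (S j) ∘ₗ Linear.leftComp ℂ (S j) (v j) ∘ₗ Linear.rightComp ℂ Z (dag (v j))
  have hσ₀ : ∀ j f, σ₀ j f = scal (S j) (v j ≫ f ≫ dag (v j)) := fun j f => rfl
  have hσ : ∀ f, ((m : ℂ)⁻¹ • ∑ j, σ₀ j) f =
      (m : ℂ)⁻¹ * ∑ j, scal (S j) (v j ≫ f ≫ dag (v j)) := fun f => by
    rw [LinearMap.smul_apply, LinearMap.sum_apply, smul_eq_mul]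
    rfl
  refine ⟨(m : ℂ)⁻¹ • ∑ j, σ₀ j, ⟨fun f => ?_, fun f g => ?_⟩, ?_, fun f => ?_⟩
  · rw [hσ]
    refine mul_nonneg ?_ (Finset.sum_nonneg fun j _ => ?_)
    · rw [← Complex.ofReal_natCast, ← Complex.ofReal_inv]
      exact_mod_cast inv_nonneg.2 (Nat.cast_nonneg m)
    · have := scal_comp_dag_nonneg (v j ≫ f)
      simpa only [dag_comp, Category.assoc] using this
  · rw [hσ, hσ]
    congr 1
    have key : ∀ f g : Z ⟶ Z, ∀ j, scal (S j) (v j ≫ (f ≫ g) ≫ dag (v j)) =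
        ∑ k, scal (S j) ((v j ≫ f ≫ dag (v k)) ≫ (v k ≫ g ≫ dag (v j))) := by
      intro f g j
      rw [← map_sum]
      congr 1
      have e : ∀ k, (v j ≫ f ≫ dag (v k)) ≫ (v k ≫ g ≫ dag (v j)) =
          (v j ≫ f) ≫ (dag (v k) ≫ v k) ≫ (g ≫ dag (v j)) := fun k => by
        simp only [Category.assoc]
      simp only [e]
      rw [← Preadditive.comp_sum, ← Preadditive.sum_comp, h.complete]
      simp
    simp only [key]
    rw [Finset.sum_comm]
    exact Finset.sum_congr rfl fun k _ => Finset.sum_congr rfl fun j _ => scal_comp_comm _ _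
  · rw [hσ]
    have : ∀ j, scal (S j) (v j ≫ 𝟙 Z ≫ dag (v j)) = 1 := fun j => scal_eq (by
      rw [Category.id_comp, h.isometry, one_smul])
    simp only [this, Finset.sum_const, Finset.card_univ, Fintype.card_fin, nsmul_eq_mul, mul_one]
    exact inv_mul_cancel₀ hm
  · rw [hσ, norm_mul, norm_inv, Complex.norm_natCast]
    have hm' : (0 : ℝ) < m := by
      have : m ≠ 0 := by exact_mod_cast hm
      exact_mod_cast Nat.pos_of_ne_zero this
    rw [inv_mul_le_iff₀ hm']
    refine (norm_sum_le _ _).trans ?_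
    refine (Finset.sum_le_card_nsmul _ _ (nrm f) fun j _ => ?_).trans (by simp)
    have hv : nrm (v j) = 1 := by
      have h1 := nrm_comp_dag (v j)
      rw [h.isometry, nrm_id] at h1
      have := nrm_nonneg (v j)
      nlinarith
    rw [norm_scal]
    refine (nrm_comp_le _ _).trans ?_
    rw [hv, one_mul]
    refine (nrm_comp_le _ _).trans ?_
    rw [nrm_dag, hv, mul_one]

end Decomposition

/-! ### A Harnack inequality for traces -/

section Harnack

open CStarCategory

universe v u

variable {C : Type u} [Category.{v} C] [Abelian C] [Linear ℂ C] [MonoidalCategory C]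
  [MonoidalPreadditive C] [MonoidalLinear ℂ C] [RigidCategory C] [UnitaryFusionCategory C]

/-- Every simple object is a direct summand of `Q`. -/
def ContainsSimples (Q : C) : Prop :=
  ∀ S : C, Simple S → ∃ (i : S ⟶ Q) (r : Q ⟶ S), i ≫ r = 𝟙 S

lemma exists_retraction {T Z : C} [Simple T] {f : T ⟶ Z} (hf : f ≠ 0) :
    ∃ r : Z ⟶ T, f ≫ r = 𝟙 T := by
  obtain ⟨c, hc⟩ := exists_isometry_smul hf
  refine ⟨c • dag (c • f), ?_⟩
  rw [Linear.comp_smul, ← Linear.smul_comp, hc]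

-- A vanishing coevaluation would annihilate the identity of `S` through the zigzag identity.
set_option linter.unusedSectionVars false in
lemma coevaluation_ne_zero (S : C) [Simple S] : η_ (ᘁS) S ≠ 0 := by
  intro h
  have h1 := ExactPairing.coevaluation_evaluation (ᘁS) S
  rw [h] at h1
  simp only [MonoidalPreadditive.whiskerLeft_zero, Limits.zero_comp] at h1
  refine id_nonzero S ?_
  rw [← cancel_epi (ρ_ S).hom, ← cancel_mono (λ_ S).inv]
  simpa using h1.symm

/-- Every simple object embeds in the tensor product of `Q` with any simple object. -/
lemma ContainsSimples.exists_isometry {Q : C} (hQ : ContainsSimples Q) (T S : C) [Simple T]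
    [Simple S] : ∃ s : T ⟶ Q ⊗ S, s ≫ dag s = 𝟙 T := by
  suffices h : ∃ s : T ⟶ Q ⊗ S, s ≠ 0 by
    obtain ⟨s, hs⟩ := h
    obtain ⟨c, hc⟩ := exists_isometry_smul hs
    exact ⟨_, hc⟩
  by_contra! hcon
  have : Simple (𝟙_ C) := IsFusion.simple_unit
  obtain ⟨r, hr⟩ := exists_retraction (coevaluation_ne_zero S)
  obtain ⟨m, U, v, hv⟩ := exists_isOrthDecomp (T ⊗ ᘁS)
  have hU := hv.simple
  -- If `T` had no map to `Q ⊗ S`, then `g` would vanish on each summand of `T ⊗ ᘁS`, as each embeds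
  -- in `Q`. But `g` is split, because the nonzero coevaluation out of the simple unit is.
  set g : T ⟶ (T ⊗ ᘁS) ⊗ S := (ρ_ T).inv ≫ T ◁ η_ (ᘁS) S ≫ (α_ T (ᘁS) S).inv with hg
  have hl : ∀ l, g ≫ (dag (v l) ≫ v l) ▷ S = 0 := by
    intro l
    obtain ⟨i, r, hir⟩ := hQ (U l) (hU l)
    have h1 := hcon (g ≫ dag (v l) ▷ S ≫ i ▷ S)
    have h2 : g ≫ (dag (v l) ≫ v l) ▷ S = (g ≫ dag (v l) ▷ S ≫ i ▷ S) ≫ r ▷ S ≫ v l ▷ S := by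
      have h3 : dag (v l) ≫ v l = dag (v l) ≫ i ≫ r ≫ v l := by
        rw [← Category.assoc i r, hir, Category.id_comp]
      rw [h3]
      simp only [Category.assoc, comp_whiskerRight]
    rw [h2, h1, Limits.zero_comp]
  have hg0 : g = 0 := by
    have h1 : g ≫ (∑ l, dag (v l) ≫ v l) ▷ S = 0 := by
      rw [sum_whiskerRight, Preadditive.comp_sum]
      exact Finset.sum_eq_zero fun l _ => hl l
    rwa [hv.complete, id_whiskerRight, Category.comp_id] at h1
  refine id_nonzero T ?_
  have h3 : g ≫ (α_ T (ᘁS) S).hom ≫ T ◁ r ≫ (ρ_ T).hom = 𝟙 T := by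
    rw [hg]
    simp only [Category.assoc, Iso.inv_hom_id_assoc, ← whiskerLeft_comp_assoc, hr]
    simp
  rw [← h3, hg0, Limits.zero_comp]

/-- A bound for the number of simple summands of `Q ⊗ S`, uniform in the simple object `S`. -/
lemma exists_finrank_bound (Q : C) : ∃ K : ℕ, 1 ≤ K ∧ ∀ S : C, Simple S →
    Module.finrank ℂ (Q ⊗ S ⟶ Q ⊗ S) ≤ K := by
  obtain ⟨n, R, hR⟩ := IsFusion.finitely_many_simples (C := C)
  refine ⟨∑ i, Module.finrank ℂ (Q ⊗ R i ⟶ Q ⊗ R i) + 1, by omega, fun S hS => ?_⟩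
  obtain ⟨i, ⟨e⟩⟩ := hR S hS
  have h1 : Module.finrank ℂ (Q ⊗ S ⟶ Q ⊗ S) = Module.finrank ℂ (Q ⊗ R i ⟶ Q ⊗ R i) :=
    LinearEquiv.finrank_eq (Linear.homCongr ℂ (whiskerLeftIso Q e) (whiskerLeftIso Q e))
  have h2 := Finset.single_le_sum (f := fun i => Module.finrank ℂ (Q ⊗ R i ⟶ Q ⊗ R i))
    (fun i _ => Nat.zero_le _) (Finset.mem_univ i)
  rw [h1]
  exact h2.trans (Nat.le_succ _)

namespace IsEndTrace

variable {Z : C} {σ : (Z ⟶ Z) →ₗ[ℂ] ℂ}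

lemma nonneg_of_projection (hσ : IsEndTrace σ) {e : Z ⟶ Z} (he : dag e = e) (he' : e ≫ e = e) :
    0 ≤ σ e := by
  have := hσ.nonneg e
  rwa [he, he'] at this

/-- Range projections of isometries with the same source have the same trace. -/
lemma isometry_eq (hσ : IsEndTrace σ) {T : C} {f g : T ⟶ Z} (hf : f ≫ dag f = 𝟙 T)
    (hg : g ≫ dag g = 𝟙 T) : σ (dag f ≫ f) = σ (dag g ≫ g) := by
  have h := hσ.comm (dag f ≫ g) (dag g ≫ f)
  have h1 : (dag f ≫ g) ≫ dag g ≫ f = dag f ≫ f := by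
    rw [Category.assoc, ← Category.assoc g, hg, Category.id_comp]
  have h2 : (dag g ≫ f) ≫ dag f ≫ g = dag g ≫ g := by
    rw [Category.assoc, ← Category.assoc f, hf, Category.id_comp]
  rwa [h1, h2] at h

/-- The range projection of a subobject has smaller trace. -/
lemma comp_isometry_le (hσ : IsEndTrace σ) {T Y : C} {s : T ⟶ Y} {w : Y ⟶ Z}
    (hs : s ≫ dag s = 𝟙 T) (hw : w ≫ dag w = 𝟙 Y) :
    σ (dag (s ≫ w) ≫ s ≫ w) ≤ σ (dag w ≫ w) := by
  rw [← sub_nonneg, ← map_sub]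
  have hw' : ∀ {V : C} (x : Y ⟶ V), w ≫ dag w ≫ x = x := fun x => by
    rw [← Category.assoc, hw, Category.id_comp]
  have hs' : ∀ {V : C} (x : T ⟶ V), s ≫ dag s ≫ x = x := fun x => by
    rw [← Category.assoc, hs, Category.id_comp]
  refine hσ.nonneg_of_projection ?_ ?_
  · simp only [dag_sub, dag_comp, dag_dag, Category.assoc]
  · simp only [dag_comp, Preadditive.sub_comp, Preadditive.comp_sub, Category.assoc, hw', hs']
    simp

end IsEndTrace

/-- The traces of `1 ⊗ p` and `1 ⊗ q` are comparable for minimal projections `p`, `q`. -/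
lemma IsEndTrace.minimal_le {Q Z : C} (hQ : ContainsSimples Q) {K : ℕ}
    (hK : ∀ S : C, Simple S → Module.finrank ℂ (Q ⊗ S ⟶ Q ⊗ S) ≤ K)
    {σ : (Q ⊗ Z ⟶ Q ⊗ Z) →ₗ[ℂ] ℂ} (hσ : IsEndTrace σ) {S S' : C} [Simple S] [Simple S']
    {f : S ⟶ Z} {g : S' ⟶ Z} (hf : f ≫ dag f = 𝟙 S) (hg : g ≫ dag g = 𝟙 S') :
    σ (Q ◁ (dag f ≫ f)) ≤ K * σ (Q ◁ (dag g ≫ g)) := by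
  obtain ⟨m, T, t, ht⟩ := exists_isOrthDecomp (Q ⊗ S)
  have hT := ht.simple
  have hm : m ≤ K := ht.card_le.trans (hK S inferInstance)
  have hQf : (Q ◁ f) ≫ dag (Q ◁ f) = 𝟙 (Q ⊗ S) := by
    rw [dag_whiskerLeft, ← whiskerLeft_comp, hf, whiskerLeft_id]
  have hQg : (Q ◁ g) ≫ dag (Q ◁ g) = 𝟙 (Q ⊗ S') := by
    rw [dag_whiskerLeft, ← whiskerLeft_comp, hg, whiskerLeft_id]
  have hgg : dag (Q ◁ g) ≫ Q ◁ g = Q ◁ (dag g ≫ g) := by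
    rw [dag_whiskerLeft, whiskerLeft_comp]
  have hcomp : ∀ {T Y Z : C} {s : T ⟶ Y} {w : Y ⟶ Z}, s ≫ dag s = 𝟙 T → w ≫ dag w = 𝟙 Y →
      (s ≫ w) ≫ dag (s ≫ w) = 𝟙 T := fun {T Y Z s w} hs hw => by
    rw [dag_comp, Category.assoc, ← Category.assoc w, hw, Category.id_comp, hs]
  -- Each simple summand of `Q ⊗ S` also embeds in `Q ⊗ S'`, and the trace of a range projection
  -- depends only on the source of the isometry.
  have hle : ∀ l, σ (dag (t l ≫ Q ◁ f) ≫ t l ≫ Q ◁ f) ≤ σ (Q ◁ (dag g ≫ g)) := by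
    intro l
    obtain ⟨s, hs⟩ := hQ.exists_isometry (T l) S'
    rw [hσ.isometry_eq (hcomp (ht.isometry l) hQf) (hcomp hs hQg), ← hgg]
    exact hσ.comp_isometry_le hs hQg
  have hsum : Q ◁ (dag f ≫ f) = ∑ l, dag (t l ≫ Q ◁ f) ≫ t l ≫ Q ◁ f := by
    have e : ∀ l, dag (t l ≫ Q ◁ f) ≫ t l ≫ Q ◁ f =
        dag (Q ◁ f) ≫ (dag (t l) ≫ t l) ≫ Q ◁ f := fun l => by
      simp only [dag_comp, Category.assoc]
    simp only [e]
    rw [← Preadditive.comp_sum, ← Preadditive.sum_comp, ht.complete, Category.id_comp,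
      dag_whiskerLeft, whiskerLeft_comp]
  have h0 : 0 ≤ σ (Q ◁ (dag g ≫ g)) := by
    rw [← hgg]
    refine hσ.nonneg_of_projection ?_ ?_
    · simp only [dag_comp, dag_dag]
    · rw [Category.assoc, ← Category.assoc (Q ◁ g), hQg, Category.id_comp]
  rw [hsum, map_sum]
  refine (Finset.sum_le_card_nsmul _ _ _ fun l _ => hle l).trans ?_
  rw [Finset.card_univ, Fintype.card_fin, nsmul_eq_mul]
  refine mul_le_mul_of_nonneg_right ?_ h0
  exact_mod_cast hm

section Expansion

variable {Q Z : C} {σ : (Q ⊗ Z ⟶ Q ⊗ Z) →ₗ[ℂ] ℂ} {m : ℕ} {S : Fin m → C} {v : ∀ i, S i ⟶ Z}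

/-- By cyclicity only the diagonal compressions of `f` matter, and these are scalars. A trace on `1
⊗ End Z` is thus encoded by its weights on minimal projections. -/
lemma IsEndTrace.apply_whiskerLeft (hσ : IsEndTrace σ) (hv : IsOrthDecomp v) (f : Z ⟶ Z)
    [∀ i, Simple (S i)] :
    σ (Q ◁ f) = ∑ j, scal (S j) (v j ≫ f ≫ dag (v j)) * σ (Q ◁ (dag (v j) ≫ v j)) := by
  have h1 : f = ∑ j, (dag (v j) ≫ v j) ≫ f := by
    rw [← Preadditive.sum_comp, hv.complete, Category.id_comp]
  conv_lhs => rw [h1, whiskerLeft_sum, map_sum]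
  refine Finset.sum_congr rfl fun j _ => ?_
  have h2 : Q ◁ ((dag (v j) ≫ v j) ≫ f) =
      Q ◁ (dag (v j) ≫ v j) ≫ Q ◁ ((dag (v j) ≫ v j) ≫ f) := by
    rw [← whiskerLeft_comp]
    congr 1
    rw [Category.assoc, Category.assoc, ← Category.assoc (v j) (dag (v j)), hv.isometry,
      Category.id_comp]
  have h3 : Q ◁ ((dag (v j) ≫ v j) ≫ f) ≫ Q ◁ (dag (v j) ≫ v j) =
      scal (S j) (v j ≫ f ≫ dag (v j)) • (Q ◁ (dag (v j) ≫ v j)) := by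
    rw [← whiskerLeft_comp, ← MonoidalLinear.whiskerLeft_smul]
    congr 1
    have h4 : ((dag (v j) ≫ v j) ≫ f) ≫ dag (v j) ≫ v j =
        dag (v j) ≫ (v j ≫ f ≫ dag (v j)) ≫ v j := by simp only [Category.assoc]
    rw [h4]
    conv_lhs => rw [← scal_smul_id (v j ≫ f ≫ dag (v j))]
    rw [Linear.smul_comp, Linear.comp_smul, Category.id_comp]
  rw [h2, hσ.comm, h3, map_smul, smul_eq_mul]

lemma IsEndTrace.sum_eq_one (hv : IsOrthDecomp v) (h1 : σ (𝟙 _) = 1) :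
    ∑ j, σ (Q ◁ (dag (v j) ≫ v j)) = 1 := by
  rw [← map_sum, ← whiskerLeft_sum, hv.complete, whiskerLeft_id, h1]

lemma IsEndTrace.minimal_nonneg (hσ : IsEndTrace σ) {T : C} {f : T ⟶ Z} (hf : f ≫ dag f = 𝟙 T) :
    0 ≤ σ (Q ◁ (dag f ≫ f)) := by
  refine hσ.nonneg_of_projection ?_ ?_
  · simp only [dag_whiskerLeft, dag_comp, dag_dag]
  · rw [← whiskerLeft_comp, Category.assoc, ← Category.assoc f, hf, Category.id_comp]

/-- Any two normalized traces are comparable on `1 ⊗ End Z`, with a constant that does not depend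
on `Z`. -/
theorem IsEndTrace.harnack (hQ : ContainsSimples Q) {K : ℕ}
    (hK : ∀ S : C, Simple S → Module.finrank ℂ (Q ⊗ S ⟶ Q ⊗ S) ≤ K)
    (hσ : IsEndTrace σ) (h1 : σ (𝟙 _) = 1)
    {σ' : (Q ⊗ Z ⟶ Q ⊗ Z) →ₗ[ℂ] ℂ} (hσ' : IsEndTrace σ') (h1' : σ' (𝟙 _) = 1) (f : Z ⟶ Z) :
    σ (Q ◁ (f ≫ dag f)) ≤ (K ^ 2 : ℕ) * σ' (Q ◁ (f ≫ dag f)) := by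
  obtain ⟨m, S, v, hv⟩ := exists_isOrthDecomp Z
  have hS := hv.simple
  -- Multiply by the total weight one of `σ'`, exchange `j` and `k` at the cost of one factor `K`
  -- for each trace, and sum the weights of `σ` to one.
  have key : ∀ j, σ (Q ◁ (dag (v j) ≫ v j)) ≤ (K ^ 2 : ℕ) * σ' (Q ◁ (dag (v j) ≫ v j)) := by
    intro j
    have hj := hσ.minimal_nonneg (hv.isometry j)
    calc σ (Q ◁ (dag (v j) ≫ v j))
        = ∑ k, σ (Q ◁ (dag (v j) ≫ v j)) * σ' (Q ◁ (dag (v k) ≫ v k)) := by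
          rw [← Finset.mul_sum, IsEndTrace.sum_eq_one hv h1', mul_one]
      _ ≤ ∑ k, (K * σ (Q ◁ (dag (v k) ≫ v k))) * (K * σ' (Q ◁ (dag (v j) ≫ v j))) :=
          Finset.sum_le_sum fun k _ => mul_le_mul
            (hσ.minimal_le hQ hK (hv.isometry j) (hv.isometry k))
            (hσ'.minimal_le hQ hK (hv.isometry k) (hv.isometry j))
            (hσ'.minimal_nonneg (hv.isometry k))
            (mul_nonneg (by exact_mod_cast Nat.zero_le K) (hσ.minimal_nonneg (hv.isometry k)))
      _ = (K ^ 2 : ℕ) * σ' (Q ◁ (dag (v j) ≫ v j)) := by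
          rw [← Finset.sum_mul, ← Finset.mul_sum, IsEndTrace.sum_eq_one hv h1]
          push_cast
          ring
  rw [hσ.apply_whiskerLeft hv, hσ'.apply_whiskerLeft hv, Finset.mul_sum]
  refine Finset.sum_le_sum fun j _ => ?_
  have h0 : 0 ≤ scal (S j) (v j ≫ (f ≫ dag f) ≫ dag (v j)) := by
    have := scal_comp_dag_nonneg (v j ≫ f)
    simpa only [dag_comp, Category.assoc] using this
  calc _ ≤ scal (S j) (v j ≫ (f ≫ dag f) ≫ dag (v j)) *
        ((K ^ 2 : ℕ) * σ' (Q ◁ (dag (v j) ≫ v j))) := mul_le_mul_of_nonneg_left (key j) h0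
    _ = _ := by ring

/-- A normalized trace is faithful on `1 ⊗ End Z`. -/
theorem IsEndTrace.faithful (hQ : ContainsSimples Q) (hσ : IsEndTrace σ) (h1 : σ (𝟙 _) = 1)
    {f : Z ⟶ Z} (hf : σ (Q ◁ (f ≫ dag f)) = 0) : f = 0 := by
  obtain ⟨K, -, hK⟩ := exists_finrank_bound Q
  obtain ⟨m, S, v, hv⟩ := exists_isOrthDecomp Z
  have hS := hv.simple
  -- The weights are mutually comparable and sum to one, so one vanishing weight would make all of
  -- them vanish.
  have hpos : ∀ j, σ (Q ◁ (dag (v j) ≫ v j)) ≠ 0 := by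
    intro j hj
    have h2 := IsEndTrace.sum_eq_one hv h1
    have h3 : ∑ k, σ (Q ◁ (dag (v k) ≫ v k)) ≤ 0 := Finset.sum_nonpos fun k _ => by
      have := hσ.minimal_le hQ hK (hv.isometry k) (hv.isometry j)
      rwa [hj, mul_zero] at this
    rw [h2] at h3
    exact absurd h3 (by norm_num)
  rw [hσ.apply_whiskerLeft hv, Finset.sum_eq_zero_iff_of_nonneg] at hf
  · have hvf : ∀ j, v j ≫ f = 0 := fun j => by
      have h2 := (mul_eq_zero.1 (hf j (Finset.mem_univ j))).resolve_right (hpos j)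
      refine comp_dag_eq_zero ?_
      have h3 := scal_smul_id (v j ≫ (f ≫ dag f) ≫ dag (v j))
      rw [h2, zero_smul] at h3
      rw [dag_comp]
      simpa only [Category.assoc] using h3.symm
    rw [← Category.id_comp f, ← hv.complete, Preadditive.sum_comp]
    refine Finset.sum_eq_zero fun j _ => ?_
    rw [Category.assoc, hvf, Limits.comp_zero]
  · intro j _
    refine mul_nonneg ?_ (hσ.minimal_nonneg (hv.isometry j))
    have := scal_comp_dag_nonneg (v j ≫ f)
    simpa only [dag_comp, Category.assoc] using this

end Expansion

end Harnack

/-! ### Uniqueness of traces from comparability -/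

section Iteration

variable {D : Type*} [Ring D] [StarRing D] [Algebra ℂ D]

/-- If any two normalized traces are comparable, with a uniform constant, then they agree. -/
theorem eq_of_comparable {K : ℝ} (hK : 1 < K)
    (h : ∀ φ ψ : D →ₗ[ℂ] ℂ, IsTraceFunctional φ → IsTraceFunctional ψ → φ 1 = 1 → ψ 1 = 1 →
      ∀ a, φ (star a * a) ≤ K * ψ (star a * a))
    {φ ψ : D →ₗ[ℂ] ℂ} (hφ : IsTraceFunctional φ) (hψ : IsTraceFunctional ψ) (hφ1 : φ 1 = 1)
    (hψ1 : ψ 1 = 1) (a : D) : φ (star a * a) = ψ (star a * a) := by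
  have hK0 : (0 : ℝ) < K := by linarith
  set t : ℝ := 1 - K⁻¹ with ht
  have ht0 : 0 < t := by rw [ht, sub_pos]; exact inv_lt_one_of_one_lt₀ hK
  have ht1 : t < 1 := by rw [ht]; linarith [inv_pos.2 hK0]
  have htC : (t : ℂ) ≠ 0 := by exact_mod_cast ht0.ne'
  have key : ∀ n : ℕ, ∀ φ ψ : D →ₗ[ℂ] ℂ, IsTraceFunctional φ → IsTraceFunctional ψ → φ 1 = 1 →
      ψ 1 = 1 → ∀ a, ((1 - t ^ n : ℝ) : ℂ) * φ (star a * a) ≤ ψ (star a * a) := by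
    intro n
    induction n with
    | zero =>
      intro φ ψ hφ hψ _ _ a
      simpa using hψ.nonneg a
    | succ n ih =>
      intro φ ψ hφ hψ hφ1 hψ1 a
      -- Comparability makes the remainder positive, and its mass is `t = 1 - K⁻¹`. Applying the
      -- induction hypothesis to the normalized remainder multiplies the error by `t`.
      let χ : D →ₗ[ℂ] ℂ := ((t⁻¹ : ℝ) : ℂ) • (ψ - ((K⁻¹ : ℝ) : ℂ) • φ)
      have hχ : ∀ d, χ d = ((t⁻¹ : ℝ) : ℂ) * (ψ d - ((K⁻¹ : ℝ) : ℂ) * φ d) := fun d => rfl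
      have hχt : IsTraceFunctional χ := by
        refine ⟨fun d => ?_, fun c d => ?_⟩
        · rw [hχ]
          refine mul_nonneg (by exact_mod_cast (inv_pos.2 ht0).le) (sub_nonneg.2 ?_)
          have h1 : (0 : ℂ) ≤ ((K⁻¹ : ℝ) : ℂ) := by exact_mod_cast (inv_pos.2 hK0).le
          have h2 := mul_le_mul_of_nonneg_left (h φ ψ hφ hψ hφ1 hψ1 d) h1
          rwa [← mul_assoc, ← Complex.ofReal_mul, inv_mul_cancel₀ hK0.ne', Complex.ofReal_one,
            one_mul] at h2
        · rw [hχ, hχ, hφ.mul_comm, hψ.mul_comm]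
      have hχ1 : χ 1 = 1 := by
        rw [hχ, hφ1, hψ1, mul_one, ht]
        have : (1 : ℂ) - ((K⁻¹ : ℝ) : ℂ) = (t : ℂ) := by rw [ht]; push_cast; ring
        rw [this, ← ht, Complex.ofReal_inv, inv_mul_cancel₀ htC]
      have h1 := ih φ χ hφ hχt hφ1 hχ1 a
      have ht0' : (0 : ℂ) ≤ (t : ℂ) := by exact_mod_cast ht0.le
      have h2 := mul_le_mul_of_nonneg_left h1 ht0'
      have h3 : (t : ℂ) * χ (star a * a) = ψ (star a * a) - ((K⁻¹ : ℝ) : ℂ) * φ (star a * a) := by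
        rw [hχ, Complex.ofReal_inv, ← mul_assoc, mul_inv_cancel₀ htC, one_mul]
      rw [h3, le_sub_iff_add_le] at h2
      convert h2 using 1
      have h4 : ((K⁻¹ : ℝ) : ℂ) = 1 - (t : ℂ) := by rw [ht]; push_cast; ring
      rw [h4]
      push_cast
      ring
  have hle : ∀ φ ψ : D →ₗ[ℂ] ℂ, IsTraceFunctional φ → IsTraceFunctional ψ → φ 1 = 1 →
      ψ 1 = 1 → ∀ a, φ (star a * a) ≤ ψ (star a * a) := by
    intro φ ψ hφ hψ hφ1 hψ1 a
    have hlim : Filter.Tendsto (fun n : ℕ => ((1 - t ^ n : ℝ) : ℂ) * φ (star a * a)) Filter.atTop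
        (nhds (((1 - 0 : ℝ) : ℂ) * φ (star a * a))) := by
      refine Filter.Tendsto.mul_const _ ?_
      exact (Complex.continuous_ofReal.tendsto _).comp
        ((tendsto_pow_atTop_nhds_zero_of_lt_one ht0.le ht1).const_sub 1)
    have := le_of_tendsto hlim (Filter.Eventually.of_forall fun n => key n φ ψ hφ hψ hφ1 hψ1 a)
    simpa using this
  exact le_antisymm (hle φ ψ hφ hψ hφ1 hψ1 a) (hle ψ φ hψ hφ hψ1 hφ1 a)

end Iteration

/-! ### Existence and uniqueness of traces on spin chains -/

/-- A linear functional on a ⋆-algebra is determined by its values at the elements `a⋆ a`. -/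
lemma LinearMap.eq_of_star_mul_self {D : Type*} [Ring D] [StarRing D] [Algebra ℂ D]
    [StarModule ℂ D] {φ ψ : D →ₗ[ℂ] ℂ} (h : ∀ a, φ (star a * a) = ψ (star a * a)) : φ = ψ := by
  refine LinearMap.ext fun b => ?_
  have h1 := h (1 + b)
  have h2 := h (1 + Complex.I • b)
  have h3 := h 1
  have h4 := h b
  simp only [star_add, star_one, star_smul, add_mul, mul_add, smul_mul_assoc, mul_smul_comm,
    map_add, map_smul, smul_eq_mul, Complex.star_def, Complex.conj_I, one_mul, mul_one] at h1 h2 h3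
  have e1 : φ b + φ (star b) = ψ b + ψ (star b) := by linear_combination h1 - h3 - h4
  have e2 : Complex.I * (φ b - φ (star b)) = Complex.I * (ψ b - ψ (star b)) := by
    have hI := Complex.I_mul_I
    linear_combination h2 - h3 + (φ (star b * b) - ψ (star b * b)) * hI - h4
  have e3 := mul_left_cancel₀ Complex.I_ne_zero e2
  linear_combination (e1 + e3) / 2

namespace AbstractSpinChain

variable {A : Type*} [CStarAlgebra A] (𝔄 : AbstractSpinChain A)

/-- The interval `[-n, n]`. -/
def centered (n : ℕ) : NonemptyInterval ℤ := ⟨(-n, n), by simp only; omega⟩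

lemma eventually_le_centered (I : NonemptyInterval ℤ) :
    ∀ᶠ n in Filter.atTop, I ≤ centered n := by
  filter_upwards [Filter.eventually_ge_atTop (I.fst.natAbs + I.snd.natAbs)] with n hn
  constructor <;> simp only [centered] <;> omega

variable [PartialOrder A] [StarOrderedRing A]

/-- A limit of functionals that are tracial states on larger and larger intervals. -/
theorem exists_isTracialState (h : ∀ I, ∃ g : StrongDual ℂ A, ‖g‖ ≤ 1 ∧ g 1 = 1 ∧
    (∀ a ∈ 𝔄.net I, 0 ≤ g (star a * a)) ∧
    ∀ a ∈ 𝔄.net I, ∀ b ∈ 𝔄.net I, g (a * b) = g (b * a)) :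
    ∃ τ : A →ₚ[ℂ] ℂ, IsTracialState τ := by
  choose g hg1 hgone hgpos hgtr using fun n => h (centered n)
  -- Bounded values converge along the ultrafilter, and the trace identities on any fixed interval
  -- hold for all large `n`.
  let U : Ultrafilter ℕ := Filter.hyperfilter ℕ
  have hU : (U : Filter ℕ) ≤ Filter.atTop := Nat.hyperfilter_le_atTop
  have hlim : ∀ a, ∃ c : ℂ, ‖c‖ ≤ ‖a‖ ∧ Filter.Tendsto (fun n => g n a) U (nhds c) := by
    intro a
    have hc := isCompact_iff_ultrafilter_le_nhds.1 (isCompact_closedBall (0 : ℂ) ‖a‖)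
      (U.map fun n => g n a) (by
        rw [Filter.le_principal_iff]
        refine Filter.mem_map.2 (Filter.univ_mem' fun n => ?_)
        have := (g n).le_of_opNorm_le (hg1 n) a
        simpa using this)
    obtain ⟨c, hc1, hc2⟩ := hc
    exact ⟨c, by simpa using hc1, hc2⟩
  choose t ht1 ht2 using hlim
  have hfreq : ∀ I, ∀ᶠ n in (U : Filter ℕ), I ≤ centered n := fun I =>
    (eventually_le_centered I).filter_mono hU
  let T₀ : A →ₗ[ℂ] ℂ :=
    { toFun := t
      map_add' := fun a b => by
        refine tendsto_nhds_unique (ht2 (a + b)) ?_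
        simpa only [map_add] using (ht2 a).add (ht2 b)
      map_smul' := fun c a => by
        refine tendsto_nhds_unique (ht2 (c • a)) ?_
        simpa only [map_smul, RingHom.id_apply] using (ht2 a).const_smul c }
  let T : A →L[ℂ] ℂ := T₀.mkContinuous 1 fun a => by rw [one_mul]; exact ht1 a
  have hT : ∀ a, T a = t a := fun a => rfl
  have hpos : ∀ a, 0 ≤ T (star a * a) := by
    intro a
    have hclosed : IsClosed {a : A | 0 ≤ T (star a * a)} :=
      isClosed_le continuous_const (by fun_prop)
    have hsub : (⋃ I, (𝔄.net I : Set A)) ⊆ {a : A | 0 ≤ T (star a * a)} := by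
      intro a ha
      obtain ⟨I, hI⟩ := Set.mem_iUnion.1 ha
      refine ge_of_tendsto (ht2 (star a * a)) ?_
      filter_upwards [hfreq I] with n hn
      exact hgpos n a (𝔄.net.monotone hn hI)
    exact (hclosed.closure_subset_iff.2 hsub) (𝔄.quasiLocal a)
  have htr : ∀ a b, T (a * b) = T (b * a) := by
    intro a b
    have hcl1 : ∀ b, IsClosed {a : A | T (a * b) = T (b * a)} := fun b =>
      isClosed_eq (by fun_prop) (by fun_prop)
    have hcl2 : ∀ a, IsClosed {b : A | T (a * b) = T (b * a)} := fun a =>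
      isClosed_eq (by fun_prop) (by fun_prop)
    refine ((hcl1 b).closure_subset_iff.2 fun a ha => ?_) (𝔄.quasiLocal a)
    refine ((hcl2 a).closure_subset_iff.2 fun b hb => ?_) (𝔄.quasiLocal b)
    obtain ⟨I, hI⟩ := Set.mem_iUnion.1 ha
    obtain ⟨J, hJ⟩ := Set.mem_iUnion.1 hb
    refine tendsto_nhds_unique_of_eventuallyEq (ht2 (a * b)) (ht2 (b * a)) ?_
    filter_upwards [hfreq I, hfreq J] with n hn hn'
    exact hgtr n a (𝔄.net.monotone hn hI) b (𝔄.net.monotone hn' hJ)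
  refine ⟨PositiveLinearMap.mk₀ T.toLinearMap fun x hx => ?_, ⟨?_, htr⟩⟩
  · obtain ⟨b, rfl⟩ := CStarAlgebra.nonneg_iff_eq_star_mul_self.1 hx
    exact hpos b
  · change t 1 = 1
    refine tendsto_nhds_unique (ht2 1) ?_
    simp only [hgone]
    exact tendsto_const_nhds

variable {𝔄} {τ : A →ₚ[ℂ] ℂ}

/-- A tracial state that is unique on the half lines is unique. -/
theorem isUniqueTracialState (hτ : IsTracialState τ) (h : ∀ x, HasUniqueTrace τ (𝔄.halfAlg x)) :
    IsUniqueTracialState τ := by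
  refine ⟨hτ, fun σ hσ => ?_⟩
  have hcl : IsClosed {a : A | σ a = τ a} := isClosed_eq (map_continuous σ) (map_continuous τ)
  refine PositiveLinearMap.ext fun a =>
    (hcl.closure_subset_iff.2 fun a ha => ?_) (𝔄.quasiLocal a)
  obtain ⟨I, hI⟩ := Set.mem_iUnion.1 ha
  refine h I.snd (σ.toLinearMap ∘ₗ (𝔄.halfAlg I.snd).subtype.toAlgHom.toLinearMap) ⟨?_, ?_⟩ ?_
    ⟨a, mem_halfAlg.2 ⟨I, le_rfl, hI⟩⟩
  · exact fun b => σ.map_nonneg (star_mul_self_nonneg (b : A))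
  · exact fun b c => hσ.map_mul_comm b c
  · exact hσ.map_one

/-- The trace factorizes over observables at distinct sites. -/
theorem map_mul_of_lt (hτ : IsTracialState τ) {x : ℤ} (h : HasUniqueTrace τ (𝔄.halfAlg x))
    {J : NonemptyInterval ℤ} (hJ : x < J.fst) {a b : A} (ha : a ∈ 𝔄.halfAlg x)
    (hb : b ∈ 𝔄.net J) : τ (a * b) = τ a * τ b := by
  have hcomm : ∀ d ∈ 𝔄.halfAlg x, ∀ b ∈ 𝔄.net J, b * d = d * b := by
    intro d hd b hb
    obtain ⟨I, hI, hdI⟩ := mem_halfAlg.1 hd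
    refine 𝔄.locality J I (Set.disjoint_left.2 fun k hk hk' => ?_) b hb d hdI
    have h1 : J.fst ≤ k := hk.1
    have h2 : k ≤ I.snd := hk'.2
    omega
  have key : ∀ c ∈ 𝔄.net J, τ (a * (star c * c)) = τ a * τ (star c * c) := by
    intro c hc
    -- Since `c` commutes with the half line, this is a positive trace there, hence a multiple of τ
    -- by uniqueness.
    let φ : 𝔄.halfAlg x →ₗ[ℂ] ℂ := (τ.toLinearMap ∘ₗ LinearMap.mulRight ℂ (star c * c)) ∘ₗ
      (𝔄.halfAlg x).subtype.toAlgHom.toLinearMap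
    have hφ : ∀ d, φ d = τ (d * (star c * c)) := fun d => rfl
    have hcc := mul_mem (star_mem hc) hc
    have hpos : ∀ d : 𝔄.halfAlg x, 0 ≤ φ (star d * d) := by
      intro d
      rw [hφ]
      have e : ((star d * d : 𝔄.halfAlg x) : A) * (star c * c) = star (c * d) * (c * d) := by
        change star (d : A) * d * (star c * c) = _
        rw [star_mul, mul_assoc, ← hcomm d d.2 _ hcc]
        simp only [mul_assoc]
      rw [e]
      exact τ.map_nonneg (star_mul_self_nonneg _)
    have htr : ∀ d e, φ (d * e) = φ (e * d) := by
      intro d e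
      rw [hφ, hφ]
      change τ ((d : A) * e * (star c * c)) = τ ((e : A) * d * (star c * c))
      rw [mul_assoc, ← hcomm e e.2 _ hcc, ← mul_assoc, hτ.map_mul_comm, ← mul_assoc]
    -- A functional of mass zero cannot be normalized; then `c` is null in the GNS space and both
    -- sides vanish.
    by_cases h0 : φ 1 = 0
    · have h1 : τ (star c * c) = 0 := by
        rw [hφ] at h0
        simpa using h0
      have hcs : τ (a * (star c * c)) = 0 := by
        have hz : τ.gnsStarAlgHom c (vacuum τ) = 0 := by
          rw [← inner_self_eq_zero (𝕜 := ℂ), inner_gns, h1]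
        have h3 := inner_gns (τ := τ) (c * star a) c
        rw [hz, inner_zero_right] at h3
        rw [h3, star_mul, star_star, mul_assoc]
      rw [hcs, h1, mul_zero]
    · have hφ0 : 0 ≤ φ 1 := by simpa using hpos 1
      have hinv : 0 ≤ (φ 1)⁻¹ := by
        obtain ⟨r, hr, hr'⟩ : ∃ r : ℝ, 0 ≤ r ∧ φ 1 = r :=
          ⟨(φ 1).re, (Complex.le_def.1 hφ0).1, Complex.ext rfl (Complex.le_def.1 hφ0).2.symm⟩
        rw [hr']
        exact_mod_cast inv_nonneg.2 hr
      have h1 := h ((φ 1)⁻¹ • φ) ⟨fun d => ?_, fun d e => ?_⟩ ?_ ⟨a, ha⟩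
      · rw [LinearMap.smul_apply, smul_eq_mul, inv_mul_eq_iff_eq_mul₀ h0, hφ, hφ] at h1
        have e1 : ((1 : 𝔄.halfAlg x) : A) = 1 := rfl
        rw [e1, one_mul] at h1
        rw [mul_comm (τ a)]
        exact h1
      · exact mul_nonneg hinv (hpos d)
      · rw [LinearMap.smul_apply, LinearMap.smul_apply, htr]
      · exact inv_mul_cancel₀ h0
  have h2 := LinearMap.eq_of_star_mul_self (D := 𝔄.net J)
    (φ := τ.toLinearMap ∘ₗ LinearMap.mulLeft ℂ a ∘ₗ (𝔄.net J).subtype.toAlgHom.toLinearMap)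
    (ψ := τ a • (τ.toLinearMap ∘ₗ (𝔄.net J).subtype.toAlgHom.toLinearMap))
    (fun c => key c c.2)
  exact LinearMap.congr_fun h2 ⟨b, hb⟩

end AbstractSpinChain

/-! ### Regularity of fusion spin chains -/

section FusionRegular

open CStarCategory

universe v u

variable {C : Type u} [Category.{v} C] [Abelian C] [Linear ℂ C] [MonoidalCategory C]
  [MonoidalPreadditive C] [MonoidalLinear ℂ C] [RigidCategory C] [UnitaryFusionCategory C]
  {X : C} (hX : StronglyTensorGenerating X)

lemma norm_fusionLocal (I : NonemptyInterval ℤ) (w : End (tpow X (siteCount I))) :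
    ‖fusionLocal hX I w‖ = ‖w‖ :=
  UniformSpace.Completion.norm_coe
    (AlgColimit.of (fun I J h => fusionIncl X I J h) (fusionIncl_injective hX) I w)

lemma fusionLocal_injective (I : NonemptyInterval ℤ) : Function.Injective (fusionLocal hX I) := by
  rw [injective_iff_map_eq_zero]
  intro w hw
  rw [← norm_eq_zero, ← norm_fusionLocal hX, hw, norm_zero]

/-- Tensor powers of a strongly tensor generating object are nonzero. -/
lemma StronglyTensorGenerating.id_tpow_ne_zero {X : C} (hX : StronglyTensorGenerating X) (q : ℕ) :
    𝟙 (tpow X q) ≠ 0 := by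
  intro h
  have : Simple (𝟙_ C) := IsFusion.simple_unit
  refine id_nonzero (𝟙_ C) (whiskerLeft_tpow_eq_zero hX.whiskerLeft_eq_zero q _ ?_)
  rw [whiskerLeft_id]
  have : 𝟙 (tpow X q ⊗ 𝟙_ C) = 𝟙 (tpow X q) ▷ 𝟙_ C := (id_whiskerRight _ _).symm
  rw [this, h, MonoidalPreadditive.zero_whiskerRight]

/-- Traces of the endomorphism algebras extend with norm at most one by Hahn–Banach, the local
embeddings being isometric. -/
lemma exists_isTracialState_fusion :
    ∃ τ : FusionAlgebra hX →ₚ[ℂ] ℂ, IsTracialState τ := by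
  refine (fusionSpinChain hX).exists_isTracialState fun I => ?_
  obtain ⟨σ, hσ, hσ1, hσn⟩ := exists_isEndTrace (hX.id_tpow_ne_zero (siteCount I))
  let σ' : StrongDual ℂ (End (tpow X (siteCount I))) := LinearMap.mkContinuous
    { toFun := fun f => σ f, map_add' := σ.map_add, map_smul' := σ.map_smul } 1
    fun f => (hσn f).trans_eq (one_mul _).symm
  let L : End (tpow X (siteCount I)) →ₗᵢ[ℂ] FusionAlgebra hX :=
    { (fusionLocal hX I).toAlgHom.toLinearMap with norm_map' := norm_fusionLocal hX I }
  have hL : ∀ w, L w = fusionLocal hX I w := fun _ => rfl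
  let e := L.equivRange
  have he : ∀ w, e w = ⟨L w, w, rfl⟩ := fun w => rfl
  obtain ⟨g, hg, hgn⟩ := exists_extension_norm_eq (LinearMap.range L.toLinearMap)
    (σ'.comp (e.symm : _ ≃L[ℂ] _).toContinuousLinearMap)
  have hgL : ∀ w, g (fusionLocal hX I w) = σ w := fun w => by
    rw [← hL]
    refine (hg ⟨L w, w, rfl⟩).trans ?_
    rw [← he]
    change σ' (e.symm (e w)) = σ w
    rw [e.symm_apply_apply]
    rfl
  refine ⟨g, ?_, ?_, ?_, ?_⟩
  · rw [hgn]
    refine ContinuousLinearMap.opNorm_le_bound _ zero_le_one fun a => ?_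
    change ‖σ (e.symm a)‖ ≤ _
    rw [one_mul]
    refine (hσn (e.symm a)).trans_eq ?_
    exact e.symm.norm_map a
  · rw [← map_one (fusionLocal hX I), hgL]
    exact hσ1
  · rintro _ ⟨w, rfl⟩
    change 0 ≤ g (star (fusionLocal hX I w) * fusionLocal hX I w)
    rw [← map_star, ← map_mul, hgL]
    exact hσ.nonneg w
  · rintro _ ⟨w, rfl⟩ _ ⟨z, rfl⟩
    change g (fusionLocal hX I w * fusionLocal hX I z) = g (fusionLocal hX I z * fusionLocal hX I w)
    rw [← map_mul, ← map_mul, hgL, hgL]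
    exact hσ.comm z w

/-- A trace on an algebra to which `End (X^m)` maps gives a trace on `End (X^p ⊗ X^n)`. -/
lemma exists_isEndTrace_of_trace {D : Type*} [Ring D] [StarRing D] [Algebra ℂ D] {φ : D →ₗ[ℂ] ℂ}
    (hφ : IsTraceFunctional φ) (h1 : φ 1 = 1) {p n m : ℕ} (h : p + n = m)
    (π : End (tpow X m) →⋆ₐ[ℂ] D) :
    ∃ σ : (tpow X p ⊗ tpow X n ⟶ tpow X p ⊗ tpow X n) →ₗ[ℂ] ℂ, IsEndTrace σ ∧ σ (𝟙 _) = 1 ∧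
      ∀ w : End (tpow X n), σ (tpow X p ◁ w) = φ (π (embL X h w)) := by
  let e := tpowMul X h
  let c : (tpow X p ⊗ tpow X n ⟶ tpow X p ⊗ tpow X n) → End (tpow X m) :=
    fun f => e.inv ≫ f ≫ e.hom
  have hc : ∀ f g, c (f ≫ g) = c g * c f := fun f g => by
    change e.inv ≫ (f ≫ g) ≫ e.hom = (e.inv ≫ f ≫ e.hom) ≫ (e.inv ≫ g ≫ e.hom)
    simp
  have hcs : ∀ f, c (dag f) = star (c f) := fun f => by
    change e.inv ≫ dag f ≫ e.hom = dag (e.inv ≫ f ≫ e.hom)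
    simp only [e, dag_comp, dag_tpowMul_hom, dag_tpowMul_inv, Category.assoc]
  have hca : ∀ f g, c (f + g) = c f + c g := fun f g => by
    change e.inv ≫ (f + g) ≫ e.hom = e.inv ≫ f ≫ e.hom + e.inv ≫ g ≫ e.hom
    simp
  have hcm : ∀ (r : ℂ) f, c (r • f) = r • c f := fun r f => by
    change e.inv ≫ (r • f) ≫ e.hom = r • (e.inv ≫ f ≫ e.hom)
    simp
  refine ⟨{ toFun := fun f => φ (π (c f)), map_add' := fun f g => ?_, map_smul' := fun r f => ?_ },
    ⟨fun f => ?_, fun f g => ?_⟩, ?_, fun w => rfl⟩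
  · rw [hca, map_add, map_add]
  · rw [hcm, map_smul, map_smul]
    rfl
  · change 0 ≤ φ (π (c (f ≫ dag f)))
    rw [hc, hcs, map_mul, map_star]
    exact hφ.nonneg _
  · change φ (π (c (f ≫ g))) = φ (π (c (g ≫ f)))
    rw [hc, hc, map_mul π, map_mul π, hφ.mul_comm]
  · have : c (𝟙 _) = 1 := by
      change e.inv ≫ 𝟙 _ ≫ e.hom = 𝟙 _
      simp
    change φ (π (c (𝟙 _))) = 1
    rw [this, map_one, h1]

/-- Every element of a half line algebra is of the form `1 ⊗ w`. -/
lemma exists_embL {x : ℤ} {a : FusionAlgebra hX} (ha : a ∈ (fusionSpinChain hX).halfAlg x)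
    (p : ℕ) : ∃ (J : NonemptyInterval ℤ) (_ : J.snd ≤ x) (n : ℕ) (h : p + n = siteCount J)
      (w : End (tpow X n)), fusionLocal hX J (embL X h w) = a := by
  obtain ⟨I, hI, w, rfl⟩ := AbstractSpinChain.mem_halfAlg.1 ha
  have h₁ := I.fst_le_snd
  let J : NonemptyInterval ℤ := ⟨(I.fst - p, I.snd), by simp only; omega⟩
  have hIJ : I ≤ J := ⟨by simp only [J]; omega, le_rfl⟩
  have hn : p + siteCount I = siteCount J := by simp only [siteCount, J]; omega
  refine ⟨J, hI, siteCount I, hn, w, ?_⟩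
  change _ = fusionLocal hX I w
  rw [← fusionLocal_incl hX hIJ, fusionIncl_eq X I J hIJ (p := p) (q := 0) (m := siteCount J)
    (by simp only [J]; omega) (by simp [J]) hn rfl, embR_zero]

/-- The inclusion of a local algebra in a half line algebra. -/
noncomputable def toHalfAlg {J : NonemptyInterval ℤ} {x : ℤ} (hJ : J.snd ≤ x) :
    End (tpow X (siteCount J)) →⋆ₐ[ℂ] (fusionSpinChain hX).halfAlg x :=
  (fusionLocal hX J).codRestrict _ fun w => AbstractSpinChain.mem_halfAlg.2 ⟨J, hJ, w, rfl⟩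

/-- A half line has room on the left for a power of `X` that contains all simple objects, so the
comparison constant is the same for all local elements. -/
lemma hasUniqueTrace_fusion {τ : FusionAlgebra hX →ₚ[ℂ] ℂ} (hτ : IsTracialState τ) (x : ℤ) :
    HasUniqueTrace τ ((fusionSpinChain hX).halfAlg x) := by
  obtain ⟨n₀, -, hQ⟩ := id hX
  obtain ⟨K, hK1, hK⟩ := exists_finrank_bound (tpow X n₀)
  let ψ : (fusionSpinChain hX).halfAlg x →ₗ[ℂ] ℂ :=
    τ.toLinearMap ∘ₗ ((fusionSpinChain hX).halfAlg x).subtype.toAlgHom.toLinearMap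
  have hψ : IsTraceFunctional ψ := ⟨fun b => τ.map_nonneg (star_mul_self_nonneg (b : FusionAlgebra hX)),
    fun b c => hτ.map_mul_comm b c⟩
  intro φ hφ hφ1 d
  -- `K ^ 2` may equal one, while the iteration needs a constant greater than one.
  have key := eq_of_comparable (D := (fusionSpinChain hX).halfAlg x) (K := (K ^ 2 : ℕ) + 1)
    (by
      have : 0 < K ^ 2 := by positivity
      have : (0 : ℝ) < (K ^ 2 : ℕ) := by exact_mod_cast this
      linarith) ?_ hφ hψ hφ1 hτ.map_one
  · exact LinearMap.congr_fun (LinearMap.eq_of_star_mul_self key) d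
  · intro φ ψ hφ hψ hφ1 hψ1 a
    obtain ⟨J, hJ, n, h, w, hw⟩ := exists_embL hX a.2 n₀
    obtain ⟨σ, hσ, hσ1, hσw⟩ := exists_isEndTrace_of_trace hφ hφ1 h (toHalfAlg hX hJ)
    obtain ⟨σ', hσ', hσ1', hσw'⟩ := exists_isEndTrace_of_trace hψ hψ1 h (toHalfAlg hX hJ)
    have ha : toHalfAlg hX hJ (embL X h w) = a := Subtype.ext hw
    have e : toHalfAlg hX hJ (embL X h (star w * w)) = star a * a := by
      rw [map_mul, map_mul, map_star, map_star, ha]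
    have h2 := IsEndTrace.harnack hQ hK hσ hσ1 hσ' hσ1' w
    have h3 := hσw (star w * w)
    have h3' := hσw' (star w * w)
    rw [e] at h3 h3'
    rw [← h3, ← h3']
    have h4 : 0 ≤ σ' (tpow X n₀ ◁ (star w * w : End (tpow X n))) := by
      rw [h3']
      exact hψ.nonneg a
    refine h2.trans ?_
    push_cast
    rw [add_mul, one_mul]
    exact le_add_of_nonneg_right h4

lemma faithful_fusion {τ : FusionAlgebra hX →ₚ[ℂ] ℂ} (hτ : IsTracialState τ) {x : ℤ}
    {a : FusionAlgebra hX} (ha : a ∈ (fusionSpinChain hX).halfAlg x) (h0 : τ (star a * a) = 0) :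
    a = 0 := by
  obtain ⟨n₀, -, hQ⟩ := id hX
  obtain ⟨J, hJ, n, h, w, rfl⟩ := exists_embL hX ha n₀
  obtain ⟨σ, hσ, hσ1, hσw⟩ := exists_isEndTrace_of_trace (φ := τ.toLinearMap)
    ⟨fun b => τ.map_nonneg (star_mul_self_nonneg b), hτ.map_mul_comm⟩ hτ.map_one h
    (fusionLocal hX J)
  have h2 := hσw (star w * w)
  rw [map_mul, map_mul, map_star, map_star] at h2
  have h3 : w = 0 := IsEndTrace.faithful hQ hσ hσ1 (h2.trans h0)
  rw [h3, map_zero, map_zero]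

/-! #### Non-scalar observables -/

/-- Two orthogonal isometries yield a projection that is not a scalar. -/
lemma not_scalar_of_orthogonal {S T Z : C} [Simple S] [Simple T] {f : S ⟶ Z} {g : T ⟶ Z}
    (hf : f ≫ dag f = 𝟙 S) (hg : g ≫ dag g = 𝟙 T) (hgf : g ≫ dag f = 0) (c : ℂ) :
    dag f ≫ f ≠ c • 𝟙 Z := by
  intro h
  have h1 : f ≫ dag f ≫ f = c • f := by rw [h, Linear.comp_smul, Category.comp_id]
  have h2 : g ≫ dag f ≫ f = c • g := by rw [h, Linear.comp_smul, Category.comp_id]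
  rw [← Category.assoc, hgf, Limits.zero_comp] at h2
  rw [← Category.assoc, hf, Category.id_comp] at h1
  have hg0 : g ≠ 0 := by
    rintro rfl
    rw [Limits.zero_comp] at hg
    exact id_nonzero T hg.symm
  have hc : c = 0 := (smul_eq_zero.1 h2.symm).resolve_right hg0
  rw [hc, zero_smul] at h1
  rw [h1, Limits.zero_comp] at hf
  exact id_nonzero S hf.symm

/-- If `X` is not simple, the projection onto one of its summands works. If `X` is simple, the
generating power contains both `X` and the unit, which are not isomorphic, hence orthogonal. -/
lemma exists_not_scalar {X : C} (hX : StronglyTensorGenerating X) (hX1 : IsEmpty (X ≅ 𝟙_ C)) :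
    ∃ (N : ℕ) (_ : 0 < N) (e : End (tpow X N)), ∀ c : ℂ, e ≠ c • 1 := by
  obtain ⟨m, S, v, hv⟩ := exists_isOrthDecomp (tpow X 1)
  have hS := hv.simple
  rcases m with _ | _ | m
  · exact absurd hv.id_eq_zero (hX.id_tpow_ne_zero 1)
  · obtain ⟨n₀, hn₀, hQ⟩ := id hX
    have hiso : IsIso (v 0) := by
      refine ⟨dag (v 0), hv.isometry 0, ?_⟩
      have := hv.complete
      rwa [Fin.sum_univ_one] at this
    let e : X ≅ S 0 := (λ_ X).symm ≪≫ (asIso (v 0)).symm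
    have h1 : Simple (𝟙_ C) := IsFusion.simple_unit
    have hiso1 : ∀ g : 𝟙_ C ⟶ S 0, g = 0 := fun g => by
      by_contra hg
      have := isIso_of_hom_simple hg
      exact hX1.false (e ≪≫ (asIso g).symm)
    obtain ⟨i, r, hir⟩ := hQ (𝟙_ C) h1
    obtain ⟨j, s, hjs⟩ := hQ (S 0) (hS 0)
    have hi0 : i ≠ 0 := by
      rintro rfl
      rw [Limits.zero_comp] at hir
      exact id_nonzero _ hir.symm
    have hj0 : j ≠ 0 := by
      rintro rfl
      rw [Limits.zero_comp] at hjs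
      exact id_nonzero _ hjs.symm
    obtain ⟨a, ha⟩ := exists_isometry_smul hi0
    obtain ⟨b, hb⟩ := exists_isometry_smul hj0
    exact ⟨n₀, hn₀, dag (b • j) ≫ (b • j),
      fun c => not_scalar_of_orthogonal hb ha (hiso1 _) c⟩
  · exact ⟨1, one_pos, dag (v 0) ≫ v 0, fun c => not_scalar_of_orthogonal (hv.isometry 0)
      (hv.isometry 1) (hv.orthogonal 1 0 (by simp)) c⟩

/-- There are centered nonzero observables in every interval of a fixed length. -/
lemma exists_centered (hX1 : IsEmpty (X ≅ 𝟙_ C)) {τ : FusionAlgebra hX →ₚ[ℂ] ℂ}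
    (hτ : IsTracialState τ) : ∃ N : ℕ, 0 < N ∧ ∀ J : NonemptyInterval ℤ, siteCount J = N →
      ∃ u ∈ (fusionSpinChain hX).net J, u ≠ 0 ∧ τ u = 0 := by
  obtain ⟨N, hN, e, he⟩ := exists_not_scalar hX hX1
  refine ⟨N, hN, ?_⟩
  rintro J rfl
  refine ⟨fusionLocal hX J (e - τ (fusionLocal hX J e) • 1), ⟨_, rfl⟩, fun h0 => ?_, ?_⟩
  · rw [map_eq_zero_iff _ (fusionLocal_injective hX J), sub_eq_zero] at h0
    exact he _ h0
  · rw [map_sub, map_smul, map_one, map_sub, map_smul, hτ.map_one, smul_eq_mul, mul_one, sub_self]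

/-- Centered observables in disjoint blocks are orthogonal because τ factorizes, and they have
nonzero norm because τ is faithful on local elements. -/
lemma infinite_fusion (hX1 : IsEmpty (X ≅ 𝟙_ C)) {τ : FusionAlgebra hX →ₚ[ℂ] ℂ}
    (hτ : IsTracialState τ) (x : ℤ) (n : ℕ) : ∃ p : Fin n → FusionAlgebra hX,
      (∀ i, p i ∈ (fusionSpinChain hX).halfAlg x) ∧
      (∀ i j, i ≠ j → τ (star (p i) * p j) = 0) ∧ ∀ i, τ (star (p i) * p i) ≠ 0 := by
  obtain ⟨N, hN, hu⟩ := exists_centered hX hX1 hτ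
  -- Consecutive blocks of `N` sites, laid out leftwards from `x`.
  let J : ℕ → NonemptyInterval ℤ := fun k => ⟨(x - (k + 1) * N + 1, x - k * N), by
    have : (0 : ℤ) < N := by exact_mod_cast hN
    simp only
    linarith⟩
  have hJ : ∀ k, siteCount (J k) = N := fun k => by
    have : x - (k : ℤ) * N - (x - (k + 1) * N + 1) + 1 = N := by ring
    simp only [siteCount, J]
    rw [this, Int.toNat_natCast]
  choose u hu1 hu2 hu3 using fun k => hu (J k) (hJ k)
  have hmem : ∀ (k : ℕ) (y : ℤ), x - k * N ≤ y → u k ∈ (fusionSpinChain hX).halfAlg y := fun k y hy =>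
    AbstractSpinChain.mem_halfAlg.2 ⟨J k, hy, hu1 k⟩
  have hx : ∀ k : ℕ, u k ∈ (fusionSpinChain hX).halfAlg x := fun k => hmem k x (by
    have : (0 : ℤ) ≤ k * N := by positivity
    linarith)
  have hlt : ∀ i j : ℕ, j < i → ∀ a ∈ (fusionSpinChain hX).net (J i),
      ∀ b ∈ (fusionSpinChain hX).net (J j), τ (a * b) = τ a * τ b := by
    intro i j hij a ha b hb
    refine AbstractSpinChain.map_mul_of_lt (𝔄 := fusionSpinChain hX) hτ
      (hasUniqueTrace_fusion hX hτ (x - i * N)) (J := J j) ?_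
      (AbstractSpinChain.mem_halfAlg.2 ⟨J i, le_rfl, ha⟩) hb
    change x - (i : ℤ) * N < x - (j + 1) * N + 1
    have h1 : ((j : ℤ) + 1) * N ≤ i * N := by
      refine mul_le_mul_of_nonneg_right ?_ (by positivity)
      exact_mod_cast hij
    linarith
  refine ⟨fun i => u i, fun i => hx i, fun i j hij => ?_, fun i h0 => ?_⟩
  · rcases lt_or_gt_of_ne (Fin.val_ne_of_ne hij) with h | h
    · rw [hτ.map_mul_comm, hlt j i h _ (hu1 j) _ (star_mem (hu1 i)), hu3, zero_mul]
    · rw [hlt i j h _ (star_mem (hu1 i)) _ (hu1 j), hu3 j, mul_zero]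
  · exact hu2 i (faithful_fusion hX hτ (hx i) h0)

end FusionRegular

/-! ### Finite generation over a shorter half line -/

section FusionGenerated

open CStarCategory

universe v u

variable {C : Type u} [Category.{v} C] [Abelian C] [Linear ℂ C] [MonoidalCategory C]
  [MonoidalPreadditive C] [MonoidalLinear ℂ C] [RigidCategory C] [UnitaryFusionCategory C]

/-- The identity of any object factors through a sum of copies of `Y`. -/
lemma ContainsSimples.exists_factorization {Y : C} (hY : ContainsSimples Y) (E : C) :
    ∃ (k : ℕ) (w : Fin k → (E ⟶ Y)) (v : Fin k → (Y ⟶ E)), ∑ i, w i ≫ v i = 𝟙 E := by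
  obtain ⟨m, S, t, ht⟩ := exists_isOrthDecomp E
  choose a r har using fun i => hY (S i) (ht.simple i)
  refine ⟨m, fun i => dag (t i) ≫ a i, fun i => r i ≫ t i, ?_⟩
  rw [← ht.complete]
  refine Finset.sum_congr rfl fun i _ => ?_
  rw [Category.assoc, ← Category.assoc (a i) (r i), har, Category.id_comp]

/-- `End (Z ⊗ Y ⊗ Q)` is generated by `End (Y ⊗ Q)` as a module over `End (Z ⊗ Y)`, by a set that
does not depend on `Z`. -/
lemma ContainsSimples.exists_generators {Y : C} (hY : ContainsSimples Y) (Q : C) :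
    ∃ (k : ℕ) (b : Fin k → (Y ⊗ Q ⟶ Y ⊗ Q)), ∀ (Z : C) (f : Z ⊗ (Y ⊗ Q) ⟶ (Z ⊗ Y) ⊗ Q),
      ∃ n : Fin k → (Z ⊗ Y ⟶ Z ⊗ Y), f = ∑ i, Z ◁ b i ≫ (α_ Z Y Q).inv ≫ n i ▷ Q := by
  -- Duality turns `f` into a map `g` out of `Z ⊗ ((Y ⊗ Q) ⊗ ᘁQ)`. Factoring the identity of the
  -- second tensor factor through copies of `Y` splits `g`; the `w i` give the generators,
  -- independent of `Z`, and the `v i` go into the coefficients.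
  obtain ⟨k, w, v, hwv⟩ := hY.exists_factorization ((Y ⊗ Q) ⊗ ᘁQ)
  refine ⟨k, fun i => (ρ_ (Y ⊗ Q)).inv ≫ (Y ⊗ Q) ◁ η_ (ᘁQ) Q ≫ (α_ (Y ⊗ Q) (ᘁQ) Q).inv ≫ w i ▷ Q,
    fun Z f => ?_⟩
  set g : (Z ⊗ (Y ⊗ Q)) ⊗ (ᘁQ) ⟶ Z ⊗ Y := (tensorRightHomEquiv _ (ᘁQ) Q _).symm f with hg
  have hf : f = (ρ_ (Z ⊗ (Y ⊗ Q))).inv ≫ (Z ⊗ (Y ⊗ Q)) ◁ η_ (ᘁQ) Q ≫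
      (α_ (Z ⊗ (Y ⊗ Q)) (ᘁQ) Q).inv ≫ g ▷ Q := by
    have := (tensorRightHomEquiv _ (ᘁQ) Q _).apply_symm_apply f
    rw [← hg] at this
    exact this.symm
  refine ⟨fun i => Z ◁ v i ≫ (α_ Z (Y ⊗ Q) (ᘁQ)).inv ≫ g, ?_⟩
  have hsum : g = ∑ i, (α_ Z (Y ⊗ Q) (ᘁQ)).hom ≫ Z ◁ w i ≫ Z ◁ v i ≫
      (α_ Z (Y ⊗ Q) (ᘁQ)).inv ≫ g := by
    have e : ∀ i, (α_ Z (Y ⊗ Q) (ᘁQ)).hom ≫ Z ◁ w i ≫ Z ◁ v i ≫ (α_ Z (Y ⊗ Q) (ᘁQ)).inv ≫ g =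
        (α_ Z (Y ⊗ Q) (ᘁQ)).hom ≫ (Z ◁ (w i ≫ v i)) ≫ (α_ Z (Y ⊗ Q) (ᘁQ)).inv ≫ g := fun i => by
      rw [whiskerLeft_comp, Category.assoc]
    simp only [e]
    rw [← Preadditive.comp_sum, ← Preadditive.sum_comp, ← whiskerLeft_sum, hwv]
    simp
  conv_lhs => rw [hf, hsum, sum_whiskerRight, Preadditive.comp_sum, Preadditive.comp_sum,
    Preadditive.comp_sum]
  refine Finset.sum_congr rfl fun i _ => ?_
  simp only [comp_whiskerRight, whiskerLeft_comp, Category.assoc]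
  simp

variable {X : C}

/-- The generators live on the last `n₀ + q` sites and are chosen before the number `r` of further
sites on the left; hence one set serves every interval. -/
lemma exists_generators_tpow {n₀ : ℕ} (hY : ContainsSimples (tpow X n₀)) {q a : ℕ}
    (h₁ : n₀ + q = a) : ∃ (k : ℕ) (b : Fin k → End (tpow X a)), ∀ {r d m : ℕ} (h₂ : r + a = m)
      (_ : r + n₀ = d) (h₄ : d + q = m) (F : End (tpow X m)),
      ∃ n : Fin k → End (tpow X d), F = ∑ i, embR X h₄ (n i) * embL X h₂ (b i) := by
  obtain ⟨k, b, hb⟩ := hY.exists_generators (tpow X q)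
  refine ⟨k, fun i => (tpowMul X h₁).inv ≫ b i ≫ (tpowMul X h₁).hom, fun {r d m} h₂ h₃ h₄ F => ?_⟩
  have H := tpowMul_assoc X h₃ h₄ h₁ h₂
  set e₁ := tpowMul X h₁
  set e₂ := tpowMul X h₂
  set e₃ := tpowMul X h₃
  set e₄ := tpowMul X h₄
  let F' : tpow X m ⟶ tpow X m := F
  obtain ⟨n, hn⟩ := hb (tpow X r) (tpow X r ◁ e₁.hom ≫ e₂.hom ≫ F' ≫ e₄.inv ≫ e₃.inv ▷ tpow X q)
  refine ⟨fun i => e₃.inv ≫ n i ≫ e₃.hom, ?_⟩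
  have hF : F' = e₂.inv ≫ tpow X r ◁ e₁.inv ≫
      (∑ i, tpow X r ◁ b i ≫ (α_ (tpow X r) (tpow X n₀) (tpow X q)).inv ≫ n i ▷ tpow X q) ≫
      e₃.hom ▷ tpow X q ≫ e₄.hom := by
    rw [← hn]
    simp [← comp_whiskerRight_assoc, ← whiskerLeft_comp_assoc]
  refine hF.trans ?_
  rw [Preadditive.sum_comp, Preadditive.comp_sum, Preadditive.comp_sum]
  refine Finset.sum_congr rfl fun i _ => ?_
  change _ = (e₂.inv ≫ (tpow X r ◁ (e₁.inv ≫ b i ≫ e₁.hom)) ≫ e₂.hom) ≫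
    (e₄.inv ≫ ((e₃.inv ≫ n i ≫ e₃.hom) ▷ tpow X q) ≫ e₄.hom)
  have H' : (α_ (tpow X r) (tpow X n₀) (tpow X q)).inv =
      tpow X r ◁ e₁.hom ≫ e₂.hom ≫ e₄.inv ≫ e₃.inv ▷ tpow X q := by
    rw [← cancel_epi (α_ (tpow X r) (tpow X n₀) (tpow X q)).hom, Iso.hom_inv_id]
    have H2 := congrArg (· ≫ e₄.inv ≫ e₃.inv ▷ tpow X q) H
    simp only [Category.assoc, Iso.hom_inv_id_assoc] at H2
    rw [← H2, ← comp_whiskerRight, Iso.hom_inv_id, id_whiskerRight]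
  rw [H']
  simp only [whiskerLeft_comp, comp_whiskerRight, Category.assoc]

variable (hX : StronglyTensorGenerating X)

lemma generated_fusion {x z : ℤ} (hxz : x ≤ z) :
    ∃ (k : ℕ) (b : Fin k → FusionAlgebra hX), (∀ i, b i ∈ (fusionSpinChain hX).halfAlg z) ∧
      ∀ f ∈ (fusionSpinChain hX).halfAlg z, ∃ n : Fin k → FusionAlgebra hX,
        (∀ i, n i ∈ (fusionSpinChain hX).halfAlg x) ∧ f = ∑ i, n i * b i := by
  obtain ⟨n₀, hn₀, hY⟩ := id hX
  obtain ⟨q, hq⟩ := Int.eq_ofNat_of_zero_le (sub_nonneg.2 hxz)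
  -- The interval consists of the `n₀` sites up to `x`, which supply all simple objects, and the `q
  -- = z - x` sites beyond.
  let I : NonemptyInterval ℤ := ⟨(x + 1 - n₀, z), by simp only; omega⟩
  have h₁ : n₀ + q = siteCount I := by simp only [siteCount, I]; omega
  obtain ⟨k, b, hb⟩ := exists_generators_tpow hY h₁
  refine ⟨k, fun i => fusionLocal hX I (b i), fun i =>
    AbstractSpinChain.mem_halfAlg.2 ⟨I, le_rfl, b i, rfl⟩, fun f hf => ?_⟩
  obtain ⟨I', hI', hfI'⟩ := AbstractSpinChain.mem_halfAlg.1 hf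
  have hI'1 := I'.fst_le_snd
  -- The support of `f` is enlarged to an interval ending at `z` that contains `I`, so that `f`
  -- splits over the generators on `I`.
  obtain ⟨r, hr⟩ : ∃ r : ℕ, x + 1 - n₀ - r ≤ I'.fst :=
    ⟨(x + 1 - n₀ - I'.fst).toNat, by omega⟩
  let J : NonemptyInterval ℤ := ⟨(x + 1 - n₀ - r, z), by simp only; omega⟩
  let L : NonemptyInterval ℤ := ⟨(x + 1 - n₀ - r, x), by simp only; omega⟩
  obtain ⟨F, rfl⟩ := (fusionSpinChain hX).net.monotone (⟨hr, hI'⟩ : I' ≤ J) hfI'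
  have h₂ : r + siteCount I = siteCount J := by simp only [siteCount, I, J]; omega
  have h₃ : r + n₀ = siteCount L := by simp only [siteCount, L]; omega
  have h₄ : siteCount L + q = siteCount J := by simp only [siteCount, L, J]; omega
  obtain ⟨n, hn⟩ := hb h₂ h₃ h₄ F
  refine ⟨fun i => fusionLocal hX L (n i), fun i =>
    AbstractSpinChain.mem_halfAlg.2 ⟨L, le_rfl, n i, rfl⟩, ?_⟩
  have hIJ : I ≤ J := ⟨by simp only [I, J]; omega, le_rfl⟩
  have hLJ : L ≤ J := ⟨le_rfl, hxz⟩
  change fusionLocal hX J F = _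
  conv_lhs => rw [hn]
  rw [map_sum]
  refine Finset.sum_congr rfl fun i _ => ?_
  change _ = fusionLocal hX L (n i) * fusionLocal hX I (b i)
  rw [map_mul, ← fusionLocal_incl hX hIJ, ← fusionLocal_incl hX hLJ,
    fusionIncl_eq X I J hIJ (p := r) (q := 0) (m := siteCount J) (by simp only [I, J]; omega)
      (by simp [I, J]) h₂ rfl, embR_zero,
    fusionIncl_eq X L J hLJ (p := 0) (q := q) (m := siteCount L) (by simp [L, J])
      (by simp only [L, J]; omega) (Nat.zero_add _) h₄, embL_zero]

theorem exists_isRegular_fusion (hX1 : IsEmpty (X ≅ 𝟙_ C)) :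
    ∃ τ : FusionAlgebra hX →ₚ[ℂ] ℂ, (fusionSpinChain hX).IsRegular τ := by
  obtain ⟨τ, hτ⟩ := exists_isTracialState_fusion hX
  have hu := hasUniqueTrace_fusion hX hτ
  exact ⟨τ, AbstractSpinChain.isUniqueTracialState hτ hu, hu, infinite_fusion hX hX1 hτ,
    fun _ _ h => generated_fusion hX h⟩

end FusionGenerated

theorem mainTheorem3 {C : Type*} [Category C] [Abelian C]
    [Linear ℂ C] [MonoidalCategory C]
    [MonoidalPreadditive C] [MonoidalLinear ℂ C]
    [RigidCategory C] [UnitaryFusionCategory C] (X : C)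
    (hX : StronglyTensorGenerating X)
    (hX1 : IsEmpty (X ≅ 𝟙_ C)) :
    -- there is a unique tracial state `τ`
    ∃ (τ : FusionAlgebra hX →ₚ[ℂ] ℂ) (hτ : IsUniqueTracialState τ),
      (fusionSpinChain hX).FiniteIndexProperty τ ∧
      (∀ x : ℤ, ((fusionSpinChain hX).leftAlgebra τ x).IsIIOneFactor) ∧
      -- the index is defined for every cellular automaton
      (∀ α : (fusionSpinChain hX).QCA, ∃ x y : ℤ, y ≤ x ∧
        (fusionSpinChain hX).leftAlgebra τ y ≤ (fusionSpinChain hX).imageAlgebra hτ α x) ∧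
      -- it does not depend on choices and is a homomorphism on the quotient group `QCA / FDQC`
      ∃ _ : (fusionSpinChain hX).FDQC.Normal,
        ∃! ind : (fusionSpinChain hX).QCA ⧸ (fusionSpinChain hX).FDQC →* {r : ℝ // 0 < r},
          ∀ (α : (fusionSpinChain hX).QCA) (x y : ℤ), y ≤ x →
            (fusionSpinChain hX).leftAlgebra τ y ≤ (fusionSpinChain hX).imageAlgebra hτ α x →
            (ind (QuotientGroup.mk α) : ℝ) = (fusionSpinChain hX).indexRatio hτ α x y := by
  obtain ⟨τ, h⟩ := exists_isRegular_fusion hX hX1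
  exact ⟨τ, h.trace, h.main⟩
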